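/- **Setting.** Let $d\ge 1$ and $0<s\le 2$, and let $C,C',C'',\varepsilon,c,c',c'',a,a',M>0$. Assume: * (kernel) $K_0:\mathbb R\to[0,\infty)$ satisfies $K_0\le C$, $\int K_0=1$, $\int xK_0(x)\,dx=0$, $\int x^2K_0(x)\,dx\le C'$ and $|K_0(y)-K_0(x)|\le C''|x-y|^{\varepsilon}$ for all $x,y$; put $K(x)=\prod_{i=1}^d K_0(x_i)$ for $x\in\mathbb R^d$; * (target) $f$ is a probability density on $\mathbb R^d$ with $f(x)\le c\,e^{-c'\|x\|_2^2}$ and $|f(x+u)-f(x)-\langle\nabla f(x),u\rangle\mathbf 1\{s>1\}|\le c''\|u\|_2^{s}$ for all $x,u\in\mathbb R^d$; * (initial proposal) $g$ is a probability density on $\mathbb R^d$ with $f\le Mg$ and $g(x)\le a\,e^{-a'\|x\|_2^2}$ for all $x\in\mathbb R^d$. Put $v=\frac{2}{\min(1,s)}\log\left(1+\frac1{c''+c}\right)+\frac3\varepsilon\log\left(1+\frac1{C''c}\right)$ and $H_1=8d(v+1)\left(2\sqrt{cC^d}+c''(1+C')d+C^d\right)$, and let $H_E>0$ with $H_E\ge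 H_1$. **Algorithm** (extended pliable rejection sampling; budget of $n$ calls to $f$; $\delta\in(0,1)$). Let $T_s=\lceil n^{(2s+d)/(3s+d)}\rceil$ and $\bar N=T_s/M-2\sqrt{T_s\log(1/\delta)}$. Let $B(\rho)$ be the centred ball of radius $\rho$ in $\mathbb R^d$, and let $\mathcal V_n$ be the volume of $B(\log n)$. Put $$r=\mathcal V_nH_E\left(\frac{\log(\bar N/\delta)}{\bar N}\right)^{\frac{s}{2s+d}},\qquad \bar g=\int_{B(\log\bar N)^c}g(x)\,dx,\qquad W=1+r+M\bar g .$$ 1. Draw $T_s$ points independently from $g$ and accept each point $X$ with probability $f(X)/(Mg(X))$. Let $X_1,\dots,X_{\hat N}$ be the accepted points, $h=\left(\log(\hat N/\delta)/\hat N\right)^{1/(2s+d)}$ and $$\tilde f(x)=\mathbf 1\{\|x\|_2\le\log\hat N\}\,\frac1{\hat Nh^d}\sum_{k=1}^{\hat N}K\left(\frac{X_k-x}{h}\right).$$ 2. Let $\hat g^\star(x)=\frac1W\left(\tilde f(x)+\frac{r}{\mathcal V_n}\mathbf 1\{x\in B(\log n)\}+Mg(x)\mathbf 1\{\|x\|_2\ge\log\bar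 N\}\right)$. Given the first stage, draw $n-T_s$ points independently from the probability distribution proportional to $\hat g^\star$, and accept each point $Y$ with probability $\min\{1,f(Y)/(W\hat g^\star(Y))\}$. Output the $\hat n$ accepted points. **Theorem.** There is a constant $\kappa>0$, depending only on $d,s,C,C',C'',\varepsilon,c,c',c'',a,a',M,H_E$, such that for every $\delta\in(0,1)$ there is $n_0$, depending only on these constants and on $\delta$, such that for all $n\ge n_0$ and all $K_0,f,g$ as above there is an event $G$, determined by the first stage, with the following two properties. * Given any first-stage outcome in $G$, the output is i.i.d. with density $f$: for every $k$, conditionally on $\hat n=k$, the $k$ returned points, in the order in which they were drawn, are independent with density $f$. * With probability at least $1-\delta$, the event $G$ occurs and $$\hat n\ \ge\ n\left[1-\kappa\,\log(n/\delta)^{d+1}\,n^{-\frac{s}{3s+d}}\right].$$ -/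

import Mathlib

open MeasureTheory

noncomputable section

namespace EPRS

/-! ## Assumptions -/

/-- Assumption on the univariate kernel `K₀`: a density bounded by `C`, centred, with second moment
at most `C'`, and `ε`-Hölder with constant `C''`. -/
structure KernelAssumption (K₀ : ℝ → ℝ) (C C' C'' ε : ℝ) : Prop where
  nonneg : ∀ x, 0 ≤ K₀ x
  le_bound : ∀ x, K₀ x ≤ C
  integral_eq_one : ∫ x, K₀ x = 1
  integral_mul_eq_zero : ∫ x, x * K₀ x = 0
  integrable_sq_mul : Integrable fun x => x ^ 2 * K₀ x
  integral_sq_mul_le : ∫ x, x ^ 2 * K₀ x ≤ C'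
  holder : ∀ x y, |K₀ y - K₀ x| ≤ C'' * |x - y| ^ ε

/-- `f` is a probability density with respect to Lebesgue measure on `ℝ^d`. -/
structure IsDensity {d : ℕ} (f : EuclideanSpace ℝ (Fin d) → ℝ) : Prop where
  measurable : Measurable f
  nonneg : ∀ x, 0 ≤ f x
  integral_eq_one : ∫ x, f x = 1

/-- Assumption on the target: a sub-Gaussian density with a uniform Taylor expansion of order `s`.
For `1 < s` the inequality forces `f` to be differentiable, whatever value `gradient f x` has at
points where this is not known beforehand. -/
structure TargetAssumption {d : ℕ} (f : EuclideanSpace ℝ (Fin d) → ℝ) (s c c' c'' : ℝ) : Prop where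
  isDensity : IsDensity f
  subGaussian : ∀ x, f x ≤ c * Real.exp (-c' * ‖x‖ ^ 2)
  taylor : ∀ x u, |f (x + u) - f x - (if 1 < s then inner ℝ (gradient f x) u else 0)|
    ≤ c'' * ‖u‖ ^ s

/-- Assumption on the initial proposal: a sub-Gaussian density `g` with `f ≤ M g`. -/
structure ProposalAssumption {d : ℕ} (f g : EuclideanSpace ℝ (Fin d) → ℝ) (M a a' : ℝ) :
    Prop where
  isDensity : IsDensity g
  le_mul : ∀ x, f x ≤ M * g x
  subGaussian : ∀ x, g x ≤ a * Real.exp (-a' * ‖x‖ ^ 2)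

/-! ## Constants -/

/-- The exponent `v` that enters the constant of the uniform kernel density bound. -/
def vConst (s ε c c'' C'' : ℝ) : ℝ :=
  Real.log (1 + 1 / (c'' + c)) * (2 / min 1 s) + 3 / ε * Real.log (1 + 1 / (C'' * c))

/-- The constant `H₁` of the uniform kernel density bound. -/
def H₁ (d : ℕ) (s ε c c'' C C' C'' : ℝ) : ℝ :=
  8 * d * (vConst s ε c c'' C'' + 1) * (2 * √(c * C ^ d) + c'' * (1 + C') * d + C ^ d)

/-- `T_s`: number of calls to `f` in the initial stage. -/
def initCalls (d : ℕ) (s : ℝ) (n : ℕ) : ℕ :=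
  ⌈(n : ℝ) ^ ((2 * s + d) / (3 * s + d))⌉₊

/-- `N̄`: the high-probability lower bound on the number of samples of the initial stage. -/
def Nbar (d : ℕ) (s M δ : ℝ) (n : ℕ) : ℝ :=
  initCalls d s n / M - 2 * √(initCalls d s n * Real.log (1 / δ))

/-- `𝒱_n`: the volume of the centred ball of radius `log n` of `ℝ^d`. -/
def ballVol (d n : ℕ) : ℝ :=
  volume.real (Metric.closedBall (0 : EuclideanSpace ℝ (Fin d)) (Real.log n))

/-- `r_N̄`. -/
def rBar (d : ℕ) (s M δ H : ℝ) (n : ℕ) : ℝ :=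
  ballVol d n * H * (Real.log (Nbar d s M δ n / δ) / Nbar d s M δ n) ^ (s / (2 * s + d))

/-- `ḡ_N̄`: the mass of `g` outside the centred ball of radius `log N̄`. -/
def gBar {d : ℕ} (g : EuclideanSpace ℝ (Fin d) → ℝ) (s M δ : ℝ) (n : ℕ) : ℝ :=
  ∫ x in (Metric.closedBall (0 : EuclideanSpace ℝ (Fin d)) (Real.log (Nbar d s M δ n)))ᶜ, g x

/-- The normalisation, and rejection constant of the second stage: `1 + r_N̄ + M ḡ_N̄`. -/
def rejConst {d : ℕ} (g : EuclideanSpace ℝ (Fin d) → ℝ) (s M δ H : ℝ) (n : ℕ) : ℝ :=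
  1 + rBar d s M δ H n + M * gBar g s M δ n

/-! ## Rejection sampling -/

/-- The measure with density `f` with respect to Lebesgue measure. -/
def densityMeasure {d : ℕ} (f : EuclideanSpace ℝ (Fin d) → ℝ) :
    Measure (EuclideanSpace ℝ (Fin d)) :=
  volume.withDensity fun x => ENNReal.ofReal (f x)

/-- The probability distribution proportional to `q`. -/
def normalizedLaw {d : ℕ} (q : EuclideanSpace ℝ (Fin d) → ℝ) :
    Measure (EuclideanSpace ℝ (Fin d)) :=
  (densityMeasure q Set.univ)⁻¹ • densityMeasure q

/-- Law of `m` independent pairs (proposed point, uniform variable on `[0,1]`), the points being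
drawn from the distribution proportional to `q`. -/
def drawLaw {d : ℕ} (m : ℕ) (q : EuclideanSpace ℝ (Fin d) → ℝ) :
    Measure (Fin m → EuclideanSpace ℝ (Fin d) × ℝ) :=
  Measure.pi fun _ => (normalizedLaw q).prod (volume.restrict (Set.Icc 0 1))

open Classical in
/-- Rejection sampling towards `f` with envelope `e`: the point `x` with uniform variable `u` is
accepted when `u * e x ≤ f x`. Returns the set of the indices of the accepted points. -/
def accepted {d m : ℕ} (f e : EuclideanSpace ℝ (Fin d) → ℝ)
    (y : Fin m → EuclideanSpace ℝ (Fin d) × ℝ) : Finset (Fin m) :=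
  Finset.univ.filter fun i => (y i).2 * e (y i).1 ≤ f (y i).1

/-- The accepted points, in the order in which they were proposed, on the event that there are
`k` of them. -/
def output {d m k : ℕ} (f e : EuclideanSpace ℝ (Fin d) → ℝ)
    (y : Fin m → EuclideanSpace ℝ (Fin d) × ℝ) (h : (accepted f e y).card = k) :
    Fin k → EuclideanSpace ℝ (Fin d) :=
  fun i => (y ((accepted f e y).orderEmbOfFin h i)).1

/-- When the pairs have law `P`, the accepted points are i.i.d. with density `f`: given that their
number is `k`, for any `k`, their joint law is the `k`-fold product of the law with density `f`. -/
def OutputIID {d m : ℕ} (P : Measure (Fin m → EuclideanSpace ℝ (Fin d) × ℝ))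
    (f e : EuclideanSpace ℝ (Fin d) → ℝ) : Prop :=
  ∀ (k : ℕ) (B : Set (Fin k → EuclideanSpace ℝ (Fin d))), MeasurableSet B →
    P {y | ∃ h : (accepted f e y).card = k, output f e y h ∈ B} =
      P {y | (accepted f e y).card = k} * Measure.pi (fun _ : Fin k => densityMeasure f) B

/-! ## The algorithm -/

/-- The bandwidth `h` for `N` samples. -/
def bandwidth (d : ℕ) (s δ : ℝ) (N : ℕ) : ℝ :=
  (Real.log (N / δ) / N) ^ (1 / (2 * s + d))

/-- The estimate `f̃`: the kernel density estimate built on the `N̂` points of the initial stage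
accepted by rejection sampling with envelope `M g`, set to `0` outside the centred ball of radius
`log N̂`. -/
def fTilde {d T : ℕ} (K₀ : ℝ → ℝ) (f g : EuclideanSpace ℝ (Fin d) → ℝ) (s M δ : ℝ)
    (w : Fin T → EuclideanSpace ℝ (Fin d) × ℝ) (x : EuclideanSpace ℝ (Fin d)) : ℝ :=
  let S := accepted f (fun z => M * g z) w
  let h := bandwidth d s δ S.card
  if ‖x‖ ≤ Real.log S.card then
    1 / (S.card * h ^ d) * ∑ k ∈ S, ∏ i, K₀ (((w k).1 i - x i) / h)
  else 0

open Classical in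
/-- The pliable proposal `ĝ⋆`, given the outcome `w` of the initial stage. -/
def pliable {d T : ℕ} (K₀ : ℝ → ℝ) (f g : EuclideanSpace ℝ (Fin d) → ℝ) (s M δ H : ℝ) (n : ℕ)
    (w : Fin T → EuclideanSpace ℝ (Fin d) × ℝ) (x : EuclideanSpace ℝ (Fin d)) : ℝ :=
  1 / rejConst g s M δ H n *
    (fTilde K₀ f g s M δ w x
      + rBar d s M δ H n *
        (if x ∈ Metric.closedBall 0 (Real.log n) then 1 / ballVol d n else 0)
      + if Real.log (Nbar d s M δ n) ≤ ‖x‖ then M * g x else 0)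

/-- The envelope of the second stage: rejection constant times pliable proposal. -/
def envelope {d T : ℕ} (K₀ : ℝ → ℝ) (f g : EuclideanSpace ℝ (Fin d) → ℝ) (s M δ H : ℝ) (n : ℕ)
    (w : Fin T → EuclideanSpace ℝ (Fin d) × ℝ) (x : EuclideanSpace ℝ (Fin d)) : ℝ :=
  rejConst g s M δ H n * pliable K₀ f g s M δ H n w x

/-- Law of the initial stage: `T_s` draws from `g`. -/
def stageOneLaw {d : ℕ} (g : EuclideanSpace ℝ (Fin d) → ℝ) (s : ℝ) (n : ℕ) :
    Measure (Fin (initCalls d s n) → EuclideanSpace ℝ (Fin d) × ℝ) :=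
  drawLaw (initCalls d s n) g

/-- Conditional law of the second stage given the outcome `w` of the initial stage: `n - T_s`
draws from the pliable proposal built on `w`. -/
def stageTwoLaw {d : ℕ} (K₀ : ℝ → ℝ) (f g : EuclideanSpace ℝ (Fin d) → ℝ) (s M δ H : ℝ) (n : ℕ)
    (w : Fin (initCalls d s n) → EuclideanSpace ℝ (Fin d) × ℝ) :
    Measure (Fin (n - initCalls d s n) → EuclideanSpace ℝ (Fin d) × ℝ) :=
  drawLaw (n - initCalls d s n) (pliable K₀ f g s M δ H n w)

/-- Joint law of the two stages of a run with a budget of `n` calls to `f`. -/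
def runLaw {d : ℕ} (K₀ : ℝ → ℝ) (f g : EuclideanSpace ℝ (Fin d) → ℝ) (s M δ H : ℝ) (n : ℕ) :
    Measure ((Fin (initCalls d s n) → EuclideanSpace ℝ (Fin d) × ℝ) ×
      (Fin (n - initCalls d s n) → EuclideanSpace ℝ (Fin d) × ℝ)) :=
  (stageOneLaw g s n).bind fun w =>
    (stageTwoLaw K₀ f g s M δ H n w).map fun y => (w, y)

/-- `n̂`: the number of samples returned by a run, i.e. accepted in the second stage. -/
def numOutput {d : ℕ} (K₀ : ℝ → ℝ) (f g : EuclideanSpace ℝ (Fin d) → ℝ) (s M δ H : ℝ) (n : ℕ)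
    (ω : (Fin (initCalls d s n) → EuclideanSpace ℝ (Fin d) × ℝ) ×
      (Fin (n - initCalls d s n) → EuclideanSpace ℝ (Fin d) × ℝ)) : ℕ :=
  (accepted f (envelope K₀ f g s M δ H n ω.1) ω.2).card

end EPRS

end

noncomputable section

namespace EPRS

/-! ## A Bernstein-type inequality for product measures -/

/-! Rejection sampling is exact as soon as its envelope dominates the target: accepted points are
then i.i.d. with density `f` given their number (`outputIID_drawLaw`). The event `G` therefore only
has to force `f ≤ envelope`. Outside the ball of radius `log N̄` the term `M g` does this alone.
Inside, the constant `r / 𝒱_n = H (log(N̄/δ)/N̄)^(s/(2s+d))` must make up for the error of the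
kernel estimate, so a one-sided uniform bound `f ≤ estimate + H h^s` suffices.

The initial stage is itself rejection sampling. Given that `k` points are accepted they are i.i.d.
from `f`, so the bound can be proved for each fixed sample size `k > N̄` and then summed over `k`
(`mul_le_drawLaw_real_goodEvent`). The bias is of order `h^s` by Taylor expansion against a centred
kernel. The deviation is handled by a Bernstein inequality and two nets (`exists_event_of_nets`,
`eventually_exists_uniform_event`). On a coarse net of mesh `1/k` the identity `k h^(2s+d) =
log(k/δ)` makes the exponent a multiple of `log(k/δ)` that beats the cardinality. Passing to a net
of mesh `k^(-B)` costs increments of much smaller variance, whose exponent is an arbitrarily large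
multiple of `log k`; hence `B`, of order `1/ε`, does not enter the constant. Beyond the fine net
Hölder continuity is enough.

For the count, the proposal has mass at most one, so a second-stage draw is accepted with
probability at least `1/W`, and `W - 1` is bounded by a multiple of the rate `log(n/δ)^(d+1)
n^(-s/(3s+d))` (`rejConst_le`). The initial stage uses about `n^(1 - s/(3s+d))` calls, the choice
that balances its cost against `r`, and the fluctuation of the count is of order `√n`, which is
smaller. A lower tail bound for the binomial count then concludes. -/

theorem exp_le_one_add_add_sq {x : ℝ} (hx : x ≤ 1) : Real.exp x ≤ 1 + x + x ^ 2 := by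
  rcases le_total (-1) x with h | h
  · have := Real.abs_exp_sub_one_sub_id_le (abs_le.2 ⟨h, hx⟩)
    linarith [(abs_le.1 this).2]
  · have : Real.exp x ≤ 1 := Real.exp_le_one_iff.2 (by linarith)
    nlinarith

theorem integrable_of_abs_le {Ω : Type*} [MeasurableSpace Ω] {μ : Measure Ω} [IsFiniteMeasure μ]
    {Y : Ω → ℝ} (hY : Measurable Y) {B : ℝ} (hB : ∀ x, |Y x| ≤ B) : Integrable Y μ :=
  Integrable.of_bound hY.aestronglyMeasurable B (ae_of_all _ hB)

/-- The inequality `exp x ≤ 1 + x + x²` needs only `x ≤ 1`, so just the upper bound `b` restricts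
`l`. The two-sided bound `B` serves integrability alone; this asymmetry matters for kernels, which
are large only on one side. -/
theorem integral_exp_mul_le {Ω : Type*} [MeasurableSpace Ω] {μ : Measure Ω}
    [IsProbabilityMeasure μ] {Y : Ω → ℝ} (hY : Measurable Y) {B b σ l : ℝ} (hB : ∀ x, |Y x| ≤ B)
    (hb : ∀ x, Y x ≤ b) (h0 : ∫ x, Y x ∂μ = 0) (h2 : ∫ x, Y x ^ 2 ∂μ ≤ σ) (hl : 0 ≤ l)
    (hlb : l * b ≤ 1) :
    Integrable (fun x => Real.exp (l * Y x)) μ ∧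
      ∫ x, Real.exp (l * Y x) ∂μ ≤ Real.exp (l ^ 2 * σ) := by
  have i1 : Integrable Y μ := integrable_of_abs_le hY hB
  have i2 : Integrable (fun x => Y x ^ 2) μ := by
    refine integrable_of_abs_le (hY.pow_const 2) (B := B ^ 2) fun x => ?_
    rw [abs_pow]
    exact pow_le_pow_left₀ (abs_nonneg _) (hB x) 2
  have hle : ∀ x, l * Y x ≤ 1 := fun x => (mul_le_mul_of_nonneg_left (hb x) hl).trans hlb
  have i3 : Integrable (fun x => Real.exp (l * Y x)) μ := by
    refine integrable_of_abs_le (hY.const_mul l).exp (B := Real.exp 1) fun x => ?_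
    rw [abs_of_pos (Real.exp_pos _)]
    exact Real.exp_le_exp.2 (hle x)
  refine ⟨i3, ?_⟩
  calc ∫ x, Real.exp (l * Y x) ∂μ ≤ ∫ x, (1 + l * Y x + l ^ 2 * Y x ^ 2) ∂μ := by
        refine integral_mono i3 (((integrable_const _).add (i1.const_mul l)).add
          (i2.const_mul (l ^ 2))) fun x => ?_
        have := exp_le_one_add_add_sq (hle x)
        rwa [mul_pow] at this
    _ = 1 + l ^ 2 * ∫ x, Y x ^ 2 ∂μ := by
        rw [integral_add (f := fun x => 1 + l * Y x) ((integrable_const _).add (i1.const_mul l))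
          (i2.const_mul (l ^ 2)), integral_add (integrable_const _) (i1.const_mul l),
          integral_const_mul, integral_const_mul, h0]
        simp
    _ ≤ l ^ 2 * σ + 1 := by nlinarith [sq_nonneg l]
    _ ≤ _ := Real.add_one_le_exp _

/-- Bernstein-type upper tail bound for a sum of independent copies of a centred variable. -/
theorem pi_real_sum_ge_le {Ω : Type*} [MeasurableSpace Ω] {μ : Measure Ω}
    [IsProbabilityMeasure μ] {Y : Ω → ℝ} (hY : Measurable Y) {B b σ l : ℝ} (hB : ∀ x, |Y x| ≤ B)
    (hb : ∀ x, Y x ≤ b) (h0 : ∫ x, Y x ∂μ = 0) (h2 : ∫ x, Y x ^ 2 ∂μ ≤ σ) (hl : 0 ≤ l)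
    (hlb : l * b ≤ 1) (N : ℕ) (t : ℝ) :
    (Measure.pi fun _ : Fin N => μ).real {x | t ≤ ∑ j, Y (x j)} ≤
      Real.exp (N * (l ^ 2 * σ) - l * t) := by
  obtain ⟨i3, hE⟩ := integral_exp_mul_le hY hB hb h0 h2 hl hlb
  have hprod : Integrable (fun x : Fin N → Ω => ∏ j, Real.exp (l * Y (x j)))
      (Measure.pi fun _ => μ) := Integrable.fintype_prod fun _ => i3
  have hM := mul_meas_ge_le_integral_of_nonneg (μ := Measure.pi fun _ : Fin N => μ)
    (ae_of_all _ fun x => Finset.prod_nonneg fun j _ => (Real.exp_pos _).le) hprod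
    (Real.exp (l * t))
  rw [integral_fintype_prod_eq_prod (fun _ : Fin N => fun x => Real.exp (l * Y x)),
    Finset.prod_const, Finset.card_univ, Fintype.card_fin] at hM
  have hsub : (Measure.pi fun _ : Fin N => μ).real {x | t ≤ ∑ j, Y (x j)} ≤
      (Measure.pi fun _ : Fin N => μ).real
        {x | Real.exp (l * t) ≤ ∏ j, Real.exp (l * Y (x j))} := by
    refine measureReal_mono fun x hx => ?_
    simp only [Set.mem_ofPred_eq] at hx ⊢
    rw [← Real.exp_sum, ← Finset.mul_sum]
    exact Real.exp_le_exp.2 (mul_le_mul_of_nonneg_left hx hl)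
  have hpow : (∫ x, Real.exp (l * Y x) ∂μ) ^ N ≤ Real.exp (N * (l ^ 2 * σ)) := by
    rw [Real.exp_nat_mul]
    exact pow_le_pow_left₀ (integral_nonneg fun x => (Real.exp_pos _).le) hE N
  rw [Real.exp_sub, le_div_iff₀' (Real.exp_pos _)]
  exact (mul_le_mul_of_nonneg_left hsub (Real.exp_pos _).le).trans (hM.trans hpow)

open Classical in
/-- Lower tail of the number of successes in independent trials. -/
theorem pi_real_card_le {Ω : Type*} [MeasurableSpace Ω] {μ : Measure Ω} [IsProbabilityMeasure μ]
    {A : Set Ω} (hA : MeasurableSet A) {l : ℝ} (hl : 0 ≤ l) (hl1 : l ≤ 1) (N : ℕ) (u : ℝ) :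
    (Measure.pi fun _ : Fin N => μ).real
      {y | ((Finset.univ.filter fun i => y i ∈ A).card : ℝ) ≤ N * μ.real A - u} ≤
      Real.exp (N * (l ^ 2 * (1 / 4)) - l * u) := by
  set p := μ.real A with hp
  have hp0 : 0 ≤ p := measureReal_nonneg
  have hp1 : p ≤ 1 := measureReal_le_one
  let Y : Ω → ℝ := fun x => p - A.indicator 1 x
  have hind : Measurable (A.indicator (1 : Ω → ℝ)) := measurable_one.indicator hA
  have hY : Measurable Y := measurable_const.sub hind
  have hI : Integrable (A.indicator (1 : Ω → ℝ)) μ := (integrable_const (1 : ℝ)).indicator hA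
  have hint : ∫ x, A.indicator (1 : Ω → ℝ) x ∂μ = p := integral_indicator_one hA
  have h0 : ∫ x, Y x ∂μ = 0 := by
    simp only [Y]
    rw [integral_sub (integrable_const _) hI, hint]
    simp
  have hcase : ∀ x, A.indicator (1 : Ω → ℝ) x = 0 ∨ A.indicator (1 : Ω → ℝ) x = 1 := fun x => by
    by_cases h : x ∈ A <;> simp [h]
  -- The variance is `p (1 - p)`, at most `1/4` whatever `p` is.
  have h2 : ∫ x, Y x ^ 2 ∂μ ≤ 1 / 4 := by
    have : ∀ x, Y x ^ 2 = p ^ 2 + (1 - 2 * p) * A.indicator (1 : Ω → ℝ) x := fun x => by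
      rcases hcase x with h | h <;> simp only [Y, h] <;> ring
    simp_rw [this]
    rw [integral_add (integrable_const _) (hI.const_mul _), integral_const_mul, hint]
    simp only [integral_const, probReal_univ, smul_eq_mul]
    nlinarith [sq_nonneg (p - 1 / 2)]
  have hb : ∀ x, Y x ≤ 1 := fun x => by
    rcases hcase x with h | h <;> simp only [Y, h] <;> linarith
  have hB : ∀ x, |Y x| ≤ 1 := fun x => by
    rcases hcase x with h | h <;> simp only [Y, h] <;> rw [abs_le] <;> constructor <;> linarith
  refine le_trans (measureReal_mono fun y hy => ?_)
    (pi_real_sum_ge_le hY hB hb h0 h2 hl (by linarith) N u)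
  simp only [Set.mem_ofPred_eq] at hy ⊢
  have hs : ∑ j, Y (y j) = N * p - ((Finset.univ.filter fun i => y i ∈ A).card : ℝ) := by
    simp [Y, Finset.sum_sub_distrib, Set.indicator_apply]
  rw [hs]
  linarith

/-! ## Independence of the accepted points -/

section Selection

variable {Ω X : Type*}

open Classical in
/-- The indices of the coordinates that lie in `A`. -/
def successes {m : ℕ} (A : Set Ω) (y : Fin m → Ω) : Finset (Fin m) :=
  Finset.univ.filter fun i => y i ∈ A

/-- The images of the successes, in order, given that there are `k` of them. -/
def selected {m k : ℕ} (p : Ω → X) (A : Set Ω) (y : Fin m → Ω) (h : (successes A y).card = k) :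
    Fin k → X :=
  fun i => p (y ((successes A y).orderEmbOfFin h i))

/-- Once the set of successes is fixed, the random enumeration of the successes becomes a fixed
embedding, and each piece is an event about deterministic coordinates. -/
theorem selected_event_eq {m k : ℕ} (p : Ω → X) (A : Set Ω) (B : Set (Fin k → X)) :
    {y : Fin m → Ω | ∃ h : (successes A y).card = k, selected p A y h ∈ B} =
      ⋃ S : {S : Finset (Fin m) // S.card = k}, {y | successes A y = S.1} ∩
        (fun (y : Fin m → Ω) i => p (y (S.1.orderEmbOfFin S.2 i))) ⁻¹' B := by
  ext y
  simp only [Set.mem_ofPred_eq, Set.mem_iUnion, Set.mem_inter_iff, Set.mem_preimage]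
  constructor
  · rintro ⟨h, hB⟩
    exact ⟨⟨_, h⟩, rfl, hB⟩
  · rintro ⟨⟨S, hS⟩, h, hB⟩
    subst h
    exact ⟨hS, hB⟩

variable [MeasurableSpace Ω] [MeasurableSpace X]

theorem measurableSet_successes_eq {m : ℕ} {A : Set Ω} (hA : MeasurableSet A)
    (S : Finset (Fin m)) : MeasurableSet {y : Fin m → Ω | successes A y = S} := by
  have : {y : Fin m → Ω | successes A y = S} =
      ⋂ i, if i ∈ S then (fun y => y i) ⁻¹' A else (fun y => y i) ⁻¹' Aᶜ := by
    ext y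
    simp only [Set.mem_ofPred_eq, Set.mem_iInter, Finset.ext_iff, successes, Finset.mem_filter,
      Finset.mem_univ, true_and]
    refine forall_congr' fun i => ?_
    by_cases h : i ∈ S <;> simp [h]
  rw [this]
  refine MeasurableSet.iInter fun i => ?_
  split_ifs
  · exact measurable_pi_apply i hA
  · exact measurable_pi_apply i hA.compl

theorem measurable_selectCoords {m k : ℕ} {p : Ω → X} (hp : Measurable p)
    (e : Fin k → Fin m) : Measurable fun (y : Fin m → Ω) i => p (y (e i)) :=
  measurable_pi_lambda _ fun i => hp.comp (measurable_pi_apply (e i))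

theorem measurableSet_selected {m k : ℕ} {p : Ω → X} (hp : Measurable p) {A : Set Ω}
    (hA : MeasurableSet A) {B : Set (Fin k → X)} (hB : MeasurableSet B) :
    MeasurableSet {y : Fin m → Ω | ∃ h : (successes A y).card = k, selected p A y h ∈ B} := by
  rw [selected_event_eq]
  exact MeasurableSet.iUnion fun S => (measurableSet_successes_eq hA _).inter
    (measurable_selectCoords hp _ hB)

/-- For a box `B` the event is itself a box: coordinates in `S` must lie in `A` and map to the
prescribed side, the others must avoid `A`. Its measure factors, and a π-system argument passes from
boxes to all measurable `B`. -/
theorem pi_successes_eq_inter {m k : ℕ} {μ : Measure Ω} [IsFiniteMeasure μ] {ν : Measure X}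
    [IsProbabilityMeasure ν] {p : Ω → X} (hp : Measurable p) {A : Set Ω}
    {α : ENNReal} (hα : ∀ B, MeasurableSet B → μ (A ∩ p ⁻¹' B) = α * ν B)
    (S : Finset (Fin m)) (hS : S.card = k) {B : Set (Fin k → X)} (hB : MeasurableSet B) :
    (Measure.pi fun _ : Fin m => μ) ({y | successes A y = S} ∩
        (fun (y : Fin m → Ω) i => p (y (S.orderEmbOfFin hS i))) ⁻¹' B) =
      (Measure.pi fun _ : Fin m => μ) {y | successes A y = S} *
        (Measure.pi fun _ : Fin k => ν) B := by
  set P := Measure.pi fun _ : Fin m => μ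
  set e := S.orderEmbOfFin hS
  have hsel := measurable_selectCoords (Ω := Ω) hp e
  have hμA : μ A = α := by simpa using hα Set.univ MeasurableSet.univ
  have hrect : ∀ D : Fin k → Set X, (∀ i, MeasurableSet (D i)) →
      P ({y | successes A y = S} ∩ (fun (y : Fin m → Ω) i => p (y (e i))) ⁻¹'
        (Set.univ.pi D)) = α ^ k * μ Aᶜ ^ (m - k) * ∏ i, ν (D i) := by
    intro D hD
    let F : Fin m → Set Ω := fun j =>
      if h : j ∈ S then A ∩ p ⁻¹' D ((S.orderIsoOfFin hS).symm ⟨j, h⟩) else Aᶜ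
    have hF : {y | successes A y = S} ∩ (fun (y : Fin m → Ω) i => p (y (e i))) ⁻¹'
        (Set.univ.pi D) = Set.univ.pi F := by
      ext y
      simp only [Set.mem_inter_iff, Set.mem_ofPred_eq, Set.mem_preimage, Set.mem_pi,
        Set.mem_univ, true_imp_iff]
      constructor
      · rintro ⟨h1, h2⟩ j
        have hj : j ∈ successes A y ↔ y j ∈ A := by simp [successes]
        rw [h1] at hj
        by_cases h : j ∈ S
        · simp only [F, h, dite_true]
          refine ⟨hj.1 h, ?_⟩
          have := h2 ((S.orderIsoOfFin hS).symm ⟨j, h⟩)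
          have he : e ((S.orderIsoOfFin hS).symm ⟨j, h⟩) = j := by
            simp only [e, ← Finset.coe_orderIsoOfFin_apply, OrderIso.apply_symm_apply]
          rwa [he] at this
        · simp only [F, h, dite_false]
          exact fun h' => h (hj.2 h')
      · intro h
        constructor
        · ext j
          have := h j
          by_cases hj : j ∈ S
          · simp only [F, hj, dite_true] at this
            simp [successes, hj, this.1]
          · simp only [F, hj, dite_false] at this
            simp only [successes, Finset.mem_filter, Finset.mem_univ, true_and, hj, iff_false]
            exact this
        · intro i
          have hm : e i ∈ S := S.orderEmbOfFin_mem hS i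
          have := h (e i)
          simp only [F, hm, dite_true] at this
          have he : (S.orderIsoOfFin hS).symm ⟨e i, hm⟩ = i := by
            rw [OrderIso.symm_apply_eq]
            ext
            simp [e]
          rw [he] at this
          exact this.2
    rw [hF, Measure.pi_pi]
    have hprod : ∏ j, μ (F j) = (∏ j ∈ S, μ (F j)) * ∏ j ∈ Sᶜ, μ (F j) :=
      (Finset.prod_mul_prod_compl S _).symm
    rw [hprod]
    have h2 : ∏ j ∈ Sᶜ, μ (F j) = μ Aᶜ ^ (m - k) := by
      rw [Finset.prod_congr rfl (g := fun _ => μ Aᶜ), Finset.prod_const, Finset.card_compl, hS,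
        Fintype.card_fin]
      intro j hj
      simp [F, Finset.mem_compl.1 hj]
    have h1 : ∏ j ∈ S, μ (F j) = α ^ k * ∏ i, ν (D i) := by
      have : ∏ j ∈ S, μ (F j) = ∏ i : Fin k, μ (F (e i)) := by
        rw [← Finset.prod_coe_sort S]
        exact ((S.orderIsoOfFin hS).toEquiv.prod_comp fun j : S => μ (F j)).symm
      rw [this]
      have hc : α ^ k = ∏ _i : Fin k, α := by simp
      rw [hc, ← Finset.prod_mul_distrib]
      refine Finset.prod_congr rfl fun i _ => ?_
      have hm : e i ∈ S := S.orderEmbOfFin_mem hS i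
      have he : (S.orderIsoOfFin hS).symm ⟨e i, hm⟩ = i := by
        rw [OrderIso.symm_apply_eq]
        ext
        simp [e]
      simp only [F, hm, dite_true, he]
      exact hα _ (hD i)
    rw [h1, h2]
    ring
  have hconst : P {y | successes A y = S} = α ^ k * μ Aᶜ ^ (m - k) := by
    have := hrect (fun _ => Set.univ) fun _ => MeasurableSet.univ
    simpa using this
  -- Both sides are finite measures that agree on boxes and have the same total mass.
  have hmeas : (P.restrict {y | successes A y = S}).map
      (fun (y : Fin m → Ω) i => p (y (e i))) =
      P {y | successes A y = S} • Measure.pi fun _ : Fin k => ν := by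
    refine ext_of_generate_finite _ generateFrom_pi.symm isPiSystem_pi ?_ ?_
    · rintro _ ⟨D, hD, rfl⟩
      have hD' : ∀ i, MeasurableSet (D i) := fun i => hD i (Set.mem_univ i)
      have hDm : MeasurableSet (Set.univ.pi D) := MeasurableSet.univ_pi hD'
      rw [Measure.map_apply hsel hDm, Measure.restrict_apply (hsel hDm), Set.inter_comm,
        hrect D hD', Measure.smul_apply, Measure.pi_pi, hconst, smul_eq_mul]
    · rw [Measure.map_apply hsel MeasurableSet.univ]
      simp
  have := congrArg (fun Q : Measure (Fin k → X) => Q B) hmeas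
  simp only [Measure.smul_apply, smul_eq_mul] at this
  rw [Measure.map_apply hsel hB, Measure.restrict_apply (hsel hB), Set.inter_comm] at this
  exact this

/-- Selecting from i.i.d. draws those that lie in `A` produces, given their number, i.i.d. points,
if `μ (A ∩ p ⁻¹' ·)` is proportional to `ν`. -/
theorem pi_selected_eq {m k : ℕ} {μ : Measure Ω} [IsFiniteMeasure μ] {ν : Measure X}
    [IsProbabilityMeasure ν] {p : Ω → X} (hp : Measurable p) {A : Set Ω} (hA : MeasurableSet A)
    {α : ENNReal} (hα : ∀ B, MeasurableSet B → μ (A ∩ p ⁻¹' B) = α * ν B)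
    {B : Set (Fin k → X)} (hB : MeasurableSet B) :
    (Measure.pi fun _ : Fin m => μ)
        {y | ∃ h : (successes A y).card = k, selected p A y h ∈ B} =
      (Measure.pi fun _ : Fin m => μ) {y | (successes A y).card = k} *
        (Measure.pi fun _ : Fin k => ν) B := by
  have key : ∀ B : Set (Fin k → X), MeasurableSet B → (Measure.pi fun _ : Fin m => μ)
      {y | ∃ h : (successes A y).card = k, selected p A y h ∈ B} =
      (∑ S : {S : Finset (Fin m) // S.card = k},
        (Measure.pi fun _ : Fin m => μ) {y | successes A y = S.1}) *
        (Measure.pi fun _ : Fin k => ν) B := by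
    intro B hB
    rw [selected_event_eq, measure_iUnion, tsum_fintype, Finset.sum_mul]
    · exact Finset.sum_congr rfl fun S _ => pi_successes_eq_inter hp hα S.1 S.2 hB
    · intro S S' hne
      refine Set.disjoint_left.2 fun y hy hy' => hne (Subtype.ext ?_)
      exact hy.1.symm.trans hy'.1
    · exact fun S => (measurableSet_successes_eq hA _).inter (measurable_selectCoords hp _ hB)
  -- The event on the count is the case `B = univ`, which identifies the sum over `S` in `key`.
  have h1 : {y : Fin m → Ω | (successes A y).card = k} =
      {y | ∃ h : (successes A y).card = k, selected p A y h ∈ Set.univ} := by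
    ext y
    simp
  rw [h1, key B hB, key Set.univ MeasurableSet.univ]
  simp

end Selection

/-! ## A single draw -/

section Draw

variable {d : ℕ}

/-- No condition on `q` is needed: if its mass is `0` or `∞`, the conventions of `ENNReal` make the
normalised law null. The law of a run thus stays finite even off the good event. -/
instance isFiniteMeasure_normalizedLaw (q : EuclideanSpace ℝ (Fin d) → ℝ) :
    IsFiniteMeasure (normalizedLaw q) := by
  refine ⟨?_⟩
  rw [normalizedLaw, Measure.smul_apply, smul_eq_mul]
  exact (ENNReal.inv_mul_le_one _).trans_lt ENNReal.one_lt_top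

theorem densityMeasure_univ_eq {q : EuclideanSpace ℝ (Fin d) → ℝ} (hq : Integrable q)
    (h0 : ∀ x, 0 ≤ q x) : densityMeasure q Set.univ = ENNReal.ofReal (∫ x, q x) := by
  rw [densityMeasure, withDensity_apply _ MeasurableSet.univ, Measure.restrict_univ,
    ofReal_integral_eq_lintegral_ofReal hq (ae_of_all _ h0)]

theorem isProbabilityMeasure_normalizedLaw {q : EuclideanSpace ℝ (Fin d) → ℝ}
    (hq : Integrable q) (h0 : ∀ x, 0 ≤ q x) (hpos : 0 < ∫ x, q x) :
    IsProbabilityMeasure (normalizedLaw q) := by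
  refine ⟨?_⟩
  rw [normalizedLaw, Measure.smul_apply, smul_eq_mul, densityMeasure_univ_eq hq h0]
  exact ENNReal.inv_mul_cancel (ENNReal.ofReal_pos.2 hpos).ne' ENNReal.ofReal_ne_top

theorem IsDensity.integrable {f : EuclideanSpace ℝ (Fin d) → ℝ} (hf : IsDensity f) :
    Integrable f := by
  by_contra h
  have := hf.integral_eq_one
  rw [integral_undef h] at this
  exact zero_ne_one this

/-- Domination of a density forces the envelope to have mass at least one. This is where the
positivity of `∫ q`, needed for normalisation, comes from. -/
theorem IsDensity.one_le_mul_integral {f q : EuclideanSpace ℝ (Fin d) → ℝ} {W : ℝ}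
    (hf : IsDensity f) (hq : Integrable q) (hle : ∀ x, f x ≤ W * q x) : 1 ≤ W * ∫ x, q x := by
  rw [← hf.integral_eq_one, ← integral_const_mul]
  exact integral_mono hf.integrable (hq.const_mul W) hle

theorem IsDensity.isProbabilityMeasure {f : EuclideanSpace ℝ (Fin d) → ℝ} (hf : IsDensity f) :
    IsProbabilityMeasure (densityMeasure f) := by
  refine ⟨?_⟩
  rw [densityMeasure_univ_eq hf.integrable hf.nonneg, hf.integral_eq_one, ENNReal.ofReal_one]

instance isProbabilityMeasure_uniform :
    IsProbabilityMeasure (volume.restrict (Set.Icc (0 : ℝ) 1)) :=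
  ⟨by simp⟩

/-- The pairs (point, uniform variable) that are accepted. -/
def acceptSet (f e : EuclideanSpace ℝ (Fin d) → ℝ) : Set (EuclideanSpace ℝ (Fin d) × ℝ) :=
  {z | z.2 * e z.1 ≤ f z.1}

theorem measurableSet_acceptSet {f e : EuclideanSpace ℝ (Fin d) → ℝ} (hf : Measurable f)
    (he : Measurable e) : MeasurableSet (acceptSet f e) :=
  measurableSet_le (measurable_snd.mul (he.comp measurable_fst)) (hf.comp measurable_fst)

/-- At a point where the proposal has density `q`, the acceptance probability is `t / (W q)`, so `q`
cancels and the accepted density is `t / W`. Where `q = 0`, domination gives `t = 0`. -/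
theorem ofReal_mul_uniform_le {q W t : ℝ} (hq : 0 ≤ q) (hW : 0 < W) (ht : 0 ≤ t)
    (hle : t ≤ W * q) :
    ENNReal.ofReal q * volume.restrict (Set.Icc (0 : ℝ) 1) {u | u * (W * q) ≤ t} =
      (ENNReal.ofReal W)⁻¹ * ENNReal.ofReal t := by
  rcases hq.eq_or_lt with rfl | hq
  · have : t = 0 := by linarith
    simp [this]
  have hWq : 0 < W * q := mul_pos hW hq
  have hset : {u : ℝ | u * (W * q) ≤ t} = Set.Iic (t / (W * q)) := by
    ext u
    rw [Set.mem_Iic, le_div_iff₀ hWq]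
    rfl
  have hinter : Set.Iic (t / (W * q)) ∩ Set.Icc (0 : ℝ) 1 = Set.Icc 0 (t / (W * q)) := by
    ext u
    have : t / (W * q) ≤ 1 := (div_le_one hWq).2 hle
    simp only [Set.mem_inter_iff, Set.mem_Iic, Set.mem_Icc]
    constructor
    · rintro ⟨h1, h2, -⟩
      exact ⟨h2, h1⟩
    · rintro ⟨h1, h2⟩
      exact ⟨h2, h1, h2.trans this⟩
  rw [hset, Measure.restrict_apply measurableSet_Iic, hinter, Real.volume_Icc, sub_zero,
    ← ENNReal.ofReal_mul hq.le, ← ENNReal.ofReal_inv_of_pos hW,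
    ← ENNReal.ofReal_mul (inv_nonneg.2 hW.le)]
  congr 1
  field_simp

/-- Law of an accepted point under rejection sampling. -/
theorem normalizedLaw_prod_acceptSet_inter {f q : EuclideanSpace ℝ (Fin d) → ℝ} {W : ℝ}
    (hf : IsDensity f) (hq : Measurable q) (hq0 : ∀ x, 0 ≤ q x) (hW : 0 < W)
    (hle : ∀ x, f x ≤ W * q x) (B : Set (EuclideanSpace ℝ (Fin d))) (hB : MeasurableSet B) :
    (normalizedLaw q).prod (volume.restrict (Set.Icc (0 : ℝ) 1))
        (acceptSet f (fun x => W * q x) ∩ Prod.fst ⁻¹' B) =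
      (densityMeasure q Set.univ)⁻¹ * (ENNReal.ofReal W)⁻¹ * densityMeasure f B := by
  have hA : MeasurableSet (acceptSet f (fun x => W * q x)) :=
    measurableSet_acceptSet hf.measurable (hq.const_mul W)
  have hAB := hA.inter (measurable_fst hB)
  rw [Measure.prod_apply hAB, normalizedLaw, lintegral_smul_measure, smul_eq_mul, mul_assoc]
  congr 1
  nth_rewrite 1 [densityMeasure]
  rw [lintegral_withDensity_eq_lintegral_mul _ hq.ennreal_ofReal
    (measurable_measure_prodMk_left hAB)]
  rw [densityMeasure, withDensity_apply _ hB, ← lintegral_const_mul _ hf.measurable.ennreal_ofReal,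
    ← lintegral_indicator hB]
  refine lintegral_congr fun x => ?_
  rw [Pi.mul_apply]
  by_cases hx : x ∈ B
  · rw [Set.indicator_of_mem hx, ← ofReal_mul_uniform_le (hq0 x) hW (hf.nonneg x) (hle x)]
    congr 2
    ext u
    simp [acceptSet, hx]
  · rw [Set.indicator_of_notMem hx]
    have : Prod.mk x ⁻¹' (acceptSet f (fun x => W * q x) ∩ Prod.fst ⁻¹' B) = ∅ := by
      ext u
      simp [hx]
    rw [this]
    simp

/-- Rejection sampling with a dominating envelope returns i.i.d. points with density `f`. -/
theorem outputIID_drawLaw {m : ℕ} {f q : EuclideanSpace ℝ (Fin d) → ℝ} {W : ℝ}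
    (hf : IsDensity f) (hq : Measurable q) (hq0 : ∀ x, 0 ≤ q x) (hW : 0 < W)
    (hle : ∀ x, f x ≤ W * q x) : OutputIID (drawLaw m q) f (fun x => W * q x) := by
  intro k B hB
  have := hf.isProbabilityMeasure
  exact pi_selected_eq measurable_fst
    (measurableSet_acceptSet hf.measurable (hq.const_mul W))
    (normalizedLaw_prod_acceptSet_inter hf hq hq0 hW hle) hB

/-- Lower tail of the number of accepted points. -/
theorem drawLaw_real_card_accepted_le {m : ℕ} {f q : EuclideanSpace ℝ (Fin d) → ℝ} {W : ℝ}
    (hf : IsDensity f) (hq : Measurable q) (hqi : Integrable q) (hq0 : ∀ x, 0 ≤ q x) (hW : 0 < W)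
    (hle : ∀ x, f x ≤ W * q x) {l : ℝ} (hl : 0 ≤ l) (hl1 : l ≤ 1) (u : ℝ) :
    (drawLaw m q).real {y | ((accepted f (fun x => W * q x) y).card : ℝ) ≤
        m * (1 / (W * ∫ x, q x)) - u} ≤
      Real.exp (m * (l ^ 2 * (1 / 4)) - l * u) := by
  have hpos : 0 < ∫ x, q x :=
    pos_of_mul_pos_right (one_pos.trans_le (hf.one_le_mul_integral hqi hle)) hW.le
  have := isProbabilityMeasure_normalizedLaw hqi hq0 hpos
  have hA : MeasurableSet (acceptSet f (fun x => W * q x)) :=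
    measurableSet_acceptSet hf.measurable (hq.const_mul W)
  have hν := hf.isProbabilityMeasure
  -- The acceptance probability is the law of an accepted point evaluated on the whole space.
  have hp : ((normalizedLaw q).prod (volume.restrict (Set.Icc (0 : ℝ) 1))).real
      (acceptSet f (fun x => W * q x)) = 1 / (W * ∫ x, q x) := by
    have h := normalizedLaw_prod_acceptSet_inter hf hq hq0 hW hle Set.univ MeasurableSet.univ
    rw [Set.preimage_univ, Set.inter_univ, measure_univ (μ := densityMeasure f), mul_one,
      densityMeasure_univ_eq hqi hq0] at h
    rw [Measure.real, h, ENNReal.toReal_mul, ENNReal.toReal_inv, ENNReal.toReal_inv,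
      ENNReal.toReal_ofReal hpos.le, ENNReal.toReal_ofReal hW.le]
    field_simp
  have h := pi_real_card_le
    (μ := (normalizedLaw q).prod (volume.restrict (Set.Icc (0 : ℝ) 1))) hA hl hl1 m u
  rw [hp] at h
  exact h

end Draw

/-! ## Measurability of the law of a run -/

section Measurability

variable {d : ℕ} {Ω : Type*} [MeasurableSpace Ω]

theorem measurable_normalizedLaw {q : Ω → EuclideanSpace ℝ (Fin d) → ℝ}
    (hq : Measurable fun z : Ω × EuclideanSpace ℝ (Fin d) => q z.1 z.2) :
    Measurable fun w => normalizedLaw (q w) := by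
  have hB : ∀ B, MeasurableSet B → Measurable fun w => densityMeasure (q w) B := by
    intro B hB
    have : (fun w => densityMeasure (q w) B) = fun w =>
        ∫⁻ x in B, ENNReal.ofReal (q w x) := by
      funext w
      rw [densityMeasure, withDensity_apply _ hB]
    rw [this]
    exact hq.ennreal_ofReal.lintegral_prod_right'
  refine Measure.measurable_of_measurable_coe _ fun B hB' => ?_
  simp only [normalizedLaw, Measure.smul_apply, smul_eq_mul]
  exact (hB _ MeasurableSet.univ).inv.mul (hB B hB')

/-- `Measure.bind` can be computed only if the second-stage law depends measurably on the first
stage. Product measures are tested on boxes, where measurability reduces to that of the factors. -/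
theorem measurable_drawLaw (m : ℕ) {q : Ω → EuclideanSpace ℝ (Fin d) → ℝ}
    (hq : Measurable fun z : Ω × EuclideanSpace ℝ (Fin d) => q z.1 z.2) :
    Measurable fun w => drawLaw m (q w) := by
  have h1 := measurable_normalizedLaw hq
  have hcoe : ∀ B, MeasurableSet B → Measurable fun w => normalizedLaw (q w) B :=
    fun B hB => (Measure.measurable_coe hB).comp h1
  have h2 : Measurable fun w =>
      (normalizedLaw (q w)).prod (volume.restrict (Set.Icc (0 : ℝ) 1)) := by
    refine Measurable.measure_of_isPiSystem generateFrom_prod.symm isPiSystem_prod ?_ ?_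
    · rintro _ ⟨A, hA, B, hB, rfl⟩
      simp only [Measure.prod_prod]
      exact (hcoe A hA).mul_const _
    · simp only [← Set.univ_prod_univ, Measure.prod_prod]
      exact (hcoe _ MeasurableSet.univ).mul_const _
  have hcoe2 : ∀ B, MeasurableSet B → Measurable fun w =>
      (normalizedLaw (q w)).prod (volume.restrict (Set.Icc (0 : ℝ) 1)) B :=
    fun B hB => (Measure.measurable_coe hB).comp h2
  unfold drawLaw
  refine Measurable.measure_of_isPiSystem generateFrom_pi.symm isPiSystem_pi ?_ ?_
  · rintro _ ⟨D, hD, rfl⟩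
    simp only [Measure.pi_pi]
    exact Finset.measurable_prod _ fun i _ => hcoe2 _ (hD i (Set.mem_univ i))
  · simp only [← Set.pi_univ Set.univ, Measure.pi_pi]
    exact Finset.measurable_prod _ fun i _ => hcoe2 _ MeasurableSet.univ

theorem measurable_card_accepted {m : ℕ} {f : EuclideanSpace ℝ (Fin d) → ℝ} (hf : Measurable f)
    {e : Ω → EuclideanSpace ℝ (Fin d) → ℝ}
    (he : Measurable fun z : Ω × EuclideanSpace ℝ (Fin d) => e z.1 z.2) :
    Measurable fun ω : Ω × (Fin m → EuclideanSpace ℝ (Fin d) × ℝ) =>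
      (accepted f (e ω.1) ω.2).card := by
  classical
  have : (fun ω : Ω × (Fin m → EuclideanSpace ℝ (Fin d) × ℝ) =>
      (accepted f (e ω.1) ω.2).card) = fun ω => ∑ i : Fin m,
        if (ω.2 i).2 * e ω.1 (ω.2 i).1 ≤ f (ω.2 i).1 then 1 else 0 := by
    funext ω
    rw [accepted, Finset.card_filter]
  rw [this]
  refine Finset.measurable_sum _ fun i _ => Measurable.ite ?_ measurable_const measurable_const
  have hi : Measurable fun ω : Ω × (Fin m → EuclideanSpace ℝ (Fin d) × ℝ) => ω.2 i :=
    (measurable_pi_apply i).comp measurable_snd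
  exact measurableSet_le (hi.snd.mul (he.comp (measurable_fst.prodMk hi.fst)))
    (hf.comp hi.fst)

theorem measurable_bandwidth (s δ : ℝ) : Measurable (bandwidth d s δ) := measurable_of_countable _

/-- The Hölder condition gives continuity, hence measurability. -/
theorem KernelAssumption.measurable {K₀ : ℝ → ℝ} {C C' C'' ε : ℝ}
    (hK : KernelAssumption K₀ C C' C'' ε) (hε : 0 < ε) : Measurable K₀ := by
  refine Continuous.measurable (continuous_iff_continuousAt.2 fun x => ?_)
  rw [ContinuousAt, tendsto_iff_dist_tendsto_zero]
  have h0 : Filter.Tendsto (fun y : ℝ => C'' * |x - y| ^ ε) (nhds x) (nhds 0) := by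
    have : Continuous fun y : ℝ => C'' * |x - y| ^ ε :=
      continuous_const.mul ((continuous_const.sub continuous_id).abs.rpow_const
        fun _ => Or.inr hε.le)
    have h := this.tendsto x
    simpa [Real.zero_rpow hε.ne'] using h
  exact squeeze_zero (fun _ => dist_nonneg) (fun y => hK.holder x y) h0

variable {K₀ : ℝ → ℝ} {f g : EuclideanSpace ℝ (Fin d) → ℝ}

theorem measurable_fTilde (hK : Measurable K₀) (hf : Measurable f) (hg : Measurable g)
    (s M δ : ℝ) (T : ℕ) :
    Measurable fun z : (Fin T → EuclideanSpace ℝ (Fin d) × ℝ) × EuclideanSpace ℝ (Fin d) =>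
      fTilde K₀ f g s M δ z.1 z.2 := by
  classical
  have he : Measurable fun z => M * g z := hg.const_mul M
  have hcard : Measurable fun w : Fin T → EuclideanSpace ℝ (Fin d) × ℝ =>
      (accepted f (fun z => M * g z) w).card :=
    (measurable_card_accepted (Ω := Unit) hf (e := fun _ z => M * g z)
      (he.comp measurable_snd)).comp (measurable_const (a := ()) |>.prodMk measurable_id)
  have hcard' : Measurable fun z : (Fin T → EuclideanSpace ℝ (Fin d) × ℝ) ×
      EuclideanSpace ℝ (Fin d) => (accepted f (fun z => M * g z) z.1).card :=
    hcard.comp measurable_fst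
  have hcast : Measurable (Nat.cast : ℕ → ℝ) := measurable_of_countable _
  have hN := hcast.comp hcard'
  have hh := (measurable_bandwidth (d := d) s δ).comp hcard'
  -- A sum over a random index set becomes a sum over all indices with indicators, which is
  -- measurable term by term.
  have hsum : (fun z : (Fin T → EuclideanSpace ℝ (Fin d) × ℝ) × EuclideanSpace ℝ (Fin d) =>
      ∑ k ∈ accepted f (fun z => M * g z) z.1,
        ∏ i, K₀ (((z.1 k).1 i - z.2 i) / bandwidth d s δ (accepted f (fun z => M * g z) z.1).card))
      = fun z => ∑ k, if (z.1 k).2 * (M * g (z.1 k).1) ≤ f (z.1 k).1 then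
        ∏ i, K₀ (((z.1 k).1 i - z.2 i) / bandwidth d s δ (accepted f (fun z => M * g z) z.1).card)
        else 0 := by
    funext z
    rw [accepted, Finset.sum_filter]
  unfold fTilde
  refine Measurable.ite (measurableSet_le measurable_snd.norm (Real.measurable_log.comp hN)) ?_
    measurable_const
  refine ((hN.mul (hh.pow_const d)).const_div 1).mul ?_
  rw [hsum]
  refine Finset.measurable_sum _ fun k _ => ?_
  have hk : Measurable fun z : (Fin T → EuclideanSpace ℝ (Fin d) × ℝ) ×
      EuclideanSpace ℝ (Fin d) => z.1 k := (measurable_pi_apply k).comp measurable_fst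
  refine Measurable.ite (measurableSet_le (hk.snd.mul (he.comp hk.fst)) (hf.comp hk.fst)) ?_
    measurable_const
  refine Finset.measurable_prod _ fun i _ => hK.comp (Measurable.div (Measurable.sub ?_ ?_) hh)
  · exact (EuclideanSpace.proj (𝕜 := ℝ) i).continuous.measurable.comp hk.fst
  · exact (EuclideanSpace.proj (𝕜 := ℝ) i).continuous.measurable.comp measurable_snd

theorem measurable_pliable (hK : Measurable K₀) (hf : Measurable f) (hg : Measurable g)
    (s M δ H : ℝ) (n T : ℕ) :
    Measurable fun z : (Fin T → EuclideanSpace ℝ (Fin d) × ℝ) × EuclideanSpace ℝ (Fin d) =>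
      pliable K₀ f g s M δ H n z.1 z.2 := by
  unfold pliable
  refine Measurable.const_mul (((measurable_fTilde hK hf hg s M δ T).add
    (Measurable.const_mul (Measurable.ite ?_ measurable_const measurable_const) _)).add
    (Measurable.ite ?_ ((hg.comp measurable_snd).const_mul M) measurable_const)) _
  · exact measurable_snd Metric.isClosed_closedBall.measurableSet
  · exact measurableSet_le measurable_const measurable_snd.norm

/-- Lower bound for the probability of an event of a run, stage by stage. -/
theorem mul_le_runLaw (hK : Measurable K₀) (hf : Measurable f) (hg : Measurable g)
    (s M δ H : ℝ) (n : ℕ) {G : Set (Fin (initCalls d s n) → EuclideanSpace ℝ (Fin d) × ℝ)}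
    (hG : MeasurableSet G) {t : ℝ} {a b : ENNReal} (h1 : a ≤ stageOneLaw g s n G)
    (h2 : ∀ w ∈ G, b ≤ stageTwoLaw K₀ f g s M δ H n w
      {y | t ≤ ((accepted f (envelope K₀ f g s M δ H n w) y).card : ℝ)}) :
    b * a ≤ runLaw K₀ f g s M δ H n
      {ω | ω.1 ∈ G ∧ t ≤ (numOutput K₀ f g s M δ H n ω : ℝ)} := by
  have hp := measurable_pliable hK hf hg s M δ H n (initCalls d s n)
  have hcast : Measurable (Nat.cast : ℕ → ℝ) := measurable_of_countable _
  have hE : MeasurableSet {ω : (Fin (initCalls d s n) → EuclideanSpace ℝ (Fin d) × ℝ) ×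
      (Fin (n - initCalls d s n) → EuclideanSpace ℝ (Fin d) × ℝ) |
      ω.1 ∈ G ∧ t ≤ (numOutput K₀ f g s M δ H n ω : ℝ)} := by
    refine (measurable_fst hG).inter (measurableSet_le measurable_const (hcast.comp ?_))
    exact measurable_card_accepted hf (hp.const_mul _)
  have hκ : Measurable fun w => stageTwoLaw K₀ f g s M δ H n w := measurable_drawLaw _ hp
  let κ : ProbabilityTheory.Kernel (Fin (initCalls d s n) → EuclideanSpace ℝ (Fin d) × ℝ)
    (Fin (n - initCalls d s n) → EuclideanSpace ℝ (Fin d) × ℝ) := ⟨_, hκ⟩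
  -- The bound holds for every `w`, including outcomes whose proposal is degenerate, so `κ` is a
  -- finite kernel without any restriction to `G`.
  have hfin : ∀ w, stageTwoLaw K₀ f g s M δ H n w Set.univ ≤ 1 := by
    intro w
    rw [stageTwoLaw, drawLaw, Measure.pi_univ]
    refine Finset.prod_le_one' fun i _ => ?_
    rw [← Set.univ_prod_univ, Measure.prod_prod,
      measure_univ (μ := volume.restrict (Set.Icc (0 : ℝ) 1)), mul_one, normalizedLaw,
      Measure.smul_apply, smul_eq_mul]
    exact ENNReal.inv_mul_le_one _
  have : ProbabilityTheory.IsFiniteKernel κ := ⟨1, ENNReal.one_lt_top, hfin⟩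
  have hmap : Measurable fun w => (stageTwoLaw K₀ f g s M δ H n w).map fun y => (w, y) := by
    refine Measure.measurable_of_measurable_coe _ fun B hB => ?_
    have : (fun w => (stageTwoLaw K₀ f g s M δ H n w).map (fun y => (w, y)) B) =
        fun w => κ w (Prod.mk w ⁻¹' B) := by
      funext w
      rw [Measure.map_apply measurable_prodMk_left hB]
      rfl
    rw [this]
    exact ProbabilityTheory.Kernel.measurable_kernel_prodMk_left hB
  rw [runLaw, Measure.bind_apply hE hmap.aemeasurable]
  calc b * a ≤ b * stageOneLaw g s n G := by gcongr
    _ = ∫⁻ _ in G, b ∂stageOneLaw g s n := (setLIntegral_const _ _).symm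
    _ ≤ ∫⁻ w in G, (stageTwoLaw K₀ f g s M δ H n w).map (fun y => (w, y))
        {ω | ω.1 ∈ G ∧ t ≤ (numOutput K₀ f g s M δ H n ω : ℝ)} ∂stageOneLaw g s n := by
        refine setLIntegral_mono' hG fun w hw => (h2 w hw).trans ?_
        rw [Measure.map_apply measurable_prodMk_left hE]
        exact measure_mono fun y hy => ⟨hw, hy⟩
    _ ≤ _ := setLIntegral_le_lintegral _ _

end Measurability

/-! ## The product kernel -/

section Kernel

variable {d : ℕ} {K₀ : ℝ → ℝ} {C C' C'' ε : ℝ}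

/-- The product kernel on `ℝ^d`. -/
def prodKernel (K₀ : ℝ → ℝ) (v : EuclideanSpace ℝ (Fin d)) : ℝ := ∏ i, K₀ (v i)

/-- The product kernel with bandwidth `h` centred at `y`. -/
def scaledKernel (K₀ : ℝ → ℝ) (h : ℝ) (y x : EuclideanSpace ℝ (Fin d)) : ℝ :=
  1 / h ^ d * ∏ i, K₀ ((x i - y i) / h)

theorem KernelAssumption.integrable (hK : KernelAssumption K₀ C C' C'' ε) : Integrable K₀ := by
  by_contra h
  have := hK.integral_eq_one
  rw [integral_undef h] at this
  exact zero_ne_one this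

theorem KernelAssumption.integrable_mul (hK : KernelAssumption K₀ C C' C'' ε) :
    Integrable fun x => x * K₀ x := by
  refine (hK.integrable.add hK.integrable_sq_mul).mono'
    (measurable_id.aestronglyMeasurable.mul hK.integrable.aestronglyMeasurable)
    (ae_of_all _ fun x => ?_)
  rw [Real.norm_eq_abs, abs_mul, abs_of_nonneg (hK.nonneg x), Pi.add_apply]
  have : |x| ≤ 1 + x ^ 2 := by
    rw [← sq_abs]
    nlinarith [sq_nonneg (|x| - 1), abs_nonneg x]
  nlinarith [hK.nonneg x]

theorem integrable_prod_coord {φ : Fin d → ℝ → ℝ} (hφ : ∀ i, Integrable (φ i)) :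
    Integrable fun v : EuclideanSpace ℝ (Fin d) => ∏ i, φ i (v i) :=
  ((EuclideanSpace.volume_preserving_symm_measurableEquiv_toLp (Fin d)).integrable_comp_emb
    (MeasurableEquiv.measurableEmbedding _)).2 (Integrable.fintype_prod hφ)

theorem integral_prod_coord (φ : Fin d → ℝ → ℝ) :
    ∫ v : EuclideanSpace ℝ (Fin d), ∏ i, φ i (v i) = ∏ i, ∫ x, φ i x := by
  rw [← integral_fintype_prod_volume_eq_prod]
  exact (EuclideanSpace.volume_preserving_symm_measurableEquiv_toLp (Fin d)).integral_comp'
    fun v : Fin d → ℝ => ∏ i, φ i (v i)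

/-- A weight in one coordinate is absorbed by the corresponding factor, so moments of the product
kernel reduce to one-dimensional ones. -/
theorem coord_mul_prodKernel (ψ : ℝ → ℝ) (j : Fin d) (v : EuclideanSpace ℝ (Fin d)) :
    ψ (v j) * prodKernel K₀ v =
      ∏ i, (if i = j then fun x => ψ x * K₀ x else K₀) (v i) := by
  rw [prodKernel, ← Finset.mul_prod_erase _ _ (Finset.mem_univ j),
    ← Finset.mul_prod_erase _ _ (Finset.mem_univ j), if_pos rfl, mul_assoc]
  congr 2
  refine Finset.prod_congr rfl fun i hi => ?_
  rw [if_neg (Finset.ne_of_mem_erase hi)]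

theorem KernelAssumption.integrable_coord_mul (hK : KernelAssumption K₀ C C' C'' ε) {ψ : ℝ → ℝ}
    (hψ : Integrable fun x => ψ x * K₀ x) (j : Fin d) :
    Integrable fun v : EuclideanSpace ℝ (Fin d) => ψ (v j) * prodKernel K₀ v := by
  simp_rw [coord_mul_prodKernel]
  refine integrable_prod_coord fun i => ?_
  split_ifs
  · exact hψ
  · exact hK.integrable

theorem KernelAssumption.integral_coord_mul (hK : KernelAssumption K₀ C C' C'' ε) (ψ : ℝ → ℝ)
    (j : Fin d) :
    ∫ v : EuclideanSpace ℝ (Fin d), ψ (v j) * prodKernel K₀ v = ∫ x, ψ x * K₀ x := by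
  simp_rw [coord_mul_prodKernel]
  rw [integral_prod_coord, ← Finset.mul_prod_erase _ _ (Finset.mem_univ j), if_pos rfl,
    Finset.prod_eq_one, mul_one]
  intro i hi
  rw [if_neg (Finset.ne_of_mem_erase hi), hK.integral_eq_one]

theorem KernelAssumption.integrable_prodKernel (hK : KernelAssumption K₀ C C' C'' ε) :
    Integrable (prodKernel K₀ : EuclideanSpace ℝ (Fin d) → ℝ) :=
  integrable_prod_coord fun _ => hK.integrable

theorem KernelAssumption.integral_prodKernel (hK : KernelAssumption K₀ C C' C'' ε) :
    ∫ v : EuclideanSpace ℝ (Fin d), prodKernel K₀ v = 1 := by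
  simp only [prodKernel]
  rw [integral_prod_coord]
  simp [hK.integral_eq_one]

theorem KernelAssumption.integrable_inner_mul (hK : KernelAssumption K₀ C C' C'' ε)
    (a : EuclideanSpace ℝ (Fin d)) :
    Integrable fun v : EuclideanSpace ℝ (Fin d) => inner ℝ a v * prodKernel K₀ v := by
  have : (fun v : EuclideanSpace ℝ (Fin d) => inner ℝ a v * prodKernel K₀ v) =
      fun v => ∑ j, a j * (v j * prodKernel K₀ v) := by
    funext v
    rw [PiLp.inner_apply, Finset.sum_mul]
    refine Finset.sum_congr rfl fun j _ => ?_
    simp only [RCLike.inner_apply, conj_trivial]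
    ring
  rw [this]
  exact integrable_finsetSum _ fun j _ =>
    (hK.integrable_coord_mul (ψ := fun x => x) hK.integrable_mul j).const_mul _

/-- The kernel is centred in each coordinate; this removes the gradient term from the bias. -/
theorem KernelAssumption.integral_inner_mul (hK : KernelAssumption K₀ C C' C'' ε)
    (a : EuclideanSpace ℝ (Fin d)) :
    ∫ v : EuclideanSpace ℝ (Fin d), inner ℝ a v * prodKernel K₀ v = 0 := by
  have : (fun v : EuclideanSpace ℝ (Fin d) => inner ℝ a v * prodKernel K₀ v) =
      fun v => ∑ j, a j * (v j * prodKernel K₀ v) := by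
    funext v
    rw [PiLp.inner_apply, Finset.sum_mul]
    refine Finset.sum_congr rfl fun j _ => ?_
    simp only [RCLike.inner_apply, conj_trivial]
    ring
  rw [this, integral_finsetSum _ fun j _ =>
    (hK.integrable_coord_mul (ψ := fun x => x) hK.integrable_mul j).const_mul _]
  refine Finset.sum_eq_zero fun j _ => ?_
  rw [integral_const_mul, hK.integral_coord_mul (fun x => x), hK.integral_mul_eq_zero, mul_zero]

theorem norm_sq_mul_prodKernel (v : EuclideanSpace ℝ (Fin d)) :
    ‖v‖ ^ 2 * prodKernel K₀ v = ∑ j, v j ^ 2 * prodKernel K₀ v := by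
  rw [EuclideanSpace.real_norm_sq_eq, Finset.sum_mul]

theorem KernelAssumption.integrable_norm_sq_mul (hK : KernelAssumption K₀ C C' C'' ε) :
    Integrable fun v : EuclideanSpace ℝ (Fin d) => ‖v‖ ^ 2 * prodKernel K₀ v := by
  simp_rw [norm_sq_mul_prodKernel]
  exact integrable_finsetSum _ fun j _ =>
    hK.integrable_coord_mul (ψ := fun x => x ^ 2) hK.integrable_sq_mul j

theorem KernelAssumption.integral_norm_sq_mul_le (hK : KernelAssumption K₀ C C' C'' ε) :
    ∫ v : EuclideanSpace ℝ (Fin d), ‖v‖ ^ 2 * prodKernel K₀ v ≤ d * C' := by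
  simp_rw [norm_sq_mul_prodKernel]
  rw [integral_finsetSum _ fun j _ =>
    hK.integrable_coord_mul (ψ := fun x => x ^ 2) hK.integrable_sq_mul j]
  calc _ ≤ ∑ _j : Fin d, C' := Finset.sum_le_sum fun j _ =>
        (hK.integral_coord_mul (fun x => x ^ 2) j).trans_le hK.integral_sq_mul_le
    _ = d * C' := by simp

theorem KernelAssumption.prodKernel_nonneg (hK : KernelAssumption K₀ C C' C'' ε)
    (v : EuclideanSpace ℝ (Fin d)) : 0 ≤ prodKernel K₀ v :=
  Finset.prod_nonneg fun _ _ => hK.nonneg _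

theorem scaledKernel_eq (h : ℝ) (y x : EuclideanSpace ℝ (Fin d)) :
    scaledKernel K₀ h y x = (h ^ d)⁻¹ * prodKernel K₀ (h⁻¹ • (x - y)) := by
  simp only [scaledKernel, prodKernel, one_div]
  congr 1
  refine Finset.prod_congr rfl fun i _ => ?_
  simp [div_eq_inv_mul]

theorem KernelAssumption.scaledKernel_nonneg (hK : KernelAssumption K₀ C C' C'' ε) {h : ℝ}
    (hh : 0 < h) (y x : EuclideanSpace ℝ (Fin d)) : 0 ≤ scaledKernel K₀ h y x :=
  mul_nonneg (by positivity) (Finset.prod_nonneg fun _ _ => hK.nonneg _)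

theorem KernelAssumption.scaledKernel_le (hK : KernelAssumption K₀ C C' C'' ε) {h : ℝ}
    (hh : 0 < h) (y x : EuclideanSpace ℝ (Fin d)) :
    scaledKernel K₀ h y x ≤ C ^ d / h ^ d := by
  have : ∏ i, K₀ ((x i - y i) / h) ≤ ∏ _i : Fin d, C :=
    Finset.prod_le_prod (fun _ _ => hK.nonneg _) fun _ _ => hK.le_bound _
  simp only [Finset.prod_const, Finset.card_univ, Fintype.card_fin] at this
  rw [scaledKernel, one_div, div_eq_inv_mul]
  exact mul_le_mul_of_nonneg_left this (by positivity)

theorem measurable_scaledKernel (hK : Measurable K₀) (h : ℝ) (y : EuclideanSpace ℝ (Fin d)) :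
    Measurable (scaledKernel K₀ h y) := by
  refine Measurable.const_mul (Finset.measurable_prod _ fun i _ =>
    hK.comp (Measurable.div_const (Measurable.sub_const ?_ _) _)) _
  exact (EuclideanSpace.proj (𝕜 := ℝ) i).continuous.measurable

theorem KernelAssumption.integrable_scaledKernel (hK : KernelAssumption K₀ C C' C'' ε) {h : ℝ}
    (hh : 0 < h) (y : EuclideanSpace ℝ (Fin d)) : Integrable (scaledKernel K₀ h y) := by
  simp_rw [funext (scaledKernel_eq h y)]
  exact ((hK.integrable_prodKernel.comp_smul (inv_ne_zero hh.ne')).comp_sub_right y).const_mul _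

/-- Substitution `x = y + h v`; the Jacobian `h^d` cancels the normalisation. -/
theorem integral_mul_scaledKernel (f : EuclideanSpace ℝ (Fin d) → ℝ) {h : ℝ}
    (hh : 0 < h) (y : EuclideanSpace ℝ (Fin d)) :
    ∫ x, f x * scaledKernel K₀ h y x = ∫ v, f (y + h • v) * prodKernel K₀ v := by
  let F : EuclideanSpace ℝ (Fin d) → ℝ := fun u => f (y + u) * prodKernel K₀ (h⁻¹ • u)
  have h1 : ∀ v, f (y + h • v) * prodKernel K₀ v = F (h • v) := fun v => by
    simp only [F, smul_smul, inv_mul_cancel₀ hh.ne', one_smul]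
  have h2 : ∀ x, f x * scaledKernel K₀ h y x = (h ^ d)⁻¹ * F (x - y) := fun x => by
    simp only [F, scaledKernel_eq, add_sub_cancel]
    ring
  simp_rw [h1, h2]
  rw [integral_const_mul, integral_sub_right_eq_self F y, Measure.integral_comp_smul,
    finrank_euclideanSpace_fin, abs_of_pos (by positivity), smul_eq_mul]

theorem KernelAssumption.integral_scaledKernel (hK : KernelAssumption K₀ C C' C'' ε) {h : ℝ}
    (hh : 0 < h) (y : EuclideanSpace ℝ (Fin d)) : ∫ x, scaledKernel K₀ h y x = 1 := by
  have := integral_mul_scaledKernel (K₀ := K₀) (fun _ => 1) hh y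
  simpa [hK.integral_prodKernel] using this

/-- Factors are changed one at a time, the others being at most `C`. The extra factor `C` on the
left avoids the exponent `S.card - 1` on the right. -/
theorem KernelAssumption.abs_prod_sub_prod_mul_le (hK : KernelAssumption K₀ C C' C'' ε)
    (hC : 0 < C) {ι : Type*} (S : Finset ι) (p q : ι → ℝ) {η : ℝ}
    (hη : ∀ i, |K₀ (p i) - K₀ (q i)| ≤ η) :
    |∏ i ∈ S, K₀ (p i) - ∏ i ∈ S, K₀ (q i)| * C ≤ S.card * C ^ S.card * η := by
  classical
  induction S using Finset.induction_on with
  | empty => simp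
  | insert j S hj ih =>
    rw [Finset.prod_insert hj, Finset.prod_insert hj, Finset.card_insert_of_notMem hj]
    set A := ∏ i ∈ S, K₀ (p i)
    set B := ∏ i ∈ S, K₀ (q i)
    have hB0 : 0 ≤ B := Finset.prod_nonneg fun _ _ => hK.nonneg _
    have hB : B ≤ C ^ S.card := by
      rw [← Finset.prod_const]
      exact Finset.prod_le_prod (fun _ _ => hK.nonneg _) fun _ _ => hK.le_bound _
    have hsplit : K₀ (p j) * A - K₀ (q j) * B =
        K₀ (p j) * (A - B) + (K₀ (p j) - K₀ (q j)) * B := by ring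
    have h1 : |K₀ (p j) * (A - B)| * C ≤ C * (S.card * C ^ S.card * η) := by
      rw [abs_mul, abs_of_nonneg (hK.nonneg _), mul_assoc]
      exact mul_le_mul (hK.le_bound _) ih (by positivity) hC.le
    have h2 : |(K₀ (p j) - K₀ (q j)) * B| * C ≤ η * C ^ S.card * C := by
      rw [abs_mul, abs_of_nonneg hB0]
      refine mul_le_mul_of_nonneg_right (mul_le_mul (hη j) hB hB0 ?_) hC.le
      exact (abs_nonneg _).trans (hη j)
    rw [hsplit]
    calc _ ≤ (|K₀ (p j) * (A - B)| + |(K₀ (p j) - K₀ (q j)) * B|) * C :=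
          mul_le_mul_of_nonneg_right (abs_add_le _ _) hC.le
      _ ≤ C * (S.card * C ^ S.card * η) + η * C ^ S.card * C := by linarith
      _ = _ := by push_cast; ring

/-- Modulus of continuity of the rescaled product kernel. -/
theorem KernelAssumption.abs_scaledKernel_sub_le (hK : KernelAssumption K₀ C C' C'' ε)
    (hC : 0 < C) (hC'' : 0 < C'') (hε : 0 < ε) {h η : ℝ} (hh : 0 < h)
    {y z : EuclideanSpace ℝ (Fin d)} (hyz : ∀ i, |y i - z i| ≤ η) (x : EuclideanSpace ℝ (Fin d)) :
    |scaledKernel K₀ h y x - scaledKernel K₀ h z x| ≤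
      d * C ^ d * C'' / C * (η / h) ^ ε / h ^ d := by
  have hη : ∀ i, |K₀ ((x i - y i) / h) - K₀ ((x i - z i) / h)| ≤ C'' * (η / h) ^ ε := fun i => by
    refine (hK.holder _ _).trans (mul_le_mul_of_nonneg_left
      (Real.rpow_le_rpow (abs_nonneg _) ?_ hε.le) hC''.le)
    rw [← sub_div, abs_div, abs_of_pos hh]
    gcongr
    refine le_trans (le_of_eq ?_) (hyz i)
    congr 1
    ring
  have := hK.abs_prod_sub_prod_mul_le hC Finset.univ (fun i => (x i - y i) / h)
    (fun i => (x i - z i) / h) hη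
  rw [Finset.card_univ, Fintype.card_fin, ← le_div_iff₀ hC] at this
  rw [scaledKernel, scaledKernel, ← mul_sub, abs_mul, abs_of_pos (by positivity : 0 < 1 / h ^ d)]
  calc _ ≤ 1 / h ^ d * (d * C ^ d * (C'' * (η / h) ^ ε) / C) :=
        mul_le_mul_of_nonneg_left this (by positivity)
    _ = _ := by ring

/-! ## Kernel smoothing of the target -/

variable {f : EuclideanSpace ℝ (Fin d) → ℝ} {s c c' c'' : ℝ}

theorem TargetAssumption.le_const (hf : TargetAssumption f s c c' c'') (hc : 0 < c) (hc' : 0 < c')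
    (x : EuclideanSpace ℝ (Fin d)) : f x ≤ c := by
  refine (hf.subGaussian x).trans (mul_le_of_le_one_right hc.le (Real.exp_le_one_iff.2 ?_))
  nlinarith [mul_nonneg hc'.le (sq_nonneg ‖x‖)]

/-- Replaces the moment of order `s` of the kernel by its mass and second moment, the only ones that
are controlled. -/
theorem rpow_le_one_add_sq {t s : ℝ} (ht : 0 ≤ t) (hs : 0 < s) (hs2 : s ≤ 2) :
    t ^ s ≤ 1 + t ^ 2 := by
  rcases le_total t 1 with h | h
  · have := Real.rpow_le_one ht h hs.le
    nlinarith [sq_nonneg t]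
  · have := Real.rpow_le_rpow_of_exponent_le h hs2
    rw [Real.rpow_two] at this
    linarith

theorem integral_densityMeasure (hf : IsDensity f) (ψ : EuclideanSpace ℝ (Fin d) → ℝ) :
    ∫ x, ψ x ∂densityMeasure f = ∫ x, f x * ψ x := by
  rw [densityMeasure, integral_withDensity_eq_integral_toReal_smul hf.measurable.ennreal_ofReal
    (ae_of_all _ fun _ => ENNReal.ofReal_lt_top)]
  simp_rw [ENNReal.toReal_ofReal (hf.nonneg _), smul_eq_mul]

/-- Bias of the kernel estimate. -/
theorem TargetAssumption.sub_integral_scaledKernel_le (hf : TargetAssumption f s c c' c'')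
    (hK : KernelAssumption K₀ C C' C'' ε) (hd : 1 ≤ d) (hs : 0 < s) (hs2 : s ≤ 2)
    (hc : 0 < c) (hc' : 0 < c') (hc'' : 0 < c'') {h : ℝ} (hh : 0 < h)
    (y : EuclideanSpace ℝ (Fin d)) :
    f y - ∫ x, scaledKernel K₀ h y x ∂densityMeasure f ≤ c'' * (1 + C') * d * h ^ s := by
  rw [integral_densityMeasure hf.isDensity, integral_mul_scaledKernel f hh]
  have iK := hK.integrable_prodKernel (d := d)
  have ifK : Integrable fun v => f (y + h • v) * prodKernel K₀ v := by
    refine Integrable.bdd_mul (c := c) iK ?_ (ae_of_all _ fun v => ?_)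
    · exact (hf.isDensity.measurable.comp
        (measurable_const.add (measurable_id.const_smul h))).aestronglyMeasurable
    · rw [Real.norm_eq_abs, abs_of_nonneg (hf.isDensity.nonneg _)]
      exact hf.le_const hc hc' _
  -- One linear form covers both regimes: a multiple of the gradient for `s > 1`, zero otherwise.
  -- Its integral against the kernel vanishes in either case.
  obtain ⟨a, ha⟩ : ∃ a : EuclideanSpace ℝ (Fin d), ∀ v,
      (if 1 < s then inner ℝ (gradient f y) (h • v) else 0) = inner ℝ a v := by
    by_cases h1 : 1 < s
    · exact ⟨h • gradient f y, fun v => by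
        rw [if_pos h1, real_inner_smul_left, real_inner_smul_right]⟩
    · exact ⟨0, fun v => by rw [if_neg h1, inner_zero_left]⟩
  have ia := hK.integrable_inner_mul a
  have in2 := hK.integrable_norm_sq_mul (d := d)
  have hhs : 0 < h ^ s := Real.rpow_pos_of_pos hh s
  have hpt : ∀ v, f y * prodKernel K₀ v - f (y + h • v) * prodKernel K₀ v ≤
      c'' * h ^ s * (prodKernel K₀ v + ‖v‖ ^ 2 * prodKernel K₀ v) -
        inner ℝ a v * prodKernel K₀ v := by
    intro v
    have ht := (abs_le.1 (hf.taylor y (h • v))).1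
    rw [ha v, norm_smul, Real.norm_eq_abs, abs_of_pos hh,
      Real.mul_rpow hh.le (norm_nonneg _)] at ht
    have h3 : c'' * (h ^ s * ‖v‖ ^ s) ≤ c'' * (h ^ s * (1 + ‖v‖ ^ 2)) := by
      gcongr
      exact rpow_le_one_add_sq (norm_nonneg _) hs hs2
    have h4 : f y - f (y + h • v) ≤ c'' * (h ^ s * (1 + ‖v‖ ^ 2)) - inner ℝ a v := by linarith
    have := mul_le_mul_of_nonneg_right h4 (hK.prodKernel_nonneg v)
    nlinarith
  have hint := integral_mono ((iK.const_mul (f y)).sub ifK)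
    (((iK.add in2).const_mul (c'' * h ^ s)).sub ia) hpt
  rw [integral_sub' (iK.const_mul (f y)) ifK, integral_const_mul, hK.integral_prodKernel, mul_one,
    integral_sub' ((iK.add in2).const_mul (c'' * h ^ s)) ia, integral_const_mul,
    integral_add' iK in2, hK.integral_prodKernel, hK.integral_inner_mul, sub_zero] at hint
  have hd' : (1 : ℝ) ≤ d := by exact_mod_cast hd
  have := hK.integral_norm_sq_mul_le (d := d)
  calc _ ≤ _ := hint
    _ ≤ c'' * h ^ s * (1 + d * C') := by gcongr
    _ ≤ c'' * h ^ s * (d + d * C') := by gcongr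
    _ = _ := by ring

/-- Since `f ≤ c` and `ψ² ≤ S |ψ|`, the second moment is controlled by one sup norm and one `L¹`
norm. For a kernel this gives `c C^d / h^d` instead of the square of `C^d / h^d`. -/
theorem TargetAssumption.integral_sq_le (hf : TargetAssumption f s c c' c'') (hc : 0 < c)
    (hc' : 0 < c') {ψ : EuclideanSpace ℝ (Fin d) → ℝ} (hψ : Integrable ψ) {S : ℝ}
    (hS : ∀ x, |ψ x| ≤ S) :
    ∫ x, ψ x ^ 2 ∂densityMeasure f ≤ c * S * ∫ x, |ψ x| := by
  rw [integral_densityMeasure hf.isDensity, ← integral_const_mul]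
  refine integral_mono_of_nonneg (ae_of_all _ fun x => ?_) (hψ.abs.const_mul _)
    (ae_of_all _ fun x => ?_)
  · exact mul_nonneg (hf.isDensity.nonneg x) (sq_nonneg _)
  · have h1 : ψ x ^ 2 ≤ S * |ψ x| := by
      rw [← sq_abs, sq]
      exact mul_le_mul_of_nonneg_right (hS x) (abs_nonneg _)
    calc f x * ψ x ^ 2 ≤ c * (S * |ψ x|) :=
          mul_le_mul (hf.le_const hc hc' x) h1 (sq_nonneg _) hc.le
      _ = c * S * |ψ x| := by ring

theorem TargetAssumption.integral_scaledKernel_le (hf : TargetAssumption f s c c' c'')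
    (hK : KernelAssumption K₀ C C' C'' ε) (hc : 0 < c) (hc' : 0 < c') {h : ℝ} (hh : 0 < h)
    (y : EuclideanSpace ℝ (Fin d)) :
    ∫ x, scaledKernel K₀ h y x ∂densityMeasure f ≤ c := by
  rw [integral_densityMeasure hf.isDensity]
  calc _ ≤ ∫ x, c * scaledKernel K₀ h y x := by
        refine integral_mono_of_nonneg (ae_of_all _ fun x => ?_)
          ((hK.integrable_scaledKernel hh y).const_mul c) (ae_of_all _ fun x => ?_)
        · exact mul_nonneg (hf.isDensity.nonneg x) (hK.scaledKernel_nonneg hh y x)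
        · exact mul_le_mul_of_nonneg_right (hf.le_const hc hc' x) (hK.scaledKernel_nonneg hh y x)
    _ = c := by rw [integral_const_mul, hK.integral_scaledKernel hh, mul_one]

end Kernel

/-! ## Uniform lower deviation of the kernel density estimate -/

section Deviation

variable {d : ℕ} {K₀ : ℝ → ℝ} {C C' C'' ε : ℝ} {f : EuclideanSpace ℝ (Fin d) → ℝ}
  {s c c' c'' : ℝ}

theorem abs_integral_le_of_abs_le {Ω : Type*} [MeasurableSpace Ω] {μ : Measure Ω}
    [IsProbabilityMeasure μ] {ψ : Ω → ℝ} {S : ℝ} (hS : ∀ x, |ψ x| ≤ S) : |∫ x, ψ x ∂μ| ≤ S := by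
  have h : ∀ᵐ x ∂μ, ‖ψ x‖ ≤ S := ae_of_all _ hS
  simpa using norm_integral_le_of_norm_le_const h

theorem integral_centred_sq_le {Ω : Type*} [MeasurableSpace Ω] {μ : Measure Ω}
    [IsProbabilityMeasure μ] {ψ : Ω → ℝ} (i1 : Integrable ψ μ)
    (i2 : Integrable (fun x => ψ x ^ 2) μ) {m : ℝ} (hm : ∫ x, ψ x ∂μ = m) :
    ∫ x, (m - ψ x) ^ 2 ∂μ ≤ ∫ x, ψ x ^ 2 ∂μ := by
  have e : ∀ x, (m - ψ x) ^ 2 = m ^ 2 - 2 * m * ψ x + ψ x ^ 2 := fun x => by ring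
  simp_rw [e]
  rw [integral_add (f := fun x => m ^ 2 - 2 * m * ψ x)
    ((integrable_const _).sub (i1.const_mul _)) i2,
    integral_sub (integrable_const _) (i1.const_mul _), integral_const_mul, hm]
  simp only [integral_const, probReal_univ, smul_eq_mul]
  nlinarith [sq_nonneg m]

/-- With variance proxy `σ = c S J`, the exponent `k (l² σ - l t)` is minimal at `l = t / (2σ)`;
`htb` is the admissibility condition `l b ≤ 1` for that choice. -/
theorem TargetAssumption.pi_real_centred_sum_le (hf : TargetAssumption f s c c' c'')
    (hc : 0 < c) (hc' : 0 < c') {ψ : EuclideanSpace ℝ (Fin d) → ℝ} (hψm : Measurable ψ)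
    (hψ : Integrable ψ) {S J b t : ℝ} (hS0 : 0 < S) (hJ0 : 0 < J) (hS : ∀ x, |ψ x| ≤ S)
    (hJ : ∫ x, |ψ x| ≤ J) (hb : ∀ x, ∫ y, ψ y ∂densityMeasure f - ψ x ≤ b) (ht : 0 ≤ t)
    (htb : t * b ≤ 2 * (c * S * J)) (k : ℕ) :
    (Measure.pi fun _ : Fin k => densityMeasure f).real
      {x | k * t ≤ ∑ j, (∫ y, ψ y ∂densityMeasure f - ψ (x j))} ≤
      Real.exp (-(k * t ^ 2 / (4 * (c * S * J)))) := by
  have := hf.isDensity.isProbabilityMeasure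
  set ν := densityMeasure f
  set m := ∫ y, ψ y ∂ν with hm
  have i1 : Integrable ψ ν := integrable_of_abs_le hψm hS
  have i2 : Integrable (fun x => ψ x ^ 2) ν := by
    refine integrable_of_abs_le (hψm.pow_const 2) (B := S ^ 2) fun x => ?_
    rw [abs_pow]
    exact pow_le_pow_left₀ (abs_nonneg _) (hS x) 2
  have hσ : 0 < c * S * J := by positivity
  have h0 : ∫ x, (m - ψ x) ∂ν = 0 := by
    rw [integral_sub (integrable_const _) i1]
    simp [hm]
  have h2 : ∫ x, (m - ψ x) ^ 2 ∂ν ≤ c * S * J := by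
    have h3 := hf.integral_sq_le hc hc' hψ hS
    have h4 : c * S * ∫ x, |ψ x| ≤ c * S * J := mul_le_mul_of_nonneg_left hJ (by positivity)
    exact (integral_centred_sq_le i1 i2 hm.symm).trans (h3.trans h4)
  have hB : ∀ x, |m - ψ x| ≤ |m| + S := fun x =>
    (abs_sub _ _).trans (by linarith [hS x])
  have hl : 0 ≤ t / (2 * (c * S * J)) := by positivity
  have hlb : t / (2 * (c * S * J)) * b ≤ 1 := by
    rw [div_mul_eq_mul_div, div_le_one (by positivity)]
    exact htb
  refine (pi_real_sum_ge_le (measurable_const.sub hψm) hB hb h0 h2 hl hlb k _).trans_eq ?_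
  congr 1
  field_simp
  ring

/-- The average of the kernels centred at `y`, shifted by its mean, changed in sign and summed. -/
def deviation {k : ℕ} (K₀ : ℝ → ℝ) (f : EuclideanSpace ℝ (Fin d) → ℝ) (h : ℝ)
    (y : EuclideanSpace ℝ (Fin d)) (x : Fin k → EuclideanSpace ℝ (Fin d)) : ℝ :=
  ∑ j, (∫ u, scaledKernel K₀ h y u ∂densityMeasure f - scaledKernel K₀ h y (x j))

theorem measurable_deviation {k : ℕ} (hK : Measurable K₀) (h : ℝ)
    (y : EuclideanSpace ℝ (Fin d)) : Measurable (deviation (k := k) K₀ f h y) :=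
  Finset.measurable_sum _ fun j _ =>
    measurable_const.sub ((measurable_scaledKernel hK h y).comp (measurable_pi_apply j))

theorem KernelAssumption.integrable_scaledKernel_densityMeasure
    (hK : KernelAssumption K₀ C C' C'' ε) (hε : 0 < ε) (hf : IsDensity f) {h : ℝ} (hh : 0 < h)
    (y : EuclideanSpace ℝ (Fin d)) : Integrable (scaledKernel K₀ h y) (densityMeasure f) := by
  have := hf.isProbabilityMeasure
  refine integrable_of_abs_le (measurable_scaledKernel (hK.measurable hε) h y)
    (B := C ^ d / h ^ d) fun x => ?_
  rw [abs_of_nonneg (hK.scaledKernel_nonneg hh y x)]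
  exact hK.scaledKernel_le hh y x

/-- Only the lower deviation of the estimate matters. As the kernel is nonnegative, the centred
variable is bounded above by its mean, at most `c`, and the range of admissible `t` grows as `h`
shrinks. -/
theorem TargetAssumption.pi_real_deviation_le (hf : TargetAssumption f s c c' c'')
    (hK : KernelAssumption K₀ C C' C'' ε) (hε : 0 < ε) (hC : 0 < C) (hc : 0 < c) (hc' : 0 < c')
    {h t : ℝ} (hh : 0 < h) (ht : 0 ≤ t) (htb : t ≤ 2 * (C ^ d / h ^ d))
    (y : EuclideanSpace ℝ (Fin d)) (k : ℕ) :
    (Measure.pi fun _ : Fin k => densityMeasure f).real {x | k * t ≤ deviation K₀ f h y x} ≤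
      Real.exp (-(k * t ^ 2 / (4 * (c * (C ^ d / h ^ d) * 1)))) := by
  refine hf.pi_real_centred_sum_le hc hc' (measurable_scaledKernel (hK.measurable hε) h y)
    (hK.integrable_scaledKernel hh y) (b := c) (by positivity) one_pos (fun x => ?_) ?_
    (fun x => ?_) ht (by nlinarith) k
  · rw [abs_of_nonneg (hK.scaledKernel_nonneg hh y x)]
    exact hK.scaledKernel_le hh y x
  · simp_rw [abs_of_nonneg (hK.scaledKernel_nonneg hh y _)]
    exact (hK.integral_scaledKernel hh y).le
  · have := hf.integral_scaledKernel_le hK hc hc' hh y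
    linarith [hK.scaledKernel_nonneg hh y x]

/-- A difference of two kernels has `L¹` norm at most `2` and sup norm at most `S`. The variance is
thus proportional to `S`, and close centres give a large exponent at the same level `t`. -/
theorem TargetAssumption.pi_real_deviation_sub_le (hf : TargetAssumption f s c c' c'')
    (hK : KernelAssumption K₀ C C' C'' ε) (hε : 0 < ε) (hc : 0 < c) (hc' : 0 < c')
    {h t S : ℝ} (hh : 0 < h) (ht : 0 ≤ t) (htb : t ≤ 2 * c) (hS0 : 0 < S)
    {y z : EuclideanSpace ℝ (Fin d)} (hS : ∀ x, |scaledKernel K₀ h z x - scaledKernel K₀ h y x| ≤ S)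
    (k : ℕ) :
    (Measure.pi fun _ : Fin k => densityMeasure f).real
        {x | k * t ≤ deviation K₀ f h z x - deviation K₀ f h y x} ≤
      Real.exp (-(k * t ^ 2 / (4 * (c * S * 2)))) := by
  have := hf.isDensity.isProbabilityMeasure
  have im := hK.measurable hε
  have i1 := hK.integrable_scaledKernel_densityMeasure hε hf.isDensity hh z
  have i2 := hK.integrable_scaledKernel_densityMeasure hε hf.isDensity hh y
  have hψm : Measurable fun x => scaledKernel K₀ h z x - scaledKernel K₀ h y x :=
    (measurable_scaledKernel im h z).sub (measurable_scaledKernel im h y)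
  have hmean : |∫ x, (scaledKernel K₀ h z x - scaledKernel K₀ h y x) ∂densityMeasure f| ≤ S :=
    abs_integral_le_of_abs_le hS
  have key := hf.pi_real_centred_sum_le hc hc' hψm
    ((hK.integrable_scaledKernel hh z).sub (hK.integrable_scaledKernel hh y))
    (b := 2 * S) (J := 2) hS0 two_pos hS ?_ (fun x => ?_) ht (by nlinarith) k
  · refine le_of_eq_of_le ?_ key
    congr 1
    ext x
    simp only [Set.mem_ofPred_eq, deviation]
    rw [← Finset.sum_sub_distrib, integral_sub i1 i2]
    have : ∀ j, ∫ u, scaledKernel K₀ h z u ∂densityMeasure f - scaledKernel K₀ h z (x j) -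
        (∫ u, scaledKernel K₀ h y u ∂densityMeasure f - scaledKernel K₀ h y (x j)) =
        ∫ u, scaledKernel K₀ h z u ∂densityMeasure f -
          ∫ u, scaledKernel K₀ h y u ∂densityMeasure f -
        (scaledKernel K₀ h z (x j) - scaledKernel K₀ h y (x j)) := fun j => by ring
    simp_rw [this]
  · calc ∫ x, |scaledKernel K₀ h z x - scaledKernel K₀ h y x| ≤
        ∫ x, (scaledKernel K₀ h z x + scaledKernel K₀ h y x) := by
          refine integral_mono
            ((hK.integrable_scaledKernel hh z).sub (hK.integrable_scaledKernel hh y)).abs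
            ((hK.integrable_scaledKernel hh z).add (hK.integrable_scaledKernel hh y)) fun x => ?_
          have h1 := hK.scaledKernel_nonneg hh z x
          have h2 := hK.scaledKernel_nonneg hh y x
          exact abs_le.2 ⟨by linarith, by linarith⟩
      _ = 2 := by
          rw [integral_add (hK.integrable_scaledKernel hh z) (hK.integrable_scaledKernel hh y),
            hK.integral_scaledKernel hh, hK.integral_scaledKernel hh]
          norm_num
  · have h1 := (abs_le.1 hmean).2
    have h2 := (abs_le.1 (hS x)).1
    linarith

theorem KernelAssumption.deviation_le_add (hK : KernelAssumption K₀ C C' C'' ε) (hε : 0 < ε)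
    (hf : IsDensity f) {h S : ℝ} (hh : 0 < h) {y z : EuclideanSpace ℝ (Fin d)}
    (hS : ∀ x, |scaledKernel K₀ h z x - scaledKernel K₀ h y x| ≤ S) {k : ℕ}
    (x : Fin k → EuclideanSpace ℝ (Fin d)) :
    deviation K₀ f h z x ≤ deviation K₀ f h y x + k * (2 * S) := by
  have := hf.isProbabilityMeasure
  have i1 := hK.integrable_scaledKernel_densityMeasure hε hf hh z
  have i2 := hK.integrable_scaledKernel_densityMeasure hε hf hh y
  have hmean : |∫ x, (scaledKernel K₀ h z x - scaledKernel K₀ h y x) ∂densityMeasure f| ≤ S :=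
    abs_integral_le_of_abs_le hS
  rw [integral_sub i1 i2] at hmean
  rw [← sub_le_iff_le_add', deviation, deviation, ← Finset.sum_sub_distrib]
  calc _ ≤ ∑ _j : Fin k, 2 * S := Finset.sum_le_sum fun j _ => by
        have h1 := (abs_le.1 hmean).2
        have h2 := (abs_le.1 (hS (x j))).1
        linarith
    _ = k * (2 * S) := by simp

/-- Uniform control of the deviation over the points that a fine net approximates, by a union bound
over a coarse net and over the differences between the two nets. -/
theorem TargetAssumption.exists_event_of_nets (hf : TargetAssumption f s c c' c'')
    (hK : KernelAssumption K₀ C C' C'' ε) (hε : 0 < ε) (hC : 0 < C) (hC'' : 0 < C'') (hd : 1 ≤ d)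
    (hs : 0 < s) (hs2 : s ≤ 2) (hc : 0 < c) (hc' : 0 < c') (hc'' : 0 < c'') {h t₀ t₁ η₀ η₁ : ℝ}
    (hh : 0 < h) (ht₀ : 0 ≤ t₀) (ht₁ : 0 ≤ t₁) (hη₀ : 0 < η₀)
    (htb₀ : t₀ ≤ 2 * (C ^ d / h ^ d)) (htb₁ : t₁ ≤ 2 * c)
    (P Q : Finset (EuclideanSpace ℝ (Fin d)))
    (π : EuclideanSpace ℝ (Fin d) → EuclideanSpace ℝ (Fin d)) (hπ : ∀ z ∈ Q, π z ∈ P)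
    (hπ' : ∀ z ∈ Q, ∀ i, |z i - π z i| ≤ η₀) {k : ℕ} (hk : 0 < k) :
    ∃ G : Set (Fin k → EuclideanSpace ℝ (Fin d)), MeasurableSet G ∧
      (Measure.pi fun _ => densityMeasure f).real Gᶜ ≤
        P.card * Real.exp (-(k * t₀ ^ 2 / (4 * (c * (C ^ d / h ^ d) * 1)))) +
        Q.card * Real.exp (-(k * t₁ ^ 2 /
          (4 * (c * (d * C ^ d * C'' / C * (η₀ / h) ^ ε / h ^ d) * 2)))) ∧
      ∀ x ∈ G, ∀ y, (∃ z ∈ Q, ∀ i, |y i - z i| ≤ η₁) →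
        f y ≤ 1 / k * ∑ j, scaledKernel K₀ h y (x j) +
          (c'' * (1 + C') * d * h ^ s + t₀ + t₁ +
            2 * (d * C ^ d * C'' / C * (η₁ / h) ^ ε / h ^ d)) := by
  have := hf.isDensity.isProbabilityMeasure
  have hm := hK.measurable hε
  have hkR : (0 : ℝ) < k := by exact_mod_cast hk
  have hdR : (0 : ℝ) < d := by exact_mod_cast hd
  let A : EuclideanSpace ℝ (Fin d) → Set (Fin k → EuclideanSpace ℝ (Fin d)) :=
    fun y => {x | k * t₀ ≤ deviation K₀ f h y x}
  let B : EuclideanSpace ℝ (Fin d) → Set (Fin k → EuclideanSpace ℝ (Fin d)) :=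
    fun z => {x | k * t₁ ≤ deviation K₀ f h z x - deviation K₀ f h (π z) x}
  have hA : ∀ y, MeasurableSet (A y) := fun y =>
    measurableSet_le measurable_const (measurable_deviation hm h y)
  have hB : ∀ z, MeasurableSet (B z) := fun z =>
    measurableSet_le measurable_const
      ((measurable_deviation hm h z).sub (measurable_deviation hm h (π z)))
  refine ⟨((⋃ y ∈ P, A y) ∪ ⋃ z ∈ Q, B z)ᶜ, ?_, ?_, ?_⟩
  · exact ((P.measurableSet_biUnion fun y _ => hA y).union
      (Q.measurableSet_biUnion fun z _ => hB z)).compl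
  · rw [compl_compl]
    refine (measureReal_union_le _ _).trans (add_le_add ?_ ?_)
    · refine (measureReal_biUnion_finset_le _ _).trans ?_
      rw [← nsmul_eq_mul]
      exact Finset.sum_le_card_nsmul _ _ _ fun y _ =>
        hf.pi_real_deviation_le hK hε hC hc hc' hh ht₀ htb₀ y k
    · refine (measureReal_biUnion_finset_le _ _).trans ?_
      rw [← nsmul_eq_mul]
      refine Finset.sum_le_card_nsmul _ _ _ fun z hz => ?_
      refine hf.pi_real_deviation_sub_le hK hε hc hc' hh ht₁ htb₁ (by positivity)
        (fun x => ?_) k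
      exact hK.abs_scaledKernel_sub_le hC hC'' hε hh (hπ' z hz) x
  · rintro x hx y ⟨z, hz, hyz⟩
    simp only [Set.compl_union, Set.mem_inter_iff, Set.mem_compl_iff, Set.mem_iUnion, not_exists,
      A, B, Set.mem_ofPred_eq, not_le] at hx
    -- Chaining from the coarse net to `y`: `h1` is the coarse deviation, `h2` the increment to the
    -- fine net, `h3` the deterministic remainder, and `h4` the bias.
    have h1 := hx.1 (π z) (hπ z hz)
    have h2 := hx.2 z hz
    have h3 := hK.deviation_le_add hε hf.isDensity hh
      (hK.abs_scaledKernel_sub_le hC hC'' hε hh hyz) x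
    have h4 := hf.sub_integral_scaledKernel_le hK hd hs hs2 hc hc' hc'' hh y
    have h5 : deviation K₀ f h y x = k * ∫ u, scaledKernel K₀ h y u ∂densityMeasure f -
        ∑ j, scaledKernel K₀ h y (x j) := by
      simp [deviation, Finset.sum_sub_distrib]
    have h6 : ∫ u, scaledKernel K₀ h y u ∂densityMeasure f -
        1 / k * ∑ j, scaledKernel K₀ h y (x j) ≤
        t₀ + t₁ + 2 * (d * C ^ d * C'' / C * (η₁ / h) ^ ε / h ^ d) := by
      rw [← mul_le_mul_iff_of_pos_left hkR, mul_sub, ← mul_assoc, mul_one_div_cancel hkR.ne',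
        one_mul]
      linarith
    linarith

/-! ## Grids -/

/-- The point of the grid of mesh `1 / q` with integer coordinates `a`. -/
def gridPoint (q : ℕ) (a : Fin d → ℤ) : EuclideanSpace ℝ (Fin d) :=
  WithLp.toLp 2 fun i => (a i : ℝ) / q

/-- The grid of mesh `1 / q` in the cube of side `2 R`. -/
def grid (d q R : ℕ) : Finset (EuclideanSpace ℝ (Fin d)) := by
  classical
  exact (Fintype.piFinset fun _ : Fin d => Finset.Icc (-(R * q : ℕ) : ℤ) (R * q : ℕ)).image
    (gridPoint q)

/-- Rounding down to the grid of mesh `1 / q`. -/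
def roundGrid (q : ℕ) (x : EuclideanSpace ℝ (Fin d)) : EuclideanSpace ℝ (Fin d) :=
  gridPoint q fun i => ⌊x i * q⌋

theorem card_grid_le (q R : ℕ) : (grid d q R).card ≤ (2 * (R * q) + 1) ^ d := by
  classical
  refine Finset.card_image_le.trans ?_
  rw [Fintype.card_piFinset, Finset.prod_const, Finset.card_univ, Fintype.card_fin, Int.card_Icc]
  refine Nat.pow_le_pow_left ?_ d
  omega

theorem roundGrid_mem {q R : ℕ} {x : EuclideanSpace ℝ (Fin d)}
    (hx : ∀ i, |x i| ≤ R) : roundGrid q x ∈ grid d q R := by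
  classical
  refine Finset.mem_image_of_mem _ (Fintype.mem_piFinset.2 fun i => Finset.mem_Icc.2 ⟨?_, ?_⟩)
  · rw [Int.le_floor]
    push_cast
    have := (abs_le.1 (hx i)).1
    have hq : (0 : ℝ) ≤ q := Nat.cast_nonneg q
    nlinarith
  · have h1 : ((⌊x i * q⌋ : ℤ) : ℝ) ≤ ((R * q : ℕ) : ℤ) := by
      refine (Int.floor_le _).trans ?_
      push_cast
      exact mul_le_mul_of_nonneg_right (abs_le.1 (hx i)).2 (Nat.cast_nonneg q)
    exact_mod_cast h1

theorem abs_sub_roundGrid_le {q : ℕ} (hq : 0 < q) (x : EuclideanSpace ℝ (Fin d)) (i : Fin d) :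
    |x i - roundGrid q x i| ≤ 1 / q := by
  have hq' : (0 : ℝ) < q := by exact_mod_cast hq
  have h1 := Int.floor_le (x i * q)
  have h2 := Int.lt_floor_add_one (x i * q)
  have : x i - roundGrid q x i = (x i * q - ⌊x i * q⌋) / q := by
    simp only [roundGrid, gridPoint]
    field_simp
  rw [this, abs_of_nonneg (div_nonneg (by linarith) hq'.le)]
  gcongr
  linarith

theorem abs_le_of_mem_grid {q R : ℕ} (hq : 0 < q) {z : EuclideanSpace ℝ (Fin d)}
    (hz : z ∈ grid d q R) (i : Fin d) : |z i| ≤ R := by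
  classical
  have hq' : (0 : ℝ) < q := by exact_mod_cast hq
  obtain ⟨a, ha, rfl⟩ := Finset.mem_image.1 hz
  have h := Finset.mem_Icc.1 (Fintype.mem_piFinset.1 ha i)
  have h1 : -((R * q : ℕ) : ℝ) ≤ a i := by exact_mod_cast h.1
  have h2 : (a i : ℝ) ≤ (R * q : ℕ) := by exact_mod_cast h.2
  push_cast at h1 h2
  simp only [gridPoint]
  rw [abs_div, abs_of_pos hq', div_le_iff₀ hq', abs_le]
  exact ⟨h1, h2⟩

end Deviation

/-! ## Asymptotics of the bandwidth -/

section Bandwidth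

open Filter Topology

theorem eventually_le_log_div (A : ℝ) {δ : ℝ} (hδ : 0 < δ) (hδ1 : δ < 1) :
    ∀ᶠ k : ℕ in atTop, A ≤ Real.log k ∧ Real.log k ≤ Real.log (k / δ) := by
  filter_upwards [(Real.tendsto_log_atTop.comp tendsto_natCast_atTop_atTop).eventually_ge_atTop A,
    eventually_gt_atTop 0] with k hk hk0
  have hk' : (0 : ℝ) < k := by exact_mod_cast hk0
  refine ⟨hk, Real.log_le_log hk' ?_⟩
  rw [le_div_iff₀ hδ]
  nlinarith

theorem two_mul_add_pos {d : ℕ} (hd : 1 ≤ d) {s : ℝ} (hs : 0 < s) : 1 < 2 * s + d := by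
  have : (1 : ℝ) ≤ d := by exact_mod_cast hd
  linarith

theorem tendsto_bandwidth {d : ℕ} (hd : 1 ≤ d) {s δ : ℝ} (hs : 0 < s) (hδ : 0 < δ) :
    Tendsto (fun k => bandwidth d s δ k) atTop (𝓝 0) := by
  have hp := two_mul_add_pos hd hs
  have h1 := (Real.tendsto_pow_log_div_mul_add_atTop δ 0 1 hδ.ne').comp
    (tendsto_natCast_atTop_atTop.atTop_div_const hδ)
  have h2 : Tendsto (fun k : ℕ => Real.log (k / δ) / k) atTop (𝓝 0) := by
    refine h1.congr fun k => ?_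
    simp only [Function.comp_apply, pow_one, add_zero]
    rw [mul_div_cancel₀ _ hδ.ne']
  have h3 := h2.rpow_const (p := 1 / (2 * s + d)) (Or.inr (by positivity))
  rwa [Real.zero_rpow (by positivity)] at h3

theorem bandwidth_pos {d k : ℕ} {s δ : ℝ} (hk : 0 < k)
    (hL : 0 < Real.log (k / δ)) : 0 < bandwidth d s δ k :=
  Real.rpow_pos_of_pos (div_pos hL (by exact_mod_cast hk)) _

/-- The defining property of the bandwidth: a Bernstein exponent at level `h^s`, with variance of
order `h^(-d)`, is a constant times `log(k/δ)`. -/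
theorem mul_bandwidth_rpow {d k : ℕ} (hd : 1 ≤ d) {s δ : ℝ} (hs : 0 < s) (hk : 0 < k)
    (hL : 0 < Real.log (k / δ)) :
    k * ((bandwidth d s δ k ^ s) ^ 2 * bandwidth d s δ k ^ d) = Real.log (k / δ) := by
  have hp := two_mul_add_pos hd hs
  have hk' : (0 : ℝ) < k := by exact_mod_cast hk
  have hh := bandwidth_pos (d := d) (s := s) hk hL
  rw [← Real.rpow_natCast (bandwidth d s δ k) d, ← Real.rpow_natCast (bandwidth d s δ k ^ s) 2,
    ← Real.rpow_mul hh.le, ← Real.rpow_add hh, bandwidth, ← Real.rpow_mul (by positivity)]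
  have : 1 / (2 * s + d) * (s * ((2 : ℕ) : ℝ) + d) = 1 := by
    push_cast
    field_simp
  rw [this, Real.rpow_one]
  field_simp

theorem rpow_le_bandwidth {d k : ℕ} (hd : 1 ≤ d) {s δ : ℝ} (hs : 0 < s) (hk : 0 < k)
    (hL : 1 ≤ Real.log (k / δ)) : (k : ℝ) ^ (-(1 / (2 * s + d))) ≤ bandwidth d s δ k := by
  have hp := two_mul_add_pos hd hs
  have hk' : (0 : ℝ) < k := by exact_mod_cast hk
  rw [Real.rpow_neg hk'.le, ← Real.inv_rpow hk'.le, bandwidth]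
  refine Real.rpow_le_rpow (by positivity) ?_ (by positivity)
  rw [inv_eq_one_div]
  gcongr

theorem one_div_le_bandwidth {d k : ℕ} (hd : 1 ≤ d) {s δ : ℝ} (hs : 0 < s) (hk : 0 < k)
    (hL : 1 ≤ Real.log (k / δ)) : 1 / (k : ℝ) ≤ bandwidth d s δ k := by
  have hp := two_mul_add_pos hd hs
  have hk' : (1 : ℝ) ≤ k := by exact_mod_cast hk
  refine le_trans ?_ (rpow_le_bandwidth hd hs hk hL)
  rw [one_div, ← Real.rpow_neg_one]
  refine Real.rpow_le_rpow_of_exponent_le hk' (neg_le_neg ?_)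
  rw [div_le_one (by linarith)]
  exact hp.le

/-- The coarse mesh `1/k` is negligible against `h`, because `2s + d > 1`. Kernels at a fine point
and at its coarse projection are then close relative to their size `h^(-d)`. -/
theorem tendsto_one_div_div_bandwidth {d : ℕ} (hd : 1 ≤ d) {s δ ε : ℝ} (hs : 0 < s) (hδ : 0 < δ)
    (hδ1 : δ < 1) (hε : 0 < ε) :
    Tendsto (fun k : ℕ => (1 / (k : ℝ) / bandwidth d s δ k) ^ ε) atTop (𝓝 0) := by
  have hp := two_mul_add_pos hd hs
  have ha : 0 < 1 - 1 / (2 * s + d) := by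
    rw [sub_pos, div_lt_one (by linarith)]
    exact hp
  have h1 : Tendsto (fun k : ℕ => (k : ℝ) ^ (-(1 - 1 / (2 * s + d)))) atTop (𝓝 0) :=
    (tendsto_rpow_neg_atTop ha).comp tendsto_natCast_atTop_atTop
  have h2 : Tendsto (fun k : ℕ => 1 / (k : ℝ) / bandwidth d s δ k) atTop (𝓝 0) := by
    refine tendsto_of_tendsto_of_tendsto_of_le_of_le' tendsto_const_nhds h1 ?_ ?_
    · filter_upwards [eventually_le_log_div 1 hδ hδ1, eventually_gt_atTop 0] with k hk hk0
      have := bandwidth_pos (d := d) (s := s) hk0 (by linarith [hk.1, hk.2] :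
        0 < Real.log (k / δ))
      positivity
    · filter_upwards [eventually_le_log_div 1 hδ hδ1, eventually_gt_atTop 0] with k hk hk0
      have hk' : (0 : ℝ) < k := by exact_mod_cast hk0
      have hL := hk.1.trans hk.2
      have h3 := bandwidth_pos (d := d) (s := s) hk0 (by linarith : 0 < Real.log (k / δ))
      rw [div_le_iff₀ h3]
      calc 1 / (k : ℝ) = (k : ℝ) ^ (-(1 - 1 / (2 * s + d))) * (k : ℝ) ^ (-(1 / (2 * s + d))) := by
            rw [← Real.rpow_add hk', one_div, ← Real.rpow_neg_one]
            congr 1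
            ring
        _ ≤ _ := by
            gcongr
            exact rpow_le_bandwidth hd hs hk0 hL
  have h3 := h2.rpow_const (p := ε) (Or.inr hε.le)
  rwa [Real.zero_rpow hε.ne'] at h3

/-! ### Net cardinalities against Bernstein exponents -/

/-- The net has at most `(3 k^(B+1))^d` points, while the exponent provides `k^(-(B+2)d)`: one power
of `k` per coordinate remains. -/
theorem card_grid_mul_exp_le {d k B : ℕ} (hd : 1 ≤ d) (hk : 3 ≤ k) {E : ℝ}
    (hE : (B + 2) * d * Real.log k ≤ E) :
    ((grid d (k ^ B) k).card : ℝ) * Real.exp (-E) ≤ 3 / k := by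
  have hk' : (3 : ℝ) ≤ k := by exact_mod_cast hk
  have hk0 : (0 : ℝ) < k := by linarith
  have h1 : ((grid d (k ^ B) k).card : ℝ) ≤ (3 * (k : ℝ) ^ (B + 1)) ^ d := by
    have h := card_grid_le (d := d) (k ^ B) k
    have h' : ((grid d (k ^ B) k).card : ℝ) ≤ (2 * (k * (k : ℝ) ^ B) + 1) ^ d := by
      exact_mod_cast h
    refine h'.trans (pow_le_pow_left₀ (by positivity) ?_ d)
    have : (1 : ℝ) ≤ (k : ℝ) ^ (B + 1) := one_le_pow₀ (by linarith)
    rw [pow_succ'] at this ⊢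
    linarith
  have h2 : Real.exp (-E) ≤ (((k : ℝ) ^ (B + 2))⁻¹) ^ d := by
    calc Real.exp (-E) ≤ Real.exp (-((((B + 2) * d : ℕ) : ℝ) * Real.log k)) := by
          apply Real.exp_le_exp.2
          push_cast
          linarith
      _ = _ := by
          rw [Real.exp_neg, Real.exp_nat_mul, Real.exp_log hk0, pow_mul, inv_pow]
  calc _ ≤ (3 * (k : ℝ) ^ (B + 1)) ^ d * (((k : ℝ) ^ (B + 2))⁻¹) ^ d := by gcongr
    _ = (3 / k) ^ d := by
        rw [← mul_pow]
        congr 1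
        field_simp
        ring
    _ ≤ 3 / k := pow_le_of_le_one (by positivity) ((div_le_one hk0).2 hk') (by omega)

/-- The condition on `B` gives a factor `k^(-(d+s+1))`: `k^(-d)` pays for `h^(-d)`, `k^(-s)` is at
most `h^s`, and the last `1/k` absorbs the constant. -/
theorem fine_remainder_le {d B k : ℕ} {s ε D R h : ℝ} (hs : 0 < s) (hε : 0 < ε) (hD : 0 < D)
    (hB : d + s + 1 ≤ ((B : ℝ) - 1) * ε) (hk : 0 < k)
    (hh : 1 / (k : ℝ) ≤ h) (hR : 2 * D / k ≤ R) :
    2 * (D * (1 / ((k ^ B : ℕ) : ℝ) / h) ^ ε / h ^ d) ≤ R * h ^ s := by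
  have hk0 : (0 : ℝ) < k := by exact_mod_cast hk
  have hk1 : (1 : ℝ) ≤ k := by exact_mod_cast hk
  have hh0 : 0 < h := lt_of_lt_of_le (by positivity) hh
  have h1 : 1 / ((k ^ B : ℕ) : ℝ) / h ≤ (k : ℝ) ^ (-((B : ℝ) - 1)) := by
    rw [div_le_iff₀ hh0]
    calc 1 / ((k ^ B : ℕ) : ℝ) = (k : ℝ) ^ (-((B : ℝ) - 1)) * (1 / k) := by
          push_cast
          rw [one_div, one_div, ← Real.rpow_neg_one (k : ℝ), ← Real.rpow_add hk0,
            ← Real.rpow_natCast, ← Real.rpow_neg hk0.le]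
          congr 1
          ring
      _ ≤ _ := by gcongr
  have h2 : (1 / ((k ^ B : ℕ) : ℝ) / h) ^ ε ≤ (k : ℝ) ^ (-(d + s + 1 : ℝ)) := by
    calc _ ≤ ((k : ℝ) ^ (-((B : ℝ) - 1))) ^ ε := Real.rpow_le_rpow (by positivity) h1 hε.le
      _ = (k : ℝ) ^ (-((B : ℝ) - 1) * ε) := (Real.rpow_mul hk0.le _ _).symm
      _ ≤ _ := Real.rpow_le_rpow_of_exponent_le hk1 (by linarith)
  have h3 : (h ^ d)⁻¹ ≤ (k : ℝ) ^ (d : ℝ) := by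
    rw [Real.rpow_natCast, ← inv_pow]
    refine pow_le_pow_left₀ (by positivity) ?_ d
    rw [inv_le_comm₀ hh0 hk0, ← one_div]
    exact hh
  have h4 : (k : ℝ) ^ (-s) ≤ h ^ s := by
    rw [Real.rpow_neg hk0.le, ← Real.inv_rpow hk0.le, ← one_div]
    exact Real.rpow_le_rpow (by positivity) hh hs.le
  calc _ = 2 * D * ((1 / ((k ^ B : ℕ) : ℝ) / h) ^ ε * (h ^ d)⁻¹) := by rw [div_eq_mul_inv]; ring
    _ ≤ 2 * D * ((k : ℝ) ^ (-(d + s + 1 : ℝ)) * (k : ℝ) ^ (d : ℝ)) := by gcongr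
    _ = 2 * D / k * (k : ℝ) ^ (-s) := by
        rw [← Real.rpow_add hk0, show (-(d + s + 1 : ℝ) + d) = -1 + -s by ring,
          Real.rpow_add hk0, Real.rpow_neg_one]
        ring
    _ ≤ R * h ^ s := by
        have : 0 ≤ 2 * D / k := by positivity
        gcongr
        exact this.trans hR

theorem coarse_exponent_eq {k n R X c P u : ℝ} (hR : R ^ 2 = c * P) (hc : c ≠ 0) (hP : P ≠ 0)
    (hu : u ≠ 0) :
    k * (8 * n * R * X) ^ 2 / (4 * (c * (P / u) * 1)) = 16 * n ^ 2 * (k * (X ^ 2 * u)) := by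
  rw [mul_pow, mul_pow, hR]
  field_simp
  ring

/-- Here `P / (8 Q)` plays the role of the constant `16 n²` of the coarse exponent. It is unbounded
as the modulus `Q` of the increments tends to zero. -/
theorem fine_exponent_eq {k R X c P Q u : ℝ} (hR : R ^ 2 = c * P) (hc : c ≠ 0) (hQ : Q ≠ 0)
    (hu : u ≠ 0) :
    k * (R * X) ^ 2 / (4 * (c * (Q / u) * 2)) = P / (8 * Q) * (k * (X ^ 2 * u)) := by
  rw [mul_pow, hR]
  field_simp
  ring

/-- Uniform lower bound for the kernel density estimate of the target on a growing ball. -/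
theorem eventually_exists_uniform_event {d : ℕ} (hd : 1 ≤ d) {s C C' C'' ε c c' c'' δ η : ℝ}
    (hs : 0 < s) (hs2 : s ≤ 2) (hC : 0 < C) (hC'' : 0 < C'') (hε : 0 < ε)
    (hc : 0 < c) (hc' : 0 < c') (hc'' : 0 < c'') (hδ : 0 < δ) (hδ1 : δ < 1) (hη : 0 < η) :
    ∀ᶠ k : ℕ in atTop, ∀ (K₀ : ℝ → ℝ) (f : EuclideanSpace ℝ (Fin d) → ℝ),
      KernelAssumption K₀ C C' C'' ε → TargetAssumption f s c c' c'' →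
      ∃ G : Set (Fin k → EuclideanSpace ℝ (Fin d)), MeasurableSet G ∧
        (Measure.pi fun _ => densityMeasure f).real Gᶜ ≤ η ∧
        ∀ x ∈ G, ∀ y, ‖y‖ ≤ Real.log k →
          f y ≤ 1 / k * ∑ j, scaledKernel K₀ (bandwidth d s δ k) y (x j) +
            (c'' * (1 + C') * d + (8 * d + 2) * √(c * C ^ d)) * bandwidth d s δ k ^ s := by
  have hdR : (1 : ℝ) ≤ d := by exact_mod_cast hd
  set R := √(c * C ^ d) with hRdef
  have hR : 0 < R := Real.sqrt_pos.2 (by positivity)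
  have hR2 : R ^ 2 = c * C ^ d := Real.sq_sqrt (by positivity)
  set D := d * C ^ d * C'' / C with hDdef
  have hD : 0 < D := by positivity
  obtain ⟨B, hB⟩ := exists_nat_ge ((d + s + 1) / ε + 1)
  have hBε : d + s + 1 ≤ ((B : ℝ) - 1) * ε := by
    rw [← div_le_iff₀ hε]
    linarith
  have hband := tendsto_bandwidth (δ := δ) hd hs hδ
  have hbs : Tendsto (fun k => bandwidth d s δ k ^ s) atTop (𝓝 0) := by
    have := hband.rpow_const (p := s) (Or.inr hs.le)
    rwa [Real.zero_rpow hs.ne'] at this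
  have hinv : Tendsto (fun k : ℕ => 1 / (k : ℝ)) atTop (𝓝 0) := tendsto_one_div_atTop_nhds_zero_nat
  have e1 := (hbs.const_mul (8 * d * R)).eventually_le_const (u := 2 * C ^ d)
    (by rw [mul_zero]; positivity)
  have e2 := (hbs.const_mul R).eventually_le_const (u := 2 * c) (by rw [mul_zero]; positivity)
  have e3 := hband.eventually_le_const (u := 1) one_pos
  -- Eventually `C^d / (8 D ρ) ≥ (B + 2) d`, so the increments beat the fine net although `B` may be
  -- large.
  have e4 := ((tendsto_one_div_div_bandwidth hd hs hδ hδ1 hε).const_mul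
    ((B + 2) * d * (8 * D))).eventually_le_const (u := C ^ d) (by rw [mul_zero]; positivity)
  -- Each of the two nets fails with probability at most `3 / k`.
  have e5 := (hinv.const_mul 6).eventually_le_const (u := η) (by rwa [mul_zero])
  have e6 := (hinv.const_mul (2 * D)).eventually_le_const (u := R) (by rwa [mul_zero])
  filter_upwards [e1, e2, e3, e4, e5, e6, eventually_ge_atTop 3, eventually_le_log_div 1 hδ hδ1]
    with k h1 h2 h3 h4 h5 h6 hk3 hlog K₀ f hK hf
  have hk : 0 < k := by omega
  have hk0 : (0 : ℝ) < k := by exact_mod_cast hk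
  have hL : 1 ≤ Real.log (k / δ) := hlog.1.trans hlog.2
  have hlogk : 0 < Real.log k := by linarith [hlog.1]
  have hh := bandwidth_pos (d := d) (s := s) hk (by linarith : 0 < Real.log (k / δ))
  have hprod := mul_bandwidth_rpow hd hs hk (by linarith : 0 < Real.log (k / δ))
  have hkh := one_div_le_bandwidth hd hs hk hL
  set h := bandwidth d s δ k
  set X := h ^ s with hX
  have hX0 : 0 < X := Real.rpow_pos_of_pos hh s
  have hhd : h ^ d ≤ 1 := pow_le_one₀ hh.le h3
  have hhd0 : 0 < h ^ d := by positivity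
  set ρ := (1 / (k : ℝ) / h) ^ ε with hρ
  have hρ0 : 0 < ρ := Real.rpow_pos_of_pos (by positivity) ε
  have hkB : 0 < k ^ B := by positivity
  have hmapsto : ∀ z ∈ grid d (k ^ B) k, roundGrid k z ∈ grid d (k ^ 1) k := fun z hz => by
    rw [pow_one]
    exact roundGrid_mem (abs_le_of_mem_grid hkB hz)
  obtain ⟨G, hG, hGp, hGx⟩ := hf.exists_event_of_nets hK hε hC hC'' hd hs hs2 hc hc' hc''
    (t₀ := 8 * d * R * X) (t₁ := R * X) (η₀ := 1 / k) (η₁ := 1 / ((k ^ B : ℕ) : ℝ)) hh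
    (by positivity) (by positivity) (by positivity)
    (h1.trans (by
      gcongr
      rw [le_div_iff₀ hhd0]
      exact mul_le_of_le_one_right (by positivity) hhd)) h2
    -- The coarse mesh is written with exponent `1` so that the same cardinality bound serves both
    -- nets.
    (grid d (k ^ 1) k) (grid d (k ^ B) k) (roundGrid k) hmapsto
    (fun z _ i => abs_sub_roundGrid_le hk z i) hk
  refine ⟨G, hG, hGp.trans ?_, fun x hx y hy => (hGx x hx y ?_).trans ?_⟩
  · have b0 := card_grid_mul_exp_le (d := d) (k := k) (B := 1) hd hk3
      (E := k * (8 * d * R * X) ^ 2 / (4 * (c * (C ^ d / h ^ d) * 1))) (by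
        rw [coarse_exponent_eq hR2 hc.ne' (by positivity) hhd0.ne', hprod]
        push_cast
        have hd2 : (d : ℝ) ≤ d ^ 2 := by nlinarith
        calc ((1 : ℝ) + 2) * d * Real.log k ≤ 16 * d ^ 2 * Real.log k := by
              gcongr
              nlinarith
          _ ≤ _ := mul_le_mul_of_nonneg_left hlog.2 (by positivity))
    have b1 := card_grid_mul_exp_le (d := d) (k := k) (B := B) hd hk3
      (E := k * (R * X) ^ 2 / (4 * (c * (D * ρ / h ^ d) * 2))) (by
        rw [fine_exponent_eq hR2 hc.ne' (mul_pos hD hρ0).ne' hhd0.ne', hprod, ← mul_assoc]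
        have hq : ((B : ℝ) + 2) * d ≤ C ^ d / (8 * D * ρ) := by
          rw [le_div_iff₀ (by positivity)]
          linarith
        exact mul_le_mul hq hlog.2 hlogk.le (by positivity))
    have : 3 / (k : ℝ) + 3 / k = 6 * (1 / k) := by ring
    linarith
  · refine ⟨roundGrid (k ^ B) y, roundGrid_mem fun i => ?_, abs_sub_roundGrid_le hkB y⟩
    have hi : |y i| ≤ ‖y‖ := PiLp.norm_apply_le y i
    exact hi.trans (hy.trans (Real.log_le_self hk0.le))
  -- The constant `8 d + 2` is `8 d` for the coarse net, `1` for the increments and `1` for this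
  -- remainder.
  · have hrem := fine_remainder_le (d := d) (B := B) (k := k) hs hε hD hBε hk hkh (R := R)
      (by rw [← mul_one_div]; exact h6)
    linarith

end Bandwidth

/-! ## The initial stage -/

section StageOne

variable {d : ℕ}

/-- The accepted points form, whatever their number `k > b`, an element of `Γ k`. -/
def goodEvent {T : ℕ} (f e : EuclideanSpace ℝ (Fin d) → ℝ) (b : ℝ)
    (Γ : ∀ k : ℕ, Set (Fin k → EuclideanSpace ℝ (Fin d))) :
    Set (Fin T → EuclideanSpace ℝ (Fin d) × ℝ) :=
  {w | ∃ k : ℕ, b < k ∧ ∃ h : (accepted f e w).card = k, output f e w h ∈ Γ k}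

theorem goodEvent_eq_biUnion {T : ℕ} (f e : EuclideanSpace ℝ (Fin d) → ℝ) (b : ℝ)
    (Γ : ∀ k : ℕ, Set (Fin k → EuclideanSpace ℝ (Fin d))) :
    (goodEvent f e b Γ : Set (Fin T → EuclideanSpace ℝ (Fin d) × ℝ)) =
      ⋃ k ∈ (Finset.range (T + 1)).filter fun k : ℕ => b < k,
        {w | ∃ h : (accepted f e w).card = k, output f e w h ∈ Γ k} := by
  ext w
  simp only [goodEvent, Set.mem_ofPred_eq, Set.mem_iUnion, Finset.mem_filter, Finset.mem_range,
    exists_prop]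
  refine exists_congr fun k => ⟨fun ⟨hb, h, ho⟩ => ⟨⟨?_, hb⟩, h, ho⟩, fun ⟨⟨_, hb⟩, h⟩ => ⟨hb, h⟩⟩
  have := (accepted f e w).card_le_univ
  rw [h, Fintype.card_fin] at this
  omega

theorem measurableSet_output_mem {T k : ℕ} {f e : EuclideanSpace ℝ (Fin d) → ℝ}
    (hf : Measurable f) (he : Measurable e) {B : Set (Fin k → EuclideanSpace ℝ (Fin d))}
    (hB : MeasurableSet B) : MeasurableSet
      {w : Fin T → EuclideanSpace ℝ (Fin d) × ℝ |
        ∃ h : (accepted f e w).card = k, output f e w h ∈ B} :=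
  measurableSet_selected measurable_fst (measurableSet_acceptSet hf he) hB

theorem measurableSet_card_accepted_eq {T : ℕ} {f e : EuclideanSpace ℝ (Fin d) → ℝ}
    (hf : Measurable f) (he : Measurable e) (k : ℕ) : MeasurableSet
      {w : Fin T → EuclideanSpace ℝ (Fin d) × ℝ | (accepted f e w).card = k} := by
  convert measurableSet_output_mem hf he (T := T) (k := k) MeasurableSet.univ using 2
  simp

theorem measurableSet_goodEvent {T : ℕ} {f e : EuclideanSpace ℝ (Fin d) → ℝ} (hf : Measurable f)
    (he : Measurable e) {b : ℝ} {Γ : ∀ k : ℕ, Set (Fin k → EuclideanSpace ℝ (Fin d))}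
    (hΓ : ∀ k : ℕ, b < k → MeasurableSet (Γ k)) :
    MeasurableSet (goodEvent f e b Γ : Set (Fin T → EuclideanSpace ℝ (Fin d) × ℝ)) := by
  rw [goodEvent_eq_biUnion]
  exact Finset.measurableSet_biUnion _ fun k hk =>
    measurableSet_output_mem hf he (hΓ k (Finset.mem_filter.1 hk).2)

/-- Given that `k` points are accepted, they are i.i.d. with density `f`, so `Γ k` has conditional
probability at least `1 - η`. Summing over `k > b` leaves the probability that more than `b` points
are accepted. -/
theorem mul_le_drawLaw_real_goodEvent {T : ℕ} {f g : EuclideanSpace ℝ (Fin d) → ℝ} {M : ℝ}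
    (hf : IsDensity f) (hg : IsDensity g) (hM : 0 < M) (hle : ∀ x, f x ≤ M * g x) {b η : ℝ}
    {Γ : ∀ k : ℕ, Set (Fin k → EuclideanSpace ℝ (Fin d))}
    (hΓ : ∀ k : ℕ, b < k → MeasurableSet (Γ k) ∧
      1 - η ≤ (Measure.pi fun _ => densityMeasure f).real (Γ k)) :
    (1 - η) * (1 - (drawLaw T g).real
        {w | ((accepted f (fun z => M * g z) w).card : ℝ) ≤ b}) ≤
      (drawLaw T g).real (goodEvent f (fun z => M * g z) b Γ) := by
  have := isProbabilityMeasure_normalizedLaw hg.integrable hg.nonneg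
    (by rw [hg.integral_eq_one]; exact one_pos)
  have : IsProbabilityMeasure (drawLaw T g) := by unfold drawLaw; infer_instance
  have hiid := outputIID_drawLaw (m := T) hf hg.measurable hg.nonneg hM hle
  have he : Measurable fun z => M * g z := hg.measurable.const_mul M
  set e := fun z => M * g z
  set P := drawLaw T g
  set I := (Finset.range (T + 1)).filter fun k : ℕ => b < k with hI
  have hdisj : ∀ (k k' : ℕ), k ≠ k' → Disjoint
      {w : Fin T → EuclideanSpace ℝ (Fin d) × ℝ | (accepted f e w).card = k}
      {w | (accepted f e w).card = k'} := fun k k' hne =>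
    Set.disjoint_left.2 fun w h h' => hne (h.symm.trans h')
  have h1 : P.real (goodEvent f e b Γ) =
      ∑ k ∈ I, P.real {w | (accepted f e w).card = k} *
        (Measure.pi fun _ : Fin k => densityMeasure f).real (Γ k) := by
    rw [goodEvent_eq_biUnion, measureReal_biUnion_finset]
    · refine Finset.sum_congr rfl fun k hk => ?_
      rw [Measure.real, hiid k (Γ k) (hΓ k (Finset.mem_filter.1 hk).2).1, ENNReal.toReal_mul]
      rfl
    · intro k _ k' _ hne
      exact (hdisj k k' hne).mono (fun w hw => hw.1) fun w hw => hw.1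
    · exact fun k hk => measurableSet_output_mem hf.measurable he
        (hΓ k (Finset.mem_filter.1 hk).2).1
  have h2 : P.real {w | ((accepted f e w).card : ℝ) ≤ b}ᶜ =
      ∑ k ∈ I, P.real {w | (accepted f e w).card = k} := by
    rw [← measureReal_biUnion_finset]
    · congr 1
      ext w
      have hc := (accepted f e w).card_le_univ
      rw [Fintype.card_fin] at hc
      simp only [hI, Set.mem_compl_iff, Set.mem_ofPred_eq, not_le, Set.mem_iUnion,
        Finset.mem_filter, Finset.mem_range, exists_prop, exists_eq_right']
      exact ⟨fun h => ⟨by omega, h⟩, fun h => h.2⟩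
    · exact fun k _ k' _ hne => hdisj k k' hne
    · exact fun k _ => measurableSet_card_accepted_eq hf.measurable he k
  have hmeas : MeasurableSet {w : Fin T → EuclideanSpace ℝ (Fin d) × ℝ |
      ((accepted f e w).card : ℝ) ≤ b} := by
    have : {w : Fin T → EuclideanSpace ℝ (Fin d) × ℝ | ((accepted f e w).card : ℝ) ≤ b} =
        ⋃ k ∈ {k : ℕ | (k : ℝ) ≤ b}, {w | (accepted f e w).card = k} := by
      ext w
      simp
    rw [this]
    exact MeasurableSet.biUnion (Set.to_countable _) fun k _ =>
      measurableSet_card_accepted_eq hf.measurable he k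
  rw [← probReal_compl_eq_one_sub hmeas, h1, h2, Finset.mul_sum]
  refine Finset.sum_le_sum fun k hk => ?_
  rw [mul_comm]
  exact mul_le_mul_of_nonneg_left (hΓ k (Finset.mem_filter.1 hk).2).2 measureReal_nonneg

/-- With high probability, more than `N̄` points are accepted in the initial stage. -/
theorem drawLaw_real_card_le_Nbar {n : ℕ} {f g : EuclideanSpace ℝ (Fin d) → ℝ} {s M δ : ℝ}
    (hf : IsDensity f) (hg : IsDensity g) (hM : 0 < M) (hle : ∀ x, f x ≤ M * g x)
    (hδ : 0 < δ) (hδ1 : δ < 1) (hT0 : 0 < initCalls d s n)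
    (hT : 16 * Real.log (1 / δ) ≤ initCalls d s n) :
    (stageOneLaw g s n).real {w | ((accepted f (fun z => M * g z) w).card : ℝ) ≤
      Nbar d s M δ n} ≤ δ ^ 4 := by
  set T := initCalls d s n
  have hT' : (0 : ℝ) < T := by exact_mod_cast hT0
  set L := Real.log (1 / δ) with hL
  have hL0 : 0 < L := Real.log_pos (by rw [lt_div_iff₀ hδ]; linarith)
  set u := 2 * √(T * L) with hu
  have hu2 : u ^ 2 = 4 * T * L := by
    rw [hu, mul_pow, Real.sq_sqrt (by positivity)]
    ring
  have hu0 : 0 ≤ u := by positivity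
  -- `2u/T` minimises the exponent; it is admissible exactly because `T ≥ 16 log(1/δ)`.
  have hl1 : 2 * u / T ≤ 1 := by
    rw [div_le_one hT']
    refine le_of_sq_le_sq ?_ hT'.le
    rw [mul_pow, hu2]
    nlinarith
  have h := drawLaw_real_card_accepted_le (m := T) hf hg.measurable hg.integrable hg.nonneg hM hle
    (l := 2 * u / T) (by positivity) hl1 u
  rw [hg.integral_eq_one, mul_one, mul_one_div] at h
  refine h.trans_eq ?_
  -- The exponent is `-u²/T = -4 log(1/δ)`. The resulting `δ^4` leaves part of the budget `δ` for
  -- the other failures.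
  have hexp : (T : ℝ) * ((2 * u / T) ^ 2 * (1 / 4)) - 2 * u / T * u =
      ((4 : ℕ) : ℝ) * Real.log δ := by
    have : (T : ℝ) * ((2 * u / T) ^ 2 * (1 / 4)) - 2 * u / T * u = -(u ^ 2 / T) := by
      field_simp
      ring
    rw [this, hu2, hL, one_div, Real.log_inv]
    field_simp
    push_cast
    ring
  rw [hexp, Real.exp_nat_mul, Real.exp_log hδ]

end StageOne

/-! ## The pliable proposal -/

section Pliable

variable {d n T : ℕ} {K₀ : ℝ → ℝ} {f g : EuclideanSpace ℝ (Fin d) → ℝ}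
  {s M δ H C C' C'' ε : ℝ}

theorem fTilde_eq (w : Fin T → EuclideanSpace ℝ (Fin d) × ℝ) (x : EuclideanSpace ℝ (Fin d)) :
    fTilde K₀ f g s M δ w x =
      if ‖x‖ ≤ Real.log (accepted f (fun z => M * g z) w).card then
        1 / ((accepted f (fun z => M * g z) w).card : ℝ) *
          ∑ k ∈ accepted f (fun z => M * g z) w,
            scaledKernel K₀ (bandwidth d s δ (accepted f (fun z => M * g z) w).card) x (w k).1
      else 0 := by
  unfold fTilde scaledKernel
  simp only [← Finset.mul_sum]
  rw [← mul_assoc, one_div_mul_one_div]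

theorem sum_accepted_eq_sum_output {k : ℕ} {e : EuclideanSpace ℝ (Fin d) → ℝ}
    (w : Fin T → EuclideanSpace ℝ (Fin d) × ℝ) (h : (accepted f e w).card = k)
    (φ : EuclideanSpace ℝ (Fin d) → ℝ) :
    ∑ i ∈ accepted f e w, φ (w i).1 = ∑ j, φ (output f e w h j) := by
  rw [← Finset.sum_coe_sort (accepted f e w)]
  exact (((accepted f e w).orderIsoOfFin h).toEquiv.sum_comp
    fun i : accepted f e w => φ (w i).1).symm

theorem KernelAssumption.integrable_scaledKernel_center (hK : KernelAssumption K₀ C C' C'' ε)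
    {h : ℝ} (hh : 0 < h) (x : EuclideanSpace ℝ (Fin d)) :
    Integrable fun y => scaledKernel K₀ h y x := by
  simp_rw [scaledKernel_eq]
  exact ((hK.integrable_prodKernel.comp_smul (inv_ne_zero hh.ne')).comp_sub_left x).const_mul _

/-- The estimate is integrated over the evaluation point, with the sample point fixed; reflection
and translation invariance reduce this to the previous normalisation. -/
theorem KernelAssumption.integral_scaledKernel_center (hK : KernelAssumption K₀ C C' C'' ε)
    {h : ℝ} (hh : 0 < h) (x : EuclideanSpace ℝ (Fin d)) :
    ∫ y, scaledKernel K₀ h y x = 1 := by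
  have h1 := hK.integral_scaledKernel hh (0 : EuclideanSpace ℝ (Fin d))
  simp_rw [scaledKernel_eq, sub_zero] at h1
  simp_rw [scaledKernel_eq]
  rw [← h1]
  exact integral_sub_left_eq_self (fun u => (h ^ d)⁻¹ * prodKernel K₀ (h⁻¹ • u)) volume x

theorem KernelAssumption.fTilde_nonneg (hK : KernelAssumption K₀ C C' C'' ε)
    {w : Fin T → EuclideanSpace ℝ (Fin d) × ℝ}
    (hh : 0 < bandwidth d s δ (accepted f (fun z => M * g z) w).card)
    (x : EuclideanSpace ℝ (Fin d)) : 0 ≤ fTilde K₀ f g s M δ w x := by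
  rw [fTilde_eq]
  split_ifs
  · exact mul_nonneg (by positivity) (Finset.sum_nonneg fun k _ => hK.scaledKernel_nonneg hh _ _)
  · exact le_rfl

theorem KernelAssumption.fTilde_le (hK : KernelAssumption K₀ C C' C'' ε)
    {w : Fin T → EuclideanSpace ℝ (Fin d) × ℝ}
    (hh : 0 < bandwidth d s δ (accepted f (fun z => M * g z) w).card)
    (x : EuclideanSpace ℝ (Fin d)) :
    fTilde K₀ f g s M δ w x ≤ 1 / ((accepted f (fun z => M * g z) w).card : ℝ) *
      ∑ k ∈ accepted f (fun z => M * g z) w,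
        scaledKernel K₀ (bandwidth d s δ (accepted f (fun z => M * g z) w).card) x (w k).1 := by
  rw [fTilde_eq]
  split_ifs
  · exact le_rfl
  · exact mul_nonneg (by positivity) (Finset.sum_nonneg fun k _ => hK.scaledKernel_nonneg hh _ _)

theorem KernelAssumption.integrable_average_scaledKernel (hK : KernelAssumption K₀ C C' C'' ε)
    {h : ℝ} (hh : 0 < h) {ι : Type*} (A : Finset ι) (p : ι → EuclideanSpace ℝ (Fin d)) :
    Integrable fun x => 1 / (A.card : ℝ) * ∑ k ∈ A, scaledKernel K₀ h x (p k) :=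
  (integrable_finsetSum _ fun _ _ => hK.integrable_scaledKernel_center hh _).const_mul _

theorem KernelAssumption.integral_average_scaledKernel (hK : KernelAssumption K₀ C C' C'' ε)
    {h : ℝ} (hh : 0 < h) {ι : Type*} {A : Finset ι} (hA : 0 < A.card)
    (p : ι → EuclideanSpace ℝ (Fin d)) :
    ∫ x, 1 / (A.card : ℝ) * ∑ k ∈ A, scaledKernel K₀ h x (p k) = 1 := by
  have hN' : (A.card : ℝ) ≠ 0 := by exact_mod_cast hA.ne'
  rw [integral_const_mul, integral_finsetSum _ fun k _ => hK.integrable_scaledKernel_center hh _,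
    Finset.sum_congr rfl fun k _ => hK.integral_scaledKernel_center hh (p k)]
  simp only [Finset.sum_const, nsmul_eq_mul, mul_one]
  rw [one_div_mul_cancel hN']

theorem KernelAssumption.integrable_fTilde (hK : KernelAssumption K₀ C C' C'' ε) (hε : 0 < ε)
    (hf : Measurable f) (hg : Measurable g)
    {w : Fin T → EuclideanSpace ℝ (Fin d) × ℝ}
    (hh : 0 < bandwidth d s δ (accepted f (fun z => M * g z) w).card) :
    Integrable (fTilde K₀ f g s M δ w) := by
  have hj := measurable_fTilde (hK.measurable hε) hf hg s M δ T
  have hm : Measurable (fTilde K₀ f g s M δ w) := by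
    have := hj.comp (measurable_prodMk_left (x := w))
    simpa only [Function.comp_def] using this
  have hi := hK.integrable_average_scaledKernel hh (accepted f (fun z => M * g z) w)
    fun k => (w k).1
  refine hi.mono' hm.aestronglyMeasurable (ae_of_all _ fun x => ?_)
  rw [Real.norm_eq_abs, abs_of_nonneg (hK.fTilde_nonneg hh x)]
  exact hK.fTilde_le hh x

theorem KernelAssumption.integral_fTilde_le (hK : KernelAssumption K₀ C C' C'' ε) (hε : 0 < ε)
    (hf : Measurable f) (hg : Measurable g)
    {w : Fin T → EuclideanSpace ℝ (Fin d) × ℝ}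
    (hN : 0 < (accepted f (fun z => M * g z) w).card)
    (hh : 0 < bandwidth d s δ (accepted f (fun z => M * g z) w).card) :
    ∫ x, fTilde K₀ f g s M δ w x ≤ 1 :=
  (integral_mono (hK.integrable_fTilde hε hf hg hh)
    (hK.integrable_average_scaledKernel hh (accepted f (fun z => M * g z) w) fun k => (w k).1)
    (hK.fTilde_le hh)).trans_eq
    (hK.integral_average_scaledKernel hh hN fun k => (w k).1)

theorem ballVol_pos (hn : 1 < n) : 0 < ballVol d n := by
  have : 0 < Real.log n := Real.log_pos (by exact_mod_cast hn)
  exact ENNReal.toReal_pos (Metric.measure_closedBall_pos volume 0 this).ne'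
    measure_closedBall_lt_top.ne

theorem rBar_nonneg (hH : 0 < H) (hN : 0 ≤ Real.log (Nbar d s M δ n / δ))
    (hN0 : 0 ≤ Nbar d s M δ n) : 0 ≤ rBar d s M δ H n :=
  mul_nonneg (mul_nonneg measureReal_nonneg hH.le) (Real.rpow_nonneg (div_nonneg hN hN0) _)

theorem gBar_nonneg (hg : ∀ x, 0 ≤ g x) : 0 ≤ gBar g s M δ n := integral_nonneg hg

theorem one_le_rejConst (hr : 0 ≤ rBar d s M δ H n) (hM : 0 < M) (hg : ∀ x, 0 ≤ g x) :
    1 ≤ rejConst g s M δ H n := by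
  have := mul_nonneg hM.le (gBar_nonneg (s := s) (M := M) (δ := δ) (n := n) hg)
  unfold rejConst
  linarith

theorem envelope_eq (hW : 0 < rejConst g s M δ H n)
    (w : Fin T → EuclideanSpace ℝ (Fin d) × ℝ) (x : EuclideanSpace ℝ (Fin d)) :
    envelope K₀ f g s M δ H n w x = fTilde K₀ f g s M δ w x
      + rBar d s M δ H n * (if ‖x‖ ≤ Real.log n then 1 / ballVol d n else 0)
      + if Real.log (Nbar d s M δ n) ≤ ‖x‖ then M * g x else 0 := by
  unfold envelope pliable
  rw [← mul_assoc, mul_one_div_cancel hW.ne', one_mul]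
  simp only [mem_closedBall_zero_iff]

theorem envelope_nonneg (hK : KernelAssumption K₀ C C' C'' ε) (hM : 0 < M) (hg : ∀ x, 0 ≤ g x)
    (hr : 0 ≤ rBar d s M δ H n) {w : Fin T → EuclideanSpace ℝ (Fin d) × ℝ}
    (hh : 0 < bandwidth d s δ (accepted f (fun z => M * g z) w).card)
    (x : EuclideanSpace ℝ (Fin d)) : 0 ≤ envelope K₀ f g s M δ H n w x := by
  rw [envelope_eq (one_pos.trans_le (one_le_rejConst hr hM hg))]
  refine add_nonneg (add_nonneg (hK.fTilde_nonneg hh x) (mul_nonneg hr ?_)) ?_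
  · split_ifs
    · exact one_div_nonneg.2 measureReal_nonneg
    · exact le_rfl
  · split_ifs
    · exact mul_nonneg hM.le (hg x)
    · exact le_rfl

/-- The function `log x / x` decreases beyond `e`, here applied at `N̄/δ` and `k/δ`. A correction
computed from the deterministic `N̄` thus covers every larger sample size. -/
theorem bandwidth_rpow_le {k : ℕ} (hs : 0 < s) (hδ : 0 < δ) (hδ1 : δ < 1)
    (hN3 : Real.exp 1 ≤ Nbar d s M δ n) (hk : Nbar d s M δ n < k) :
    bandwidth d s δ k ^ s ≤
      (Real.log (Nbar d s M δ n / δ) / Nbar d s M δ n) ^ (s / (2 * s + d)) := by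
  set N := Nbar d s M δ n
  have hN0 : 0 < N := (Real.exp_pos 1).trans_le hN3
  have hk0 : (0 : ℝ) < k := hN0.trans hk
  have hNδ : Real.exp 1 ≤ N / δ := by
    rw [le_div_iff₀ hδ]
    nlinarith
  have hkδ : N / δ ≤ k / δ := by gcongr
  have hanti := Real.log_div_self_antitoneOn (Set.mem_Ici.2 hNδ)
    (Set.mem_Ici.2 (hNδ.trans hkδ)) hkδ
  have e : ∀ t : ℝ, Real.log (t / δ) / t = 1 / δ * (Real.log (t / δ) / (t / δ)) := fun t => by
    field_simp
  have hle : Real.log (k / δ) / k ≤ Real.log (N / δ) / N := by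
    rw [e, e N]
    exact mul_le_mul_of_nonneg_left hanti (by positivity)
  have hpos : 0 ≤ Real.log (k / δ) / k := by
    refine div_nonneg (Real.log_nonneg ?_) hk0.le
    exact (Real.one_le_exp zero_le_one).trans (hNδ.trans hkδ)
  rw [bandwidth, ← Real.rpow_mul hpos, one_div_mul_eq_div]
  exact Real.rpow_le_rpow hpos hle (by positivity)

/-- On the good event of the initial stage, the envelope dominates the target. -/
theorem le_envelope_of_mem_goodEvent (hK : KernelAssumption K₀ C C' C'' ε) (hM : 0 < M)
    (hg : ∀ x, 0 ≤ g x) (hle : ∀ x, f x ≤ M * g x) (hs : 0 < s) (hδ : 0 < δ) (hδ1 : δ < 1)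
    (hH : 0 < H) (hn : 1 < n)
    (hN3 : Real.exp 1 ≤ Nbar d s M δ n) (hNn : Nbar d s M δ n ≤ n)
    {Γ : ∀ k : ℕ, Set (Fin k → EuclideanSpace ℝ (Fin d))}
    (hΓ : ∀ k : ℕ, Nbar d s M δ n < k → ∀ x ∈ Γ k, ∀ y, ‖y‖ ≤ Real.log k →
      f y ≤ 1 / k * ∑ j, scaledKernel K₀ (bandwidth d s δ k) y (x j) +
        H * bandwidth d s δ k ^ s)
    {w : Fin T → EuclideanSpace ℝ (Fin d) × ℝ}
    (hw : w ∈ goodEvent f (fun z => M * g z) (Nbar d s M δ n) Γ) :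
    0 < (accepted f (fun z => M * g z) w).card ∧
    0 < bandwidth d s δ (accepted f (fun z => M * g z) w).card ∧
    ∀ x, f x ≤ envelope K₀ f g s M δ H n w x := by
  obtain ⟨k, hk, hcard, hout⟩ := hw
  set N := Nbar d s M δ n with hNdef
  have hN1 : 1 < N := (Real.one_lt_exp_iff.2 one_pos).trans_le hN3
  have hk1 : (1 : ℝ) < k := hN1.trans hk
  have hk0 : 0 < k := by exact_mod_cast one_pos.trans hk1
  have hlogk : 0 < Real.log (k / δ) := by
    refine Real.log_pos ?_
    rw [lt_div_iff₀ hδ]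
    nlinarith
  have hh : 0 < bandwidth d s δ k := bandwidth_pos hk0 hlogk
  have hlogN : 0 ≤ Real.log (N / δ) := by
    refine Real.log_nonneg ?_
    rw [le_div_iff₀ hδ]
    nlinarith
  have hr : 0 ≤ rBar d s M δ H n := rBar_nonneg hH hlogN (by linarith)
  refine ⟨by rw [hcard]; exact hk0, by rw [hcard]; exact hh, fun x => ?_⟩
  have hft : 0 ≤ fTilde K₀ f g s M δ w x := hK.fTilde_nonneg (by rw [hcard]; exact hh) x
  rw [envelope_eq (one_pos.trans_le (one_le_rejConst hr hM hg))]
  -- Far away `M g` dominates by itself. Otherwise `‖x‖ < log N̄` lies below both `log k` and `log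
  -- n`, so neither the estimate nor the uniform term is truncated.
  by_cases hx : Real.log N ≤ ‖x‖
  · rw [if_pos hx]
    have : 0 ≤ rBar d s M δ H n * (if ‖x‖ ≤ Real.log n then 1 / ballVol d n else 0) := by
      refine mul_nonneg hr ?_
      split_ifs
      · exact one_div_nonneg.2 measureReal_nonneg
      · exact le_rfl
    linarith [hle x]
  · rw [not_le] at hx
    have hxk : ‖x‖ ≤ Real.log k := hx.le.trans (Real.log_le_log (by linarith) hk.le)
    have hxn : ‖x‖ ≤ Real.log n := hx.le.trans (Real.log_le_log (by linarith) hNn)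
    rw [if_pos hxn, if_neg (not_le.2 hx), add_zero, fTilde_eq, hcard, if_pos hxk,
      sum_accepted_eq_sum_output w hcard (scaledKernel K₀ (bandwidth d s δ k) x)]
    have h1 := hΓ k hk _ hout x hxk
    have h2 : rBar d s M δ H n * (1 / ballVol d n) =
        H * (Real.log (N / δ) / N) ^ (s / (2 * s + d)) := by
      have := (ballVol_pos (d := d) hn).ne'
      rw [rBar, ← hNdef]
      field_simp
    have h3 := mul_le_mul_of_nonneg_left
      (bandwidth_rpow_le hs hδ hδ1 hN3 hk) hH.le
    rw [h2]
    linarith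

/-- The pliable proposal has total mass at most one. -/
theorem integrable_pliable (hK : KernelAssumption K₀ C C' C'' ε) (hε : 0 < ε) (hM : 0 < M)
    (hf : Measurable f) (hg : IsDensity g) (hr : 0 ≤ rBar d s M δ H n) (hn : 1 < n)
    (hN : 1 < Nbar d s M δ n) {w : Fin T → EuclideanSpace ℝ (Fin d) × ℝ}
    (hcard : 0 < (accepted f (fun z => M * g z) w).card)
    (hh : 0 < bandwidth d s δ (accepted f (fun z => M * g z) w).card) :
    Integrable (pliable K₀ f g s M δ H n w) ∧ ∫ x, pliable K₀ f g s M δ H n w x ≤ 1 := by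
  have hW := one_pos.trans_le (one_le_rejConst (n := n) (s := s) hr hM hg.nonneg)
  have i1 := hK.integrable_fTilde hε hf hg.measurable hh
  have m1 := hK.integral_fTilde_le hε hf hg.measurable hcard hh
  set V := ballVol d n with hVdef
  have hV : 0 < V := ballVol_pos hn
  set r := rBar d s M δ H n with hrdef
  set N := Nbar d s M δ n with hNdef
  have hlogN : 0 < Real.log N := Real.log_pos hN
  let b : EuclideanSpace ℝ (Fin d) → ℝ := fun x =>
    r * (if ‖x‖ ≤ Real.log n then 1 / V else 0)
  let t : EuclideanSpace ℝ (Fin d) → ℝ := fun x => if Real.log N ≤ ‖x‖ then M * g x else 0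
  have hb : b = fun x => r * (Metric.closedBall (0 : EuclideanSpace ℝ (Fin d))
      (Real.log n)).indicator (fun _ => 1 / V) x := by
    funext x
    by_cases hx : ‖x‖ ≤ Real.log n <;> simp [b, hx]
  have i2 : Integrable b := by
    rw [hb]
    refine Integrable.const_mul ?_ _
    rw [integrable_indicator_iff Metric.isClosed_closedBall.measurableSet]
    exact integrableOn_const measure_closedBall_lt_top.ne
  have m2 : ∫ x, b x = r := by
    rw [hb, integral_const_mul, integral_indicator Metric.isClosed_closedBall.measurableSet,
      setIntegral_const]
    change r * (V • (1 / V)) = r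
    rw [smul_eq_mul, mul_one_div_cancel hV.ne', mul_one]
  have ht : t = ((Metric.ball (0 : EuclideanSpace ℝ (Fin d)) (Real.log N))ᶜ).indicator
      fun x => M * g x := by
    funext x
    by_cases hx : Real.log N ≤ ‖x‖
    · simp [t, hx]
    · simp [t, hx, not_le.1 hx]
  have i3 : Integrable t := by
    rw [ht]
    exact (hg.integrable.const_mul M).indicator Metric.isOpen_ball.measurableSet.compl
  have m3 : ∫ x, t x = M * gBar g s M δ n := by
    rw [ht, integral_indicator Metric.isOpen_ball.measurableSet.compl, integral_const_mul]
    congr 1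
    refine setIntegral_congr_set ?_
    -- The proposal keeps `M g` on the sphere whereas `gBar` excludes it; the sphere is null since
    -- its radius is not zero.
    have hae : Metric.closedBall (0 : EuclideanSpace ℝ (Fin d)) (Real.log N) =ᵐ[volume]
        Metric.ball 0 (Real.log N) := by
      rw [← Metric.ball_union_sphere]
      exact union_ae_eq_left_of_ae_eq_empty (ae_eq_empty.2
        (Measure.addHaar_sphere_of_ne_zero volume 0 hlogN.ne'))
    exact (ae_eq_set_compl_compl.2 hae).symm
  have heq : pliable K₀ f g s M δ H n w = fun x =>
      1 / rejConst g s M δ H n * ((fTilde K₀ f g s M δ w x + b x) + t x) := by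
    funext x
    simp only [pliable, b, t, mem_closedBall_zero_iff]
    rfl
  have i12 : Integrable fun x => fTilde K₀ f g s M δ w x + b x := i1.add i2
  rw [heq]
  refine ⟨(i12.add i3).const_mul _, ?_⟩
  rw [integral_const_mul, integral_add i12 i3, integral_add i1 i2, m2, m3, one_div_mul_eq_div,
    div_le_one hW, rejConst]
  linarith

end Pliable

/-! ## Sizes of the quantities of the algorithm -/

section Sizes

open Filter Topology

variable {d : ℕ} {s M δ H a a' : ℝ}

theorem three_mul_add_pos (hd : 1 ≤ d) (hs : 0 < s) : 1 < 3 * s + d := by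
  have : (1 : ℝ) ≤ d := by exact_mod_cast hd
  linarith

theorem rate_pos (hd : 1 ≤ d) (hs : 0 < s) : 0 < s / (3 * s + d) :=
  div_pos hs (one_pos.trans (three_mul_add_pos hd hs))

/-- Makes a fluctuation of order `√n` negligible against the loss `n^(1 - s/(3s+d))`. -/
theorem rate_lt_half (hd : 1 ≤ d) (hs : 0 < s) : s / (3 * s + d) < 1 / 2 := by
  have := three_mul_add_pos hd hs
  rw [div_lt_div_iff₀ (by linarith) two_pos]
  have : (0 : ℝ) ≤ d := Nat.cast_nonneg d
  linarith

theorem density_exponent_le_one (hd : 1 ≤ d) (hs : 0 < s) : s / (2 * s + d) ≤ 1 := by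
  have := two_mul_add_pos hd hs
  rw [div_le_one (by linarith)]
  have : (0 : ℝ) ≤ d := Nat.cast_nonneg d
  linarith

theorem init_exponent_eq (hd : 1 ≤ d) (hs : 0 < s) :
    (2 * s + d) / (3 * s + d) = 1 - s / (3 * s + d) := by
  have := three_mul_add_pos hd hs
  field_simp
  ring

theorem rpow_le_initCalls (hd : 1 ≤ d) (hs : 0 < s) (n : ℕ) :
    (n : ℝ) ^ (1 - s / (3 * s + d)) ≤ initCalls d s n := by
  rw [← init_exponent_eq hd hs]
  exact Nat.le_ceil _

theorem initCalls_le (hd : 1 ≤ d) (hs : 0 < s) {n : ℕ} (hn : 1 ≤ n) :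
    (initCalls d s n : ℝ) ≤ 2 * (n * (n : ℝ) ^ (-(s / (3 * s + d)))) := by
  have hn' : (1 : ℝ) ≤ n := by exact_mod_cast hn
  have h0 := rate_lt_half hd hs
  have h1 : (initCalls d s n : ℝ) ≤ (n : ℝ) ^ (1 - s / (3 * s + d)) + 1 := by
    rw [← init_exponent_eq hd hs]
    exact (Nat.ceil_lt_add_one (by positivity)).le
  have h2 : (1 : ℝ) ≤ (n : ℝ) ^ (1 - s / (3 * s + d)) := Real.one_le_rpow hn' (by linarith)
  have h3 : (n : ℝ) * (n : ℝ) ^ (-(s / (3 * s + d))) = (n : ℝ) ^ (1 - s / (3 * s + d)) := by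
    rw [sub_eq_add_neg, Real.rpow_add (by linarith), Real.rpow_one]
  rw [h3]
  linarith

theorem initCalls_le_self (hd : 1 ≤ d) (hs : 0 < s) {n : ℕ} (hn : 1 ≤ n) :
    initCalls d s n ≤ n := by
  have hn' : (1 : ℝ) ≤ n := by exact_mod_cast hn
  have h0 := rate_pos hd hs
  refine Nat.ceil_le.2 ?_
  rw [init_exponent_eq hd hs]
  calc (n : ℝ) ^ (1 - s / (3 * s + d)) ≤ (n : ℝ) ^ (1 : ℝ) :=
        Real.rpow_le_rpow_of_exponent_le hn' (by linarith)
    _ = n := Real.rpow_one _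

theorem tendsto_initCalls (hd : 1 ≤ d) (hs : 0 < s) :
    Tendsto (fun n => (initCalls d s n : ℝ)) atTop atTop := by
  have h0 := rate_lt_half hd hs
  exact tendsto_atTop_mono (rpow_le_initCalls hd hs)
    ((tendsto_rpow_atTop (by linarith)).comp tendsto_natCast_atTop_atTop)

theorem log_one_div_pos (hδ : 0 < δ) (hδ1 : δ < 1) : 0 < Real.log (1 / δ) :=
  Real.log_pos (by rw [lt_div_iff₀ hδ]; linarith)

/-- The correction `2 √(T log(1/δ))` is at most half of the mean `T / M` once `T ≥ 16 M² log(1/δ)`.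
-/
theorem div_le_Nbar {n : ℕ} (hM : 0 < M)
    (hT : 16 * M ^ 2 * Real.log (1 / δ) ≤ initCalls d s n) :
    (initCalls d s n : ℝ) / (2 * M) ≤ Nbar d s M δ n := by
  rw [Nbar]
  set T := (initCalls d s n : ℝ)
  have hT0 : 0 ≤ T := Nat.cast_nonneg _
  set L := Real.log (1 / δ)
  have h : √(T * L) ≤ T / (4 * M) := by
    rw [Real.sqrt_le_left (by positivity), div_pow, le_div_iff₀ (by positivity)]
    nlinarith
  have : T / M = T / (2 * M) + 2 * (T / (4 * M)) := by
    field_simp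
    ring
  linarith

theorem Nbar_le_self (hd : 1 ≤ d) (hs : 0 < s) (hM : 1 ≤ M) {n : ℕ} (hn : 1 ≤ n) :
    Nbar d s M δ n ≤ n := by
  have h1 : (initCalls d s n : ℝ) / M ≤ initCalls d s n := div_le_self (Nat.cast_nonneg _) hM
  have h2 : (initCalls d s n : ℝ) ≤ n := by exact_mod_cast initCalls_le_self hd hs hn
  have h3 := Real.sqrt_nonneg (initCalls d s n * Real.log (1 / δ))
  rw [Nbar]
  linarith

/-- This is the balance behind `T_s`: `(1 - s/(3s+d)) · s/(2s+d) = s/(3s+d)`, so the estimation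
error at sample size of order `T_s` matches the fraction of the budget spent initially. -/
theorem inv_Nbar_rpow_le (hd : 1 ≤ d) (hs : 0 < s) (hM : 1 ≤ M) {n : ℕ} (hn : 1 ≤ n)
    (hN : (initCalls d s n : ℝ) / (2 * M) ≤ Nbar d s M δ n) :
    (Nbar d s M δ n)⁻¹ ^ (s / (2 * s + d)) ≤ 2 * M * (n : ℝ) ^ (-(s / (3 * s + d))) := by
  have hp2 := two_mul_add_pos hd hs
  have hp3 := three_mul_add_pos hd hs
  have hn' : (1 : ℝ) ≤ n := by exact_mod_cast hn
  have hn0 : (0 : ℝ) < n := by linarith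
  have hpow : 0 < (n : ℝ) ^ (1 - s / (3 * s + d)) := by positivity
  have h1 : (n : ℝ) ^ (1 - s / (3 * s + d)) / (2 * M) ≤ Nbar d s M δ n := by
    refine le_trans ?_ hN
    gcongr
    exact rpow_le_initCalls hd hs n
  have hN0 : 0 < Nbar d s M δ n := lt_of_lt_of_le (by positivity) h1
  have h2 : (Nbar d s M δ n)⁻¹ ≤ 2 * M * (n : ℝ) ^ (-(1 - s / (3 * s + d))) := by
    rw [inv_le_comm₀ hN0 (by positivity), mul_inv, Real.rpow_neg hn0.le, inv_inv,
      ← div_eq_inv_mul]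
    exact h1
  have hq0 : 0 ≤ s / (2 * s + d) := by positivity
  have hq1 := density_exponent_le_one hd hs
  calc _ ≤ (2 * M * (n : ℝ) ^ (-(1 - s / (3 * s + d)))) ^ (s / (2 * s + d)) :=
        Real.rpow_le_rpow (by positivity) h2 hq0
    _ = (2 * M) ^ (s / (2 * s + d)) * (n : ℝ) ^ (-(s / (3 * s + d))) := by
        rw [Real.mul_rpow (by positivity) (by positivity), ← Real.rpow_mul hn0.le]
        congr 2
        field_simp
        ring
    _ ≤ (2 * M) ^ (1 : ℝ) * (n : ℝ) ^ (-(s / (3 * s + d))) := by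
        gcongr
        linarith
    _ = _ := by rw [Real.rpow_one]

/-- The rate of the theorem, up to a constant. -/
def rate (d : ℕ) (s δ : ℝ) (n : ℕ) : ℝ :=
  Real.log (n / δ) ^ (d + 1) * (n : ℝ) ^ (-(s / (3 * s + d)))

theorem ballVol_eq (d : ℕ) {n : ℕ} (hn : 1 ≤ n) : ballVol d n =
    Real.log n ^ d * volume.real (Metric.ball (0 : EuclideanSpace ℝ (Fin d)) 1) := by
  rw [ballVol, Measure.addHaar_real_closedBall _ _ (Real.log_nonneg (by exact_mod_cast hn)),
    finrank_euclideanSpace_fin]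

/-- The ball volume contributes `d` logarithms and the density error at most one more, whence the
power `d + 1`. -/
theorem rBar_le (hd : 1 ≤ d) (hs : 0 < s) (hM : 1 ≤ M) (hH : 0 < H) (hδ : 0 < δ) (hδ1 : δ < 1)
    {n : ℕ} (hn : 1 ≤ n) (hN : (initCalls d s n : ℝ) / (2 * M) ≤ Nbar d s M δ n)
    (hN1 : 1 ≤ Nbar d s M δ n) (hlog : 1 ≤ Real.log (n / δ)) :
    rBar d s M δ H n ≤
      2 * M * H * volume.real (Metric.ball (0 : EuclideanSpace ℝ (Fin d)) 1) * rate d s δ n := by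
  have hn' : (1 : ℝ) ≤ n := by exact_mod_cast hn
  have hNn := Nbar_le_self (δ := δ) hd hs hM hn
  have hinv := inv_Nbar_rpow_le hd hs hM hn hN
  have hp2 := two_mul_add_pos hd hs
  have hq1 := density_exponent_le_one hd hs
  rw [rBar, ballVol_eq d hn, rate]
  set N := Nbar d s M δ n
  set V := volume.real (Metric.ball (0 : EuclideanSpace ℝ (Fin d)) 1)
  have hV : 0 ≤ V := measureReal_nonneg
  have hN0 : 0 < N := by linarith
  have hlogN : 0 ≤ Real.log (N / δ) := Real.log_nonneg (by rw [le_div_iff₀ hδ]; nlinarith)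
  have hlogn : 0 ≤ Real.log n := Real.log_nonneg hn'
  have h1 : Real.log (N / δ) ≤ Real.log (n / δ) :=
    Real.log_le_log (by positivity) (by gcongr)
  have h2 : Real.log n ≤ Real.log (n / δ) :=
    Real.log_le_log (by linarith) (by rw [le_div_iff₀ hδ]; nlinarith)
  have h3 : Real.log (N / δ) ^ (s / (2 * s + d)) ≤ Real.log (n / δ) :=
    calc _ ≤ Real.log (n / δ) ^ (s / (2 * s + d)) := Real.rpow_le_rpow hlogN h1 (by positivity)
      _ ≤ Real.log (n / δ) ^ (1 : ℝ) := Real.rpow_le_rpow_of_exponent_le hlog hq1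
      _ = _ := Real.rpow_one _
  rw [div_eq_mul_inv, Real.mul_rpow hlogN (by positivity)]
  calc _ ≤ Real.log (n / δ) ^ d * V * H *
        (Real.log (n / δ) * (2 * M * (n : ℝ) ^ (-(s / (3 * s + d))))) := by gcongr
    _ = _ := by ring

theorem integrable_exp_neg_mul_norm_sq {b : ℝ} (hb : 0 < b) :
    Integrable fun x : EuclideanSpace ℝ (Fin d) => Real.exp (-b * ‖x‖ ^ 2) := by
  have h := (GaussianFourier.integrable_cexp_neg_mul_sq_norm_add (b := (b : ℂ))
    (V := EuclideanSpace ℝ (Fin d)) (by simpa using hb) 0 0).norm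
  refine h.congr (ae_of_all _ fun x => ?_)
  simp only [Complex.norm_exp]
  congr 1
  simp [← Complex.ofReal_pow]

/-- Half of the Gaussian exponent is kept for integrability. The other half is at most `1/N̄` beyond
radius `log N̄`, since `(a'/2) log² N̄ ≥ log N̄`. -/
theorem gBar_le {f g : EuclideanSpace ℝ (Fin d) → ℝ} (ha : 0 < a) (ha' : 0 < a')
    (hg : ProposalAssumption f g M a a') {n : ℕ} (hN1 : 1 ≤ Nbar d s M δ n)
    (hN : 2 ≤ a' * Real.log (Nbar d s M δ n)) :
    gBar g s M δ n ≤ a * (∫ x : EuclideanSpace ℝ (Fin d), Real.exp (-(a' / 2) * ‖x‖ ^ 2)) *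
      (Nbar d s M δ n)⁻¹ := by
  have hi := integrable_exp_neg_mul_norm_sq (d := d) (half_pos ha')
  unfold gBar
  set N := Nbar d s M δ n
  have hN0 : 0 < N := by linarith
  have hlog : 0 ≤ Real.log N := Real.log_nonneg hN1
  have hpt : ∀ x ∈ (Metric.closedBall (0 : EuclideanSpace ℝ (Fin d)) (Real.log N))ᶜ,
      g x ≤ a * N⁻¹ * Real.exp (-(a' / 2) * ‖x‖ ^ 2) := by
    intro x hx
    rw [Set.mem_compl_iff, mem_closedBall_zero_iff, not_le] at hx
    refine (hg.subGaussian x).trans ?_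
    rw [mul_assoc]
    refine mul_le_mul_of_nonneg_left ?_ ha.le
    have h1 : -a' * ‖x‖ ^ 2 ≤ -Real.log N + -(a' / 2) * ‖x‖ ^ 2 := by
      have h2 : Real.log N ^ 2 ≤ ‖x‖ ^ 2 := pow_le_pow_left₀ hlog hx.le 2
      have h3 : 2 * Real.log N ≤ a' * Real.log N ^ 2 := by nlinarith
      nlinarith
    calc Real.exp (-a' * ‖x‖ ^ 2) ≤ Real.exp (-Real.log N + -(a' / 2) * ‖x‖ ^ 2) :=
          Real.exp_le_exp.2 h1
      _ = _ := by rw [Real.exp_add, Real.exp_neg, Real.exp_log hN0]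
  calc _ ≤ ∫ x in (Metric.closedBall (0 : EuclideanSpace ℝ (Fin d)) (Real.log N))ᶜ,
        a * N⁻¹ * Real.exp (-(a' / 2) * ‖x‖ ^ 2) :=
        setIntegral_mono_on hg.isDensity.integrable.integrableOn (hi.const_mul _).integrableOn
          Metric.isClosed_closedBall.measurableSet.compl hpt
    _ ≤ ∫ x, a * N⁻¹ * Real.exp (-(a' / 2) * ‖x‖ ^ 2) :=
        setIntegral_le_integral (hi.const_mul _) (ae_of_all _ fun x => by
          have := Real.exp_pos (-(a' / 2) * ‖x‖ ^ 2)
          simp only [Pi.zero_apply]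
          positivity)
    _ = _ := by
        rw [integral_const_mul]
        ring

/-- The constant of the bound on the normalisation. -/
def rejRate (d : ℕ) (M H a a' : ℝ) : ℝ :=
  2 * M * H * volume.real (Metric.ball (0 : EuclideanSpace ℝ (Fin d)) 1) +
    2 * M * (M * (a * ∫ x : EuclideanSpace ℝ (Fin d), Real.exp (-(a' / 2) * ‖x‖ ^ 2)))

theorem rejRate_nonneg (hM : 0 < M) (hH : 0 < H) (ha : 0 < a) : 0 ≤ rejRate d M H a a' := by
  have h1 : 0 ≤ ∫ x : EuclideanSpace ℝ (Fin d), Real.exp (-(a' / 2) * ‖x‖ ^ 2) :=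
    integral_nonneg fun x => (Real.exp_pos _).le
  have h2 : 0 ≤ volume.real (Metric.ball (0 : EuclideanSpace ℝ (Fin d)) 1) := measureReal_nonneg
  unfold rejRate
  positivity

theorem rejConst_le {f g : EuclideanSpace ℝ (Fin d) → ℝ} (hd : 1 ≤ d) (hs : 0 < s) (hM : 1 ≤ M)
    (hH : 0 < H) (hδ : 0 < δ) (hδ1 : δ < 1) (ha : 0 < a) (ha' : 0 < a')
    (hg : ProposalAssumption f g M a a') {n : ℕ} (hn : 1 ≤ n)
    (hN : (initCalls d s n : ℝ) / (2 * M) ≤ Nbar d s M δ n) (hN1 : 1 ≤ Nbar d s M δ n)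
    (hN2 : 2 ≤ a' * Real.log (Nbar d s M δ n)) (hlog : 1 ≤ Real.log (n / δ)) :
    rejConst g s M δ H n ≤ 1 + rejRate d M H a a' * rate d s δ n := by
  have h1 := rBar_le hd hs hM hH hδ hδ1 hn hN hN1 hlog
  have h2 := gBar_le ha ha' hg hN1 hN2
  have h3 := inv_Nbar_rpow_le hd hs hM hn hN
  have hp2 := two_mul_add_pos hd hs
  have hq1 := density_exponent_le_one hd hs
  set N := Nbar d s M δ n
  have hinv0 : 0 < N⁻¹ := inv_pos.2 (by linarith)
  -- The tail of `g` is of order `1/N̄`, smaller than the density error because `s/(2s+d) ≤ 1`.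
  have h4 : N⁻¹ ≤ N⁻¹ ^ (s / (2 * s + d)) := by
    have := Real.rpow_le_rpow_of_exponent_ge hinv0 (inv_le_one_of_one_le₀ hN1) hq1
    rwa [Real.rpow_one] at this
  have hn0 : (0 : ℝ) < n := by exact_mod_cast hn
  have h5 : (n : ℝ) ^ (-(s / (3 * s + d))) ≤ rate d s δ n :=
    le_mul_of_one_le_left (by positivity) (one_le_pow₀ hlog)
  have hI : 0 ≤ ∫ x : EuclideanSpace ℝ (Fin d), Real.exp (-(a' / 2) * ‖x‖ ^ 2) :=
    integral_nonneg fun x => (Real.exp_pos _).le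
  set I := ∫ x : EuclideanSpace ℝ (Fin d), Real.exp (-(a' / 2) * ‖x‖ ^ 2) with hIdef
  have h6 : N⁻¹ ≤ 2 * M * rate d s δ n :=
    (h4.trans h3).trans (mul_le_mul_of_nonneg_left h5 (by positivity))
  have h7 : M * gBar g s M δ n ≤ M * (a * I * (2 * M * rate d s δ n)) := by
    gcongr
    exact h2.trans (by gcongr)
  rw [rejConst, rejRate, ← hIdef]
  linarith

/-- The target number of samples is below the expected number minus the fluctuations. -/
theorem mul_one_sub_le {n T : ℕ} {W Λ κ x : ℝ} (hTn : T ≤ n) (hT : (T : ℝ) ≤ 2 * (n * x))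
    (hW1 : 1 ≤ W) (hW : W ≤ 1 + κ * Λ) (hxΛ : x ≤ Λ) {p : ℝ} (hp : 1 / W ≤ p) :
    (n : ℝ) * (1 - (κ + 3) * Λ) ≤ ((n - T : ℕ) : ℝ) * p - n * x := by
  have hm : ((n - T : ℕ) : ℝ) = n - T := Nat.cast_sub hTn
  have hm0 : 0 ≤ (n : ℝ) - T := sub_nonneg.2 (by exact_mod_cast hTn)
  have hT0 : (0 : ℝ) ≤ T := Nat.cast_nonneg T
  have hn0 : (0 : ℝ) ≤ n := Nat.cast_nonneg n
  have h1 : 1 - κ * Λ ≤ p := by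
    refine le_trans ?_ hp
    rw [le_div_iff₀ (by linarith)]
    -- Uses `1 - κΛ ≤ 2 - W` and `(2 - W) W = 1 - (W - 1)²`.
    nlinarith [sq_nonneg (W - 1)]
  have hκΛ : 0 ≤ κ * Λ := by linarith
  have h2 : ((n : ℝ) - T) * (1 - κ * Λ) ≤ (n - T) * p := mul_le_mul_of_nonneg_left h1 hm0
  have h3 : (n : ℝ) * x ≤ n * Λ := mul_le_mul_of_nonneg_left hxΛ hn0
  rw [hm]
  -- The `3` collects `2` from the calls of the initial stage and `1` from the fluctuation.
  nlinarith [mul_nonneg hT0 hκΛ]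

/-- With `l = n^(-1/2)` the variance term stays below `1/4`, while the gain is `n^(1/2 - s/(3s+d))`,
which tends to infinity. -/
theorem eventually_fluctuation_le (hd : 1 ≤ d) (hs : 0 < s) {η : ℝ} (hη : 0 < η) :
    ∀ᶠ n : ℕ in atTop, ∀ m : ℕ, m ≤ n →
      Real.exp (m * (((n : ℝ) ^ (-(1 / 2 : ℝ))) ^ 2 * (1 / 4)) -
        (n : ℝ) ^ (-(1 / 2 : ℝ)) * (n * (n : ℝ) ^ (-(s / (3 * s + d))))) ≤ η := by
  have h0 := rate_lt_half hd hs
  have ht : Tendsto (fun n : ℕ => (n : ℝ) ^ (1 / 2 - s / (3 * s + d))) atTop atTop :=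
    (tendsto_rpow_atTop (by linarith)).comp tendsto_natCast_atTop_atTop
  filter_upwards [ht.eventually_ge_atTop (1 / 4 - Real.log η), eventually_gt_atTop 0]
    with n hn hn0 m hm
  have hn' : (0 : ℝ) < n := by exact_mod_cast hn0
  have hm' : (m : ℝ) ≤ n := by exact_mod_cast hm
  rw [← Real.le_log_iff_exp_le hη]
  have e1 : ((n : ℝ) ^ (-(1 / 2 : ℝ))) ^ 2 = (n : ℝ)⁻¹ := by
    rw [← Real.rpow_natCast, ← Real.rpow_mul hn'.le, ← Real.rpow_neg_one]
    norm_num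
  have e2 : (n : ℝ) ^ (-(1 / 2 : ℝ)) * (n * (n : ℝ) ^ (-(s / (3 * s + d)))) =
      (n : ℝ) ^ (1 / 2 - s / (3 * s + d)) := by
    nth_rewrite 2 [← Real.rpow_one (n : ℝ)]
    rw [← Real.rpow_add hn', ← Real.rpow_add hn']
    congr 1
    ring
  rw [e1, e2]
  have h2 : (m : ℝ) * ((n : ℝ)⁻¹ * (1 / 4)) ≤ 1 / 4 := by
    rw [← mul_assoc, ← div_eq_mul_inv]
    have := (div_le_one hn').2 hm'
    linarith
  linarith

/-- Only `v ≥ 0` matters, since the two-net bound has a constant free of `ε`; then `8 d + 2 ≤ 16 d`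
finishes. -/
theorem kernel_const_le {v C C' ε c c'' C'' : ℝ} (hd : 1 ≤ d) (hs : 0 < s) (hε : 0 < ε)
    (hC : 0 < C) (hC' : 0 < C') (hC'' : 0 < C'') (hc : 0 < c) (hc'' : 0 < c'')
    (hv : v = vConst s ε c c'' C'') :
    c'' * (1 + C') * d + (8 * d + 2) * √(c * C ^ d) ≤
      8 * d * (v + 1) * (2 * √(c * C ^ d) + c'' * (1 + C') * d + C ^ d) := by
  have hv0 : 0 ≤ v := by
    rw [hv, vConst]
    have h1 : 0 ≤ Real.log (1 + 1 / (c'' + c)) := Real.log_nonneg (by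
      have : 0 < 1 / (c'' + c) := by positivity
      linarith)
    have h2 : 0 ≤ Real.log (1 + 1 / (C'' * c)) := Real.log_nonneg (by
      have : 0 < 1 / (C'' * c) := by positivity
      linarith)
    have h3 : 0 < min 1 s := lt_min one_pos hs
    positivity
  have hd' : (1 : ℝ) ≤ d := by exact_mod_cast hd
  set R := √(c * C ^ d)
  have hR : 0 ≤ R := Real.sqrt_nonneg _
  set A := c'' * (1 + C') * d
  have hA : 0 ≤ A := by positivity
  have hCd : 0 ≤ C ^ d := by positivity
  have h1 : (8 * d : ℝ) ≤ 8 * d * (v + 1) := le_mul_of_one_le_right (by positivity) (by linarith)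
  calc A + (8 * d + 2) * R ≤ 8 * d * (2 * R + A + C ^ d) := by nlinarith
    _ ≤ _ := mul_le_mul_of_nonneg_right h1 (by positivity)

end Sizes

/-! ## Success probability of a run -/

section Run

variable {d n : ℕ} {K₀ : ℝ → ℝ} {f g : EuclideanSpace ℝ (Fin d) → ℝ} {s M δ H : ℝ}

/-- The second stage returns many points once the envelope dominates the target. -/
theorem ofReal_le_stageTwoLaw (hf : IsDensity f) (hW : 0 < rejConst g s M δ H n)
    {w : Fin (initCalls d s n) → EuclideanSpace ℝ (Fin d) × ℝ}
    (hq : Measurable (pliable K₀ f g s M δ H n w))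
    (hqi : Integrable (pliable K₀ f g s M δ H n w))
    (hq0 : ∀ x, 0 ≤ pliable K₀ f g s M δ H n w x)
    (hle : ∀ x, f x ≤ envelope K₀ f g s M δ H n w x) {l u t η : ℝ} (hl : 0 ≤ l) (hl1 : l ≤ 1)
    (ht : t ≤ ((n - initCalls d s n : ℕ) : ℝ) *
      (1 / (rejConst g s M δ H n * ∫ x, pliable K₀ f g s M δ H n w x)) - u)
    (hexp : Real.exp (((n - initCalls d s n : ℕ) : ℝ) * (l ^ 2 * (1 / 4)) - l * u) ≤ η) :
    ENNReal.ofReal (1 - η) ≤ stageTwoLaw K₀ f g s M δ H n w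
      {y | t ≤ ((accepted f (envelope K₀ f g s M δ H n w) y).card : ℝ)} := by
  have hpos : 0 < ∫ x, pliable K₀ f g s M δ H n w x :=
    pos_of_mul_pos_right (one_pos.trans_le (hf.one_le_mul_integral hqi hle)) hW.le
  have := isProbabilityMeasure_normalizedLaw hqi hq0 hpos
  have : IsProbabilityMeasure (stageTwoLaw K₀ f g s M δ H n w) := by
    unfold stageTwoLaw drawLaw
    infer_instance
  have h := drawLaw_real_card_accepted_le (m := n - initCalls d s n) hf hq hqi hq0 hW hle hl hl1 u
  set P := stageTwoLaw K₀ f g s M δ H n w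
  set E := {y : Fin (n - initCalls d s n) → EuclideanSpace ℝ (Fin d) × ℝ |
    t ≤ ((accepted f (envelope K₀ f g s M δ H n w) y).card : ℝ)}
  have hcompl : P.real Eᶜ ≤ η := by
    refine le_trans ?_ (h.trans hexp)
    refine measureReal_mono fun y hy => ?_
    have hy' : ¬ t ≤ ((accepted f (envelope K₀ f g s M δ H n w) y).card : ℝ) := hy
    exact (not_le.1 hy').le.trans ht
  have hsum : 1 ≤ P.real E + P.real Eᶜ := by
    have := measureReal_union_le (μ := P) E Eᶜ
    rwa [Set.union_compl_self, probReal_univ] at this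
  rw [← ofReal_measureReal]
  exact ENNReal.ofReal_le_ofReal (by linarith)

/-- An event of the initial stage on which the envelope dominates the target. -/
theorem exists_dominating_event {C C' C'' ε η : ℝ} (hK : KernelAssumption K₀ C C' C'' ε)
    (hε : 0 < ε) (hf : IsDensity f) (hg : IsDensity g) (hle : ∀ x, f x ≤ M * g x) (hs : 0 < s)
    (hM : 1 ≤ M) (hδ : 0 < δ) (hδ1 : δ < 1) (hH : 0 < H) (hη : η ≤ 1) (hn : 1 < n)
    (hT0 : 0 < initCalls d s n) (hT : 16 * M ^ 2 * Real.log (1 / δ) ≤ initCalls d s n)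
    (hN3 : Real.exp 1 ≤ Nbar d s M δ n) (hNn : Nbar d s M δ n ≤ n)
    (hr : 0 ≤ rBar d s M δ H n)
    (hex : ∀ k : ℕ, Nbar d s M δ n < k → ∃ Γ : Set (Fin k → EuclideanSpace ℝ (Fin d)),
      MeasurableSet Γ ∧ (Measure.pi fun _ => densityMeasure f).real Γᶜ ≤ η ∧
        ∀ x ∈ Γ, ∀ y, ‖y‖ ≤ Real.log k →
          f y ≤ 1 / k * ∑ j, scaledKernel K₀ (bandwidth d s δ k) y (x j) +
            H * bandwidth d s δ k ^ s) :
    ∃ G : Set (Fin (initCalls d s n) → EuclideanSpace ℝ (Fin d) × ℝ), MeasurableSet G ∧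
      (1 - η) * (1 - δ ^ 4) ≤ (stageOneLaw g s n).real G ∧
      ∀ w ∈ G, (∀ x, f x ≤ envelope K₀ f g s M δ H n w x) ∧
        Measurable (pliable K₀ f g s M δ H n w) ∧ (∀ x, 0 ≤ pliable K₀ f g s M δ H n w x) ∧
        Integrable (pliable K₀ f g s M δ H n w) ∧ ∫ x, pliable K₀ f g s M δ H n w x ≤ 1 := by
  have hM0 : 0 < M := one_pos.trans_le hM
  have := hf.isProbabilityMeasure
  have hN1 : 1 < Nbar d s M δ n := (Real.one_lt_exp_iff.2 one_pos).trans_le hN3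
  have hW0 := one_pos.trans_le (one_le_rejConst hr hM0 hg.nonneg)
  -- Sizes `k ≤ N̄` receive the empty set, so that `choose` yields a family indexed by all `k`.
  have hex' : ∀ k : ℕ, ∃ Γ : Set (Fin k → EuclideanSpace ℝ (Fin d)), Nbar d s M δ n < k →
      MeasurableSet Γ ∧ (Measure.pi fun _ => densityMeasure f).real Γᶜ ≤ η ∧
        ∀ x ∈ Γ, ∀ y, ‖y‖ ≤ Real.log k →
          f y ≤ 1 / k * ∑ j, scaledKernel K₀ (bandwidth d s δ k) y (x j) +
            H * bandwidth d s δ k ^ s := fun k => by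
    by_cases hk : Nbar d s M δ n < k
    · obtain ⟨Γ, h⟩ := hex k hk
      exact ⟨Γ, fun _ => h⟩
    · exact ⟨∅, fun h => absurd h hk⟩
  choose Γ hΓ using hex'
  have hΓm : ∀ k : ℕ, Nbar d s M δ n < k → MeasurableSet (Γ k) := fun k hk => (hΓ k hk).1
  refine ⟨goodEvent f (fun z => M * g z) (Nbar d s M δ n) Γ,
    measurableSet_goodEvent hf.measurable (hg.measurable.const_mul M) hΓm, ?_, fun w hw => ?_⟩
  · have h1 := mul_le_drawLaw_real_goodEvent (T := initCalls d s n) (η := η) hf hg hM0 hle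
      fun k hk => ⟨hΓm k hk, by
        have h := (hΓ k hk).2.1
        rw [probReal_compl_eq_one_sub (hΓm k hk)] at h
        linarith⟩
    have h2 := drawLaw_real_card_le_Nbar (n := n) (s := s) hf hg hM0 hle hδ hδ1 hT0
      ((mul_le_mul_of_nonneg_right (by nlinarith) (log_one_div_pos hδ hδ1).le).trans hT)
    exact (mul_le_mul_of_nonneg_left (sub_le_sub_left h2 1) (by linarith)).trans h1
  · obtain ⟨hcard, hbw, hdom⟩ := le_envelope_of_mem_goodEvent hK hM0 hg.nonneg hle hs hδ hδ1 hH hn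
      hN3 hNn (fun k hk => (hΓ k hk).2.2) hw
    obtain ⟨hint, hmass⟩ := integrable_pliable hK hε hM0 hf.measurable hg hr hn hN1 hcard hbw
    refine ⟨hdom, ?_, fun x => ?_, hint, hmass⟩
    · have := (measurable_pliable (hK.measurable hε) hf.measurable hg.measurable s M δ H n
        (initCalls d s n)).comp (measurable_prodMk_left (x := w))
      simpa only [Function.comp_def] using this
    · exact nonneg_of_mul_nonneg_right (envelope_nonneg hK hM0 hg.nonneg hr hbw x) hW0

end Run

end EPRS

end

/-! ### Assembly of the two stages -/

theorem theorem4 (d : ℕ) (hd : 1 ≤ d) (s : ℝ) (hs : 0 < s) (hs2 : s ≤ 2)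
    (C C' C'' ε c c' c'' a a' M H : ℝ)
    (hC : 0 < C) (hC' : 0 < C') (hC'' : 0 < C'') (hε : 0 < ε)
    (hc : 0 < c) (hc' : 0 < c') (hc'' : 0 < c'') (ha : 0 < a) (ha' : 0 < a') (hM : 0 < M)
    (hH : 0 < H) (hH₁ : EPRS.H₁ d s ε c c'' C C' C'' ≤ H) :
    ∃ κ : ℝ, 0 < κ ∧ ∀ δ : ℝ, 0 < δ → δ < 1 → ∃ n₀ : ℕ, ∀ n : ℕ, n₀ ≤ n →
      ∀ (K₀ : ℝ → ℝ) (f g : EuclideanSpace ℝ (Fin d) → ℝ),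
        EPRS.KernelAssumption K₀ C C' C'' ε →
        EPRS.TargetAssumption f s c c' c'' →
        EPRS.ProposalAssumption f g M a a' →
        ∃ G : Set (Fin (EPRS.initCalls d s n) → EuclideanSpace ℝ (Fin d) × ℝ),
          MeasurableSet G ∧
          (∀ w ∈ G, EPRS.OutputIID (EPRS.stageTwoLaw K₀ f g s M δ H n w) f
            (EPRS.envelope K₀ f g s M δ H n w)) ∧
          ENNReal.ofReal (1 - δ) ≤ EPRS.runLaw K₀ f g s M δ H n
            {ω | ω.1 ∈ G ∧
              (n : ℝ) * (1 - κ * Real.log (n / δ) ^ (d + 1) * (n : ℝ) ^ (-(s / (3 * s + d))))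
                ≤ EPRS.numOutput K₀ f g s M δ H n ω} := by
  refine ⟨EPRS.rejRate d M H a a' + 3,
    by linarith [EPRS.rejRate_nonneg (d := d) (a' := a') hM hH ha], fun δ hδ hδ1 => ?_⟩
  -- Integrating `f ≤ M g` gives `1 ≤ M`, so for smaller `M` no admissible pair exists.
  by_cases hM1 : 1 ≤ M
  swap
  · refine ⟨0, fun n _ K₀ f g _ hf hg => absurd ?_ hM1⟩
    have := integral_mono hf.isDensity.integrable (hg.isDensity.integrable.const_mul M) hg.le_mul
    rwa [integral_const_mul, hf.isDensity.integral_eq_one, hg.isDensity.integral_eq_one,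
      mul_one] at this
  -- The initial count fails with probability at most `δ^4`. What remains of `δ` is split between
  -- the uniform bound and the second-stage count.
  set η := (δ - δ ^ 4) / 2 with hη
  have hδ4 : δ ^ 4 < δ := by
    have := pow_lt_pow_right_of_lt_one₀ hδ hδ1 (by norm_num : 1 < 4)
    rwa [pow_one] at this
  have hη0 : 0 < η := by linarith
  have hδ40 : 0 < δ ^ 4 := by positivity
  -- The threshold `k₀` is fixed before `K₀` and `f`, so `n₀` depends only on the constants and `δ`.
  obtain ⟨k₀, hk₀⟩ := Filter.eventually_atTop.1 (EPRS.eventually_exists_uniform_event (C' := C') hd hs hs2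
    hC hC'' hε hc hc' hc'' hδ hδ1 hη0)
  have hT := EPRS.tendsto_initCalls hd hs
  have hNT : Filter.Tendsto (fun n => EPRS.Nbar d s M δ n) Filter.atTop Filter.atTop := by
    refine Filter.tendsto_atTop_mono' _ ?_ (hT.atTop_div_const (by positivity : 0 < 2 * M))
    filter_upwards [hT.eventually_ge_atTop (16 * M ^ 2 * Real.log (1 / δ))] with n hn
    exact EPRS.div_le_Nbar hM hn
  have hlogN := (Real.tendsto_log_atTop.comp hNT).const_mul_atTop ha'
  refine Filter.eventually_atTop.1 ?_
  filter_upwards [hT.eventually_ge_atTop (16 * M ^ 2 * Real.log (1 / δ)),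
    hT.eventually_gt_atTop 0, hNT.eventually_ge_atTop (Real.exp 1), hNT.eventually_ge_atTop k₀,
    hlogN.eventually_ge_atTop 2, EPRS.eventually_le_log_div 1 hδ hδ1,
    EPRS.eventually_fluctuation_le hd hs hη0, Filter.eventually_gt_atTop 1]
    with n hT16 hT0 hNe hNk hN2 hlog hfluc hn K₀ f g hK hf hg
  have hn1 : 1 ≤ n := hn.le
  have hn' : (1 : ℝ) ≤ n := by exact_mod_cast hn1
  have hlogn : 1 ≤ Real.log (n / δ) := hlog.1.trans hlog.2
  have hfd := hf.isDensity
  have hgd := hg.isDensity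
  have hNdiv := EPRS.div_le_Nbar hM hT16
  have hNn := EPRS.Nbar_le_self (δ := δ) hd hs hM1 hn1
  have hN1 : 1 < EPRS.Nbar d s M δ n := (Real.one_lt_exp_iff.2 one_pos).trans_le hNe
  have hr : 0 ≤ EPRS.rBar d s M δ H n := by
    refine EPRS.rBar_nonneg hH (Real.log_nonneg ?_) (by linarith)
    rw [le_div_iff₀ hδ]
    nlinarith
  have hW1 := EPRS.one_le_rejConst hr hM hgd.nonneg
  have hW0 := one_pos.trans_le hW1
  have hWle := EPRS.rejConst_le hd hs hM1 hH hδ hδ1 ha ha' hg hn1 hNdiv hN1.le hN2 hlogn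
  have hHle := (EPRS.kernel_const_le hd hs hε hC hC' hC'' hc hc'' rfl).trans hH₁
  obtain ⟨G, hG, hstage1, hGw⟩ := EPRS.exists_dominating_event (η := η) hK hε hfd hgd hg.le_mul hs
    hM1 hδ hδ1 hH (by linarith) hn (by exact_mod_cast hT0) hT16 hNe hNn hr fun k hk => by
      obtain ⟨Γ, hΓ, hp, hx⟩ := hk₀ k (by exact_mod_cast (hNk.trans hk.le)) K₀ f hK hf
      refine ⟨Γ, hΓ, hp, fun x hxΓ y hy => (hx x hxΓ y hy).trans ?_⟩
      have hk1 : 1 < (k : ℝ) := hN1.trans hk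
      have hbw : 0 < EPRS.bandwidth d s δ k := by
        refine EPRS.bandwidth_pos (by exact_mod_cast one_pos.trans hk1) (Real.log_pos ?_)
        rw [lt_div_iff₀ hδ]
        nlinarith
      gcongr
  refine ⟨G, hG, fun w hw => EPRS.outputIID_drawLaw hfd (hGw w hw).2.1 (hGw w hw).2.2.1 hW0
    (hGw w hw).1, ?_⟩
  have hprobOne : IsProbabilityMeasure (EPRS.stageOneLaw g s n) := by
    have := EPRS.isProbabilityMeasure_normalizedLaw hgd.integrable hgd.nonneg
      (by rw [hgd.integral_eq_one]; exact one_pos)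
    unfold EPRS.stageOneLaw EPRS.drawLaw
    infer_instance
  have hrun := EPRS.mul_le_runLaw (hK.measurable hε) hfd.measurable hgd.measurable s M δ H n
    hG
    (t := (n : ℝ) * (1 - (EPRS.rejRate d M H a a' + 3) * Real.log (n / δ) ^ (d + 1) *
      (n : ℝ) ^ (-(s / (3 * s + d)))))
    (a := ENNReal.ofReal ((1 - η) * (1 - δ ^ 4))) (b := ENNReal.ofReal (1 - η))
    (by
      rw [← ofReal_measureReal]
      exact ENNReal.ofReal_le_ofReal hstage1)
    (fun w hw => by
      obtain ⟨hle, hpm, hp0, hint, hmass⟩ := hGw w hw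
      refine EPRS.ofReal_le_stageTwoLaw (l := (n : ℝ) ^ (-(1 / 2 : ℝ)))
        (u := n * (n : ℝ) ^ (-(s / (3 * s + d)))) hfd hW0 hpm hint hp0 hle
        (by positivity) (Real.rpow_le_one_of_one_le_of_nonpos hn' (by norm_num)) ?_
        (hfluc _ (Nat.sub_le _ _))
      rw [mul_assoc (EPRS.rejRate d M H a a' + 3)]
      refine EPRS.mul_one_sub_le (EPRS.initCalls_le_self hd hs hn1) (EPRS.initCalls_le hd hs hn1)
        hW1 hWle (le_mul_of_one_le_left (by positivity) (one_le_pow₀ hlogn)) ?_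
      -- The proposal has mass at most one, so its acceptance probability `1 / (W ∫ q)` is at least
      -- `1 / W`.
      have hpos := one_pos.trans_le (hfd.one_le_mul_integral hint hle)
      exact one_div_le_one_div_of_le hpos (mul_le_of_le_one_right hW0.le hmass))
  refine le_trans ?_ hrun
  rw [← ENNReal.ofReal_mul (by linarith)]
  refine ENNReal.ofReal_le_ofReal ?_
  -- `(1 - η)² (1 - δ^4) ≥ 1 - 2η - δ^4 = 1 - δ`.
  nlinarith [mul_nonneg hη0.le hη0.le, mul_nonneg (mul_nonneg hη0.le hη0.le) hδ40.le]
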